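/- Oriented link diagrams are considered up to isotopy (planar isotopy and Reidemeister moves), and $L_+,L_-,L_0$ denote three oriented link diagrams that are the same except near one crossing, which is positive in $L_+$, negative in $L_-$, and smoothed compatibly with the orientations in $L_0$. (A crossing is positive if, with both strands pointing upwards, the upper strand goes from bottom left to top right.) There is a HOMFLY polynomial, that is, an isotopy invariant $P:\{\text{oriented link diagrams}\}\to\mathbb{C}[l^{\pm1},m^{\pm1}]$ with $P(\bigcirc)=1$ and $lP(L_+)+l^{-1}P(L_-)+mP(L_0)=0$. Let $D$, with values in $\mathbb{C}[s,s^{-1}]$, be its specialization $l=s$, $m=-2$. Then $D$ is an isotopy invariant of oriented links and satisfies $$D(\bigcirc)=1,\qquad sD(L_+)+s^{-1}D(L_-)-2D(L_0)=0 .$$ For $a\in\mathbb{Z}$ put $R^{[a]}_0(s)=(1-a)s^a$ and $R^{[a]}_1(s)=a\,s^{a-1}$. (Expansion formula.) Let $x_1,\dots,x_{n-1}$ be the Artin generators of the braid group on $n$ strands, where all strands are oriented downwards and in $x_i$ the strand from top left to bottom right is the upper one (so that the crossing $x_i$ is negative), and let $D_n(\beta)$ denote the value of $D$ on the closure of the $n$-braid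 $\beta$. For all $i_1,\dots,i_k\in\{1,\dots,n-1\}$ and $a_1,\dots,a_k\in\mathbb{Z}$, $$D_n(x_{i_1}^{a_1}\cdots x_{i_k}^{a_k})(s)=\sum_{0\le j_1,\dots,j_k\le1}R^{[a_1]}_{j_1}(s)\cdots R^{[a_k]}_{j_k}(s)\,D_n(x_{i_1}^{j_1}\cdots x_{i_k}^{j_k})(s).$$ (Relative expansion formula.) Let $\mathcal{L}(R_{k_1},\dots,R_{k_p})$, $k_1,\dots,k_p\in\mathbb{Z}$, be a family of oriented link diagrams with $p$ subdiagrams, the $t$-th of which is the braid $x_1^{k_t}$ on two parallel strands of the same orientation, the rest of the diagram being fixed, and write $D_{\mathcal{L}}(k_1,\dots,k_p)$ for the value of $D$ on it. Then for all $k_1,\dots,k_p\in\mathbb{Z}$ $$D_{\mathcal{L}}(k_1,\dots,k_p)(s)=\sum_{0\le j_1,\dots,j_p\le1}R^{[k_1]}_{j_1}(s)\cdots R^{[k_p]}_{j_p}(s)\,D_{\mathcal{L}}(j_1,\dots,j_p)(s).$$ -/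

import Mathlib

open LaurentPolynomial

namespace OrientedLink

/-! ### Oriented link diagrams

An oriented link diagram, in general position with respect to the height function of the plane, is
cut by horizontal lines into slices, each of which holds exactly one maximum, one minimum or one
crossing, next to vertical strands.  A diagram is recorded as the list of its slices, read from top
to bottom.  The strands met by a horizontal line are recorded, from left to right, by their
orientations: `true` for a strand that is oriented downwards, `false` for one oriented upwards. -/

/-- The non-trivial part of a slice.

* `birth e` is a local maximum; its left leg has orientation `e`, its right leg orientation `!e`.
* `death e` is a local minimum; its left leg has orientation `e`, its right leg orientation `!e`.
* `cross e f o` is a crossing of the strand from top left to bottom right, of orientation `e`, with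
  the strand from top right to bottom left, of orientation `f`; the strand from top left to bottom
  right is the upper one if `o = true`, and the lower one if `o = false`. -/
inductive Piece where
  | birth (e : Bool)
  | death (e : Bool)
  | cross (e f o : Bool)

/-- Orientations of the strands at the top of a piece. -/
def Piece.src : Piece → List Bool
  | .birth _ => []
  | .death e => [e, !e]
  | .cross e f _ => [e, f]

/-- Orientations of the strands at the bottom of a piece. -/
def Piece.tgt : Piece → List Bool
  | .birth e => [e, !e]
  | .death _ => []
  | .cross e f _ => [f, e]

/-- A slice: a piece with vertical strands to its left and to its right. -/
structure Slice where
  left : List Bool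
  piece : Piece
  right : List Bool

/-- Orientations of the strands at the top of a slice. -/
def Slice.src (s : Slice) : List Bool := s.left ++ s.piece.src ++ s.right

/-- Orientations of the strands at the bottom of a slice. -/
def Slice.tgt (s : Slice) : List Bool := s.left ++ s.piece.tgt ++ s.right

/-- `IsTangle a w b`: the slices of `w` fit together to an oriented tangle diagram whose strands at
the top are `a` and whose strands at the bottom are `b`. -/
def IsTangle : List Bool → List Slice → List Bool → Prop
  | a, [], b => a = b
  | a, s :: w, b => s.src = a ∧ IsTangle s.tgt w b

theorem IsTangle.append {a b c : List Bool} {v w : List Slice} (hv : IsTangle a v b)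
    (hw : IsTangle b w c) : IsTangle a (v ++ w) c := by
  induction v generalizing a with
  | nil => cases hv; exact hw
  | cons s v ih => exact ⟨hv.1, ih hv.2⟩

/-- An oriented link diagram: an oriented tangle diagram without ends. -/
structure LinkDiagram where
  word : List Slice
  closed : IsTangle [] word []

/-! ### Isotopy -/

/-- The local moves between sliced oriented diagrams: `exchange`, `zigzagLeft`, `zigzagRight`,
`slideBirth` and `slideDeath` generate the isotopies of the plane (change of the relative heights of
distant pieces, cancellation of a maximum against a minimum, passage of a crossing through a
maximum or a minimum); the others are the three Reidemeister moves. -/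
inductive LocalMove : List Slice → List Slice → Prop
  | exchange (l m r : List Bool) (x y : Piece) :
      LocalMove [⟨l, x, m ++ y.src ++ r⟩, ⟨l ++ x.tgt ++ m, y, r⟩]
        [⟨l ++ x.src ++ m, y, r⟩, ⟨l, x, m ++ y.tgt ++ r⟩]
  | zigzagLeft (l r : List Bool) (e : Bool) :
      LocalMove [⟨l ++ [e], .birth (!e), r⟩, ⟨l, .death e, [e] ++ r⟩] []
  | zigzagRight (l r : List Bool) (e : Bool) :
      LocalMove [⟨l, .birth e, [e] ++ r⟩, ⟨l ++ [e], .death (!e), r⟩] []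
  | slideBirth (l r : List Bool) (e f o : Bool) :
      LocalMove [⟨l ++ [f], .birth e, r⟩, ⟨l, .cross f e o, [!e] ++ r⟩]
        [⟨l, .birth e, [f] ++ r⟩, ⟨l ++ [e], .cross (!e) f (!o), r⟩]
  | slideDeath (l r : List Bool) (e f o : Bool) :
      LocalMove [⟨l, .cross e f o, [!e] ++ r⟩, ⟨l ++ [f], .death e, r⟩]
        [⟨l ++ [e], .cross f (!e) (!o), r⟩, ⟨l, .death e, [f] ++ r⟩]
  | reidemeisterOneBirth (l r : List Bool) (e o : Bool) :
      LocalMove [⟨l, .birth e, r⟩, ⟨l, .cross e (!e) o, r⟩] [⟨l, .birth (!e), r⟩]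
  | reidemeisterOneDeath (l r : List Bool) (e o : Bool) :
      LocalMove [⟨l, .cross e (!e) o, r⟩, ⟨l, .death (!e), r⟩] [⟨l, .death e, r⟩]
  | reidemeisterTwo (l r : List Bool) (e f o : Bool) :
      LocalMove [⟨l, .cross e f o, r⟩, ⟨l, .cross f e (!o), r⟩] []
  /-- The bits `oab`, `oac`, `obc` say which of two strands is the upper one; the condition says
  that the three strands lie one above the other in some order. -/
  | reidemeisterThree (l r : List Bool) (a b c oab oac obc : Bool) (h : oab = obc → oac = oab) :
      LocalMove
        [⟨l, .cross a b oab, [c] ++ r⟩, ⟨l ++ [b], .cross a c oac, r⟩,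
          ⟨l, .cross b c obc, [a] ++ r⟩]
        [⟨l ++ [a], .cross b c obc, r⟩, ⟨l, .cross a c oac, [b] ++ r⟩,
          ⟨l ++ [c], .cross a b oab, r⟩]

/-- Two link diagrams differ by one local move. -/
def Step (L L' : LinkDiagram) : Prop :=
  ∃ p q v w : List Slice, LocalMove v w ∧ L.word = p ++ v ++ q ∧ L'.word = p ++ w ++ q

/-- Two link diagrams represent isotopic oriented links. -/
def Isotopic : LinkDiagram → LinkDiagram → Prop := Relation.EqvGen Step

/-- A function on link diagrams is a link invariant. -/
def IsLinkInvariant {α : Type*} (F : LinkDiagram → α) : Prop :=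
  ∀ L L' : LinkDiagram, Isotopic L L' → F L = F L'

/-! ### Skein triples -/

/-- A crossing is positive if the upper strand, turned counterclockwise by less than a straight
angle, takes the direction of the lower one. -/
def positiveCrossing (e f : Bool) : Piece := .cross e f (xor e f)

/-- The mirror image of the positive crossing. -/
def negativeCrossing (e f : Bool) : Piece := .cross e f (!(xor e f))

/-- The smoothing of a crossing that respects the orientations: two vertical strands if both strands
go down or both go up, and a minimum above a maximum otherwise. -/
def smoothing (l r : List Bool) (e f : Bool) : List Slice :=
  if e = f then [] else [⟨l, .death e, r⟩, ⟨l, .birth f, r⟩]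

/-- `Lp`, `Lm`, `L0` are the same except near one crossing, which is positive in `Lp`, negative in
`Lm` and smoothed in `L0`. -/
def SkeinTriple (Lp Lm L0 : LinkDiagram) : Prop :=
  ∃ (p q : List Slice) (l r : List Bool) (e f : Bool),
    Lp.word = p ++ [⟨l, positiveCrossing e f, r⟩] ++ q ∧
    Lm.word = p ++ [⟨l, negativeCrossing e f, r⟩] ++ q ∧
    L0.word = p ++ smoothing l r e f ++ q

/-- The diagram of the unknot without crossings. -/
def unknot : LinkDiagram :=
  ⟨[⟨[], .birth true, []⟩, ⟨[], .death true, []⟩], rfl, rfl, rfl⟩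

/-! ### The HOMFLY polynomial and its degenerate specialization -/

/-- The ring `ℂ[l, l⁻¹, m, m⁻¹]`, as Laurent polynomials in `m` over `ℂ[l, l⁻¹]`. -/
abbrev HomflyRing : Type := LaurentPolynomial (LaurentPolynomial ℂ)

/-- The monomial `l ^ k`. -/
noncomputable def lPow (k : ℤ) : HomflyRing := C (T k)

/-- The variable `m`. -/
noncomputable def mVar : HomflyRing := T 1

/-- `P` is the HOMFLY polynomial: a link invariant with the value `1` on the unknot and the skein
relation `l P(L₊) + l⁻¹ P(L₋) + m P(L₀) = 0`.  (Nothing is said on the empty diagram.) -/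
structure IsHomfly (P : LinkDiagram → HomflyRing) : Prop where
  invariant : IsLinkInvariant P
  normalized : P unknot = 1
  skein : ∀ Lp Lm L0 : LinkDiagram, SkeinTriple Lp Lm L0 →
    lPow 1 * P Lp + lPow (-1) * P Lm + mVar * P L0 = 0

/-- The constant `-2`, as a unit of `ℂ[s, s⁻¹]`. -/
noncomputable def negTwo : (ℂ[T;T⁻¹])ˣ :=
  Units.map (C : ℂ →+* ℂ[T;T⁻¹]).toMonoidHom (Units.mk0 (-2 : ℂ) (by norm_num))

/-- The specialization `l = s`, `m = -2`, with values in `ℂ[s, s⁻¹]`. -/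
noncomputable def specialize : HomflyRing →+* ℂ[T;T⁻¹] :=
  LaurentPolynomial.eval₂ (RingHom.id ℂ[T;T⁻¹]) negTwo

/-- The degenerate polynomial that is obtained from the HOMFLY polynomial `P`. -/
noncomputable def degenerate (P : LinkDiagram → HomflyRing) (L : LinkDiagram) : ℂ[T;T⁻¹] :=
  specialize (P L)

/-- The coefficients `R₀^[a] = (1 - a) s ^ a` and `R₁^[a] = a s ^ (a - 1)`. -/
noncomputable def R (a : ℤ) (j : Fin 2) : ℂ[T;T⁻¹] :=
  if j = 0 then (1 - (a : ℂ[T;T⁻¹])) * T a else (a : ℂ[T;T⁻¹]) * T (a - 1)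

/-! ### Twists, closed braids and families of diagrams with twist regions -/

/-- The braid `x ^ k` on two adjacent strands of the same orientation `e`.  The generator `x` is the
crossing in which the strand from top left to bottom right is the upper one; with both strands going
down it is the generator of the braid group, and with both strands going up it is the same picture,
turned by a straight angle. -/
def twist (l r : List Bool) (e : Bool) (k : ℤ) : List Slice :=
  List.replicate k.natAbs ⟨l, .cross e e (decide (0 < k)), r⟩

theorem isTangle_twist (l r : List Bool) (e : Bool) (k : ℤ) :
    IsTangle (l ++ [e, e] ++ r) (twist l r e k) (l ++ [e, e] ++ r) := by
  unfold twist
  induction k.natAbs with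
  | zero => rfl
  | succ n ih => exact ⟨rfl, ih⟩

/-- `n` nested maxima: `n` strands going down, and to their right `n` strands going up. -/
def openArcs (n : ℕ) : List Slice :=
  (List.range n).map fun t => ⟨List.replicate t true, .birth true, List.replicate t false⟩

/-- `n` nested minima, which close the strands that `openArcs n` begins. -/
def closeArcs (n : ℕ) : List Slice :=
  (List.range n).reverse.map fun t => ⟨List.replicate t true, .death true, List.replicate t false⟩

/-- The power `x_(i+1) ^ a` of a generator of the braid group on `n` strands, drawn on the `n` strands
going down, with the `n` closing strands to the right.  (Generators are numbered from `0` here.) -/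
def braidPower (n : ℕ) (i : Fin (n - 1)) (a : ℤ) : List Slice :=
  twist (List.replicate i true) (List.replicate (n - 2 - i) true ++ List.replicate n false) true a

/-- The braid word `x_(i 0 + 1) ^ (a 0) ⋯ x_(i (k-1) + 1) ^ (a (k-1))` on `n` strands. -/
def braidWord (n : ℕ) {k : ℕ} (i : Fin k → Fin (n - 1)) (a : Fin k → ℤ) : List Slice :=
  (List.ofFn fun t => braidPower n (i t) (a t)).flatten

theorem isTangle_openArcs (n : ℕ) :
    IsTangle [] (openArcs n) (List.replicate n true ++ List.replicate n false) := by
  induction n with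
  | zero => rfl
  | succ n ih =>
    rw [openArcs, List.range_succ, List.map_append]
    refine IsTangle.append ih ⟨?_, ?_⟩
    · simp [Slice.src, Piece.src]
    · change Slice.tgt _ = _
      simp only [Slice.tgt, Piece.tgt]
      rw [List.replicate_succ', List.replicate_succ]
      simp

theorem isTangle_closeArcs (n : ℕ) :
    IsTangle (List.replicate n true ++ List.replicate n false) (closeArcs n) [] := by
  induction n with
  | zero => rfl
  | succ n ih =>
    rw [closeArcs, List.range_succ, List.reverse_append, List.map_append]
    refine ⟨?_, ?_⟩
    · simp only [Slice.src, Piece.src]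
      rw [List.replicate_succ', List.replicate_succ]
      simp
    · simpa [Slice.tgt, Piece.tgt, closeArcs] using ih

theorem isTangle_flatten (b : List Bool) (ws : List (List Slice))
    (h : ∀ w ∈ ws, IsTangle b w b) : IsTangle b ws.flatten b := by
  induction ws with
  | nil => rfl
  | cons w ws ih =>
    rw [List.flatten_cons]
    exact (h w (by simp)).append (ih fun v hv => h v (by simp [hv]))

theorem isTangle_braidPower (n : ℕ) (i : Fin (n - 1)) (a : ℤ) :
    IsTangle (List.replicate n true ++ List.replicate n false) (braidPower n i a)
      (List.replicate n true ++ List.replicate n false) := by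
  have h : List.replicate n true ++ List.replicate n false =
      List.replicate i true ++ [true, true] ++
        (List.replicate (n - 2 - i) true ++ List.replicate n false) := by
    have hi := i.2
    have h2 : ([true, true] : List Bool) = List.replicate 2 true := rfl
    rw [h2, ← List.append_assoc, List.replicate_append_replicate, List.replicate_append_replicate]
    congr 2
    omega
  have key := isTangle_twist (List.replicate i true)
    (List.replicate (n - 2 - i) true ++ List.replicate n false) true a
  rw [← h] at key
  exact key

/-- The closure of the `n`-braid `x_(i 0 + 1) ^ (a 0) ⋯ x_(i (k-1) + 1) ^ (a (k-1))`. -/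
def closedBraid (n : ℕ) {k : ℕ} (i : Fin k → Fin (n - 1)) (a : Fin k → ℤ) : LinkDiagram where
  word := openArcs n ++ braidWord n i a ++ closeArcs n
  closed := by
    refine ((isTangle_openArcs n).append (isTangle_flatten _ _ ?_)).append (isTangle_closeArcs n)
    intro w hw
    obtain ⟨t, rfl⟩ := (List.mem_ofFn' _ _).1 hw
    exact isTangle_braidPower n (i t) (a t)

/-- A family of link diagrams `𝓛(R_(k 0), …, R_(k (p-1)))`: the `j`-th subdiagram `R_(k j)` is the
braid `x ^ (k j)` on two adjacent strands with the common orientation `orient j`, and the rest of the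
diagram is fixed; it consists of the parts `above j` between two successive subdiagrams and of the
part `below` under the last one. -/
structure TwistFamily (p : ℕ) where
  above : Fin p → List Slice
  left : Fin p → List Bool
  right : Fin p → List Bool
  orient : Fin p → Bool
  below : List Slice
  closed : ∀ k : Fin p → ℤ, IsTangle []
    ((List.ofFn fun j => above j ++ twist (left j) (right j) (orient j) (k j)).flatten ++ below) []

/-- The member `𝓛(R_(k 0), …, R_(k (p-1)))` of the family. -/
def TwistFamily.diagram {p : ℕ} (F : TwistFamily p) (k : Fin p → ℤ) : LinkDiagram where
  word := (List.ofFn fun j =>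
    F.above j ++ twist (F.left j) (F.right j) (F.orient j) (k j)).flatten ++ F.below
  closed := F.closed k

end OrientedLink

/-! ### Skein theory of tangles: every non-empty diagram reduces to the unknot. -/

namespace OrientedLink

/-! ### Isotopy of tangles -/

/-! Expansion formulas. On two parallel strands the generator x is a negative crossing, so x^(k-1),
x^(k+1), x^k form a skein triple: if f(k) is the value of D on diagrams that differ only in one
twist region x^k, then s f(k-1) + s⁻¹ f(k+1) = 2 f(k). Hence g(k) = s^(-k) f(k) satisfies g(k+1) +
g(k-1) = 2 g(k). The choice m = -2 gives this recurrence a double root, so g is affine in k, which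
is f(k) = R₀^[k] f(0) + R₁^[k] f(1). Expanding one region after the other gives the products
(`degenerate_twist`, `eq_sum_R_mul`, `eq_sum_prod_R_mul`). Closed braids and twist families are both
instances of `degenerate_expansion`. This half uses only the defining properties of a HOMFLY
polynomial.

Existence combines two arguments, neither of which suffices alone. The vertex model of quantum gl_N
attaches to a diagram, for every N and every q ≠ 0, a state sum that is invariant under all moves
(`LocalMove.stateSum_eq`) and satisfies the skein relation with l = i q^N and m = -i (q - q⁻¹)
(`stateSum_skein`). This yields infinitely many numerical invariants, but no polynomial in two free
variables. Skein theory, on the other hand, reduces every non-empty diagram to the unknot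
(`gen_unknot`); this yields a Laurent polynomial, which might depend on the reduction. Following a
reduction shows that some Laurent polynomial interpolates the normalized state sums at all points q
= n + 2, N = k + 1 (`Gen.interpolates`). These points determine it (`Interpolates.unique`), so it
depends on the diagram only, and invariance and skein relation pass from the numbers to the
polynomials.

The reduction (`gen_standard`) reads a diagram from top to bottom and keeps it a combination of
standard ones: nested maxima, followed by crossings only, in which strands going down pass over
strands going up. A new maximum is slid in among the nested ones. A new minimum is slid to the
middle, where it closes the last strand of a braid. As in the theory of Hecke algebras, a braid is a
combination of words in which the last generator occurs at most once, and closing the last strand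
then splits off a circle or removes a curl (`gen_partial_closure`). -/

theorem isTangle_append {a c : List Bool} {v w : List Slice} :
    IsTangle a (v ++ w) c ↔ ∃ b, IsTangle a v b ∧ IsTangle b w c := by
  refine ⟨fun h => ?_, fun ⟨b, hv, hw⟩ => hv.append hw⟩
  induction v generalizing a with
  | nil => exact ⟨a, rfl, h⟩
  | cons s v ih =>
    obtain ⟨b, h1, h2⟩ := ih h.2
    exact ⟨b, ⟨h.1, h1⟩, h2⟩

theorem isTangle_singleton {a b : List Bool} {s : Slice} :
    IsTangle a [s] b ↔ s.src = a ∧ s.tgt = b := Iff.rfl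

theorem IsTangle.single (s : Slice) : IsTangle s.src [s] s.tgt := ⟨rfl, rfl⟩

/-- Adds vertical strands to the left and to the right of a slice. -/
def Slice.shift (l r : List Bool) (s : Slice) : Slice := ⟨l ++ s.left, s.piece, s.right ++ r⟩

/-- Adds vertical strands to the left and to the right of a tangle diagram. -/
def shift (l r : List Bool) (w : List Slice) : List Slice := w.map (Slice.shift l r)

@[simp] theorem shift_nil (l r : List Bool) : shift l r [] = [] := rfl

@[simp] theorem shift_cons (l r : List Bool) (s : Slice) (w : List Slice) :
    shift l r (s :: w) = s.shift l r :: shift l r w := rfl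

@[simp] theorem shift_append (l r : List Bool) (v w : List Slice) :
    shift l r (v ++ w) = shift l r v ++ shift l r w := List.map_append

@[simp] theorem Slice.shift_mk (l r l' r' : List Bool) (x : Piece) :
    Slice.shift l r ⟨l', x, r'⟩ = ⟨l ++ l', x, r' ++ r⟩ := rfl

@[simp] theorem Slice.shift_shift (l r l' r' : List Bool) (s : Slice) :
    (s.shift l' r').shift l r = s.shift (l ++ l') (r' ++ r) := by
  simp [Slice.shift]

@[simp] theorem shift_shift (l r l' r' : List Bool) (w : List Slice) :
    shift l r (shift l' r' w) = shift (l ++ l') (r' ++ r) w := by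
  simp [shift, Function.comp_def]

@[simp] theorem shift_nil_nil (w : List Slice) : shift [] [] w = w := by
  induction w with
  | nil => rfl
  | cons s w ih => simp [ih, Slice.shift]

theorem Slice.shift_src (l r : List Bool) (s : Slice) : (s.shift l r).src = l ++ s.src ++ r := by
  simp [Slice.shift, Slice.src]

theorem Slice.shift_tgt (l r : List Bool) (s : Slice) : (s.shift l r).tgt = l ++ s.tgt ++ r := by
  simp [Slice.shift, Slice.tgt]

theorem IsTangle.shift {a b : List Bool} {w : List Slice} (h : IsTangle a w b)
    (l r : List Bool) : IsTangle (l ++ a ++ r) (shift l r w) (l ++ b ++ r) := by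
  induction w generalizing a with
  | nil => cases h; rfl
  | cons s w ih =>
    refine ⟨by rw [Slice.shift_src, h.1], ?_⟩
    rw [Slice.shift_tgt]
    exact ih h.2

theorem LocalMove.shift {v w : List Slice} (h : LocalMove v w) (l r : List Bool) :
    LocalMove (shift l r v) (shift l r w) := by
  cases h with
  | exchange l' m r' x y => simpa using LocalMove.exchange (l ++ l') m (r' ++ r) x y
  | zigzagLeft l' r' e => simpa using LocalMove.zigzagLeft (l ++ l') (r' ++ r) e
  | zigzagRight l' r' e => simpa using LocalMove.zigzagRight (l ++ l') (r' ++ r) e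
  | slideBirth l' r' e f o => simpa using LocalMove.slideBirth (l ++ l') (r' ++ r) e f o
  | slideDeath l' r' e f o => simpa using LocalMove.slideDeath (l ++ l') (r' ++ r) e f o
  | reidemeisterOneBirth l' r' e o =>
    simpa using LocalMove.reidemeisterOneBirth (l ++ l') (r' ++ r) e o
  | reidemeisterOneDeath l' r' e o =>
    simpa using LocalMove.reidemeisterOneDeath (l ++ l') (r' ++ r) e o
  | reidemeisterTwo l' r' e f o => simpa using LocalMove.reidemeisterTwo (l ++ l') (r' ++ r) e f o
  | reidemeisterThree l' r' a b c oab oac obc h =>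
    simpa using LocalMove.reidemeisterThree (l ++ l') (r' ++ r) a b c oab oac obc h

/-- `TangleEq a b v w`: the diagrams `v` and `w` represent isotopic tangles from `a` to `b`. -/
inductive TangleEq (a b : List Bool) : List Slice → List Slice → Prop
  | refl {w : List Slice} (h : IsTangle a w b) : TangleEq a b w w
  | move (p q : List Slice) {v w : List Slice} (h : LocalMove v w)
      (hv : IsTangle a (p ++ v ++ q) b) (hw : IsTangle a (p ++ w ++ q) b) :
      TangleEq a b (p ++ v ++ q) (p ++ w ++ q)
  | symm {v w : List Slice} : TangleEq a b v w → TangleEq a b w v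
  | trans {u v w : List Slice} : TangleEq a b u v → TangleEq a b v w → TangleEq a b u w

namespace TangleEq

variable {a b c : List Bool} {u v w : List Slice}

theorem both (h : TangleEq a b v w) : IsTangle a v b ∧ IsTangle a w b := by
  induction h with
  | refl h => exact ⟨h, h⟩
  | move p q h hv hw => exact ⟨hv, hw⟩
  | symm _ ih => exact ih.symm
  | trans _ _ ih1 ih2 => exact ⟨ih1.1, ih2.2⟩

theorem left (h : TangleEq a b v w) : IsTangle a v b := h.both.1

theorem right (h : TangleEq a b v w) : IsTangle a w b := h.both.2

theorem of_move (h : LocalMove v w) (hv : IsTangle a v b) (hw : IsTangle a w b) :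
    TangleEq a b v w := by
  simpa using TangleEq.move [] [] h (by simpa using hv) (by simpa using hw)

/-- Isotopies are local, so a move computed on a few strands may be used inside any larger diagram.
-/
theorem context {a' b' : List Bool} {p q : List Slice} (hp : IsTangle a' p a)
    (hq : IsTangle b q b') (h : TangleEq a b v w) : TangleEq a' b' (p ++ v ++ q) (p ++ w ++ q) := by
  induction h with
  | refl h => exact .refl ((hp.append h).append hq)
  | @move p' q' v w h hv hw =>
    have := TangleEq.move (a := a') (b := b') (p ++ p') (q' ++ q) h
      (by simpa using (hp.append hv).append hq) (by simpa using (hp.append hw).append hq)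
    simpa using this
  | symm _ ih => exact ih.symm
  | trans _ _ ih1 ih2 => exact ih1.trans ih2

theorem append {v' w' : List Slice} (h : TangleEq a b v w) (h' : TangleEq b c v' w') :
    TangleEq a c (v ++ v') (w ++ w') := by
  have h1 := context (p := []) (a' := a) rfl h'.left h
  have h2 := context (q := []) (b' := c) h.right rfl h'
  simpa using h1.trans (by simpa using h2)

theorem append_left (hu : IsTangle a u b) (h : TangleEq b c v w) :
    TangleEq a c (u ++ v) (u ++ w) := (TangleEq.refl hu).append h

theorem append_right (h : TangleEq a b v w) (hu : IsTangle b u c) :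
    TangleEq a c (v ++ u) (w ++ u) := h.append (.refl hu)

theorem shift (h : TangleEq a b v w) (l r : List Bool) :
    TangleEq (l ++ a ++ r) (l ++ b ++ r) (shift l r v) (OrientedLink.shift l r w) := by
  induction h with
  | refl h => exact .refl (h.shift l r)
  | move p q h hv hw =>
    have hv' := hv.shift l r
    have hw' := hw.shift l r
    simp only [shift_append] at hv' hw' ⊢
    exact .move _ _ (h.shift l r) hv' hw'
  | symm _ ih => exact ih.symm
  | trans _ _ ih1 ih2 => exact ih1.trans ih2

end TangleEq

theorem TangleEq.interchange_slice (s t : Slice) :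
    TangleEq (s.src ++ t.src) (s.tgt ++ t.tgt) [s.shift [] t.src, t.shift s.tgt []]
      [t.shift s.src [], s.shift [] t.tgt] := by
  obtain ⟨l, x, r⟩ := s
  obtain ⟨l', y, r'⟩ := t
  refine .of_move ?_ ?_ ?_
  · simpa [Slice.src, Slice.tgt] using LocalMove.exchange l (r ++ l') r' x y
  · simp [IsTangle, Slice.src, Slice.tgt]
  · simp [IsTangle, Slice.src, Slice.tgt]

/-- Tangles side by side can be moved up and down independently of each other. -/
theorem TangleEq.interchange {a a' c c' : List Bool} {v w : List Slice} (hv : IsTangle a v a')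
    (hw : IsTangle c w c') :
    TangleEq (a ++ c) (a' ++ c') (OrientedLink.shift [] c v ++ OrientedLink.shift a' [] w)
      (OrientedLink.shift a [] w ++ OrientedLink.shift [] c' v) := by
  induction v generalizing a with
  | nil =>
    obtain rfl : a = a' := hv
    simpa using TangleEq.refl (hw.shift a [])
  | cons s v ih =>
    obtain ⟨rfl, hv⟩ := hv
    -- The single slice `s` sinks below all of `w`; the outer induction then treats the slices of
    -- `v` one by one.
    have key : TangleEq (s.src ++ c) (s.tgt ++ c')
        ([s.shift [] c] ++ OrientedLink.shift s.tgt [] w)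
        (OrientedLink.shift s.src [] w ++ [s.shift [] c']) := by
      clear ih hv
      induction w generalizing c with
      | nil =>
        obtain rfl : c = c' := hw
        simpa using TangleEq.refl ((IsTangle.single s).shift [] c)
      | cons t w ih =>
        obtain ⟨rfl, hw⟩ := hw
        have h1 := (TangleEq.interchange_slice s t).append_right
          (by simpa using hw.shift s.tgt [])
        have h2 := TangleEq.append_left
          (by simpa using (IsTangle.single t).shift s.src []) (ih hw)
        simpa using h1.trans (by simpa using h2)
    have h1 := TangleEq.append_left
      (by simpa using (IsTangle.single s).shift [] c) (ih hv)
    have h2 := key.append_right (by simpa using hv.shift [] c')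
    simpa using h1.trans (by simpa using h2)

/-! ### Linear combinations of diagrams modulo the skein relation -/

/-- `Gen a b S w`: the tangle diagram `w` from `a` to `b` is obtained from members of `S` by isotopy,
by the skein relation and by the insertion of circles. -/
inductive Gen (a b : List Bool) (S : List Slice → Prop) : List Slice → Prop
  | base {w : List Slice} : S w → Gen a b S w
  | iso {v w : List Slice} : TangleEq a b v w → Gen a b S w → Gen a b S v
  | pos (p q : List Slice) (l r : List Bool) (e f : Bool) :
      IsTangle a (p ++ [⟨l, positiveCrossing e f, r⟩] ++ q) b →
      Gen a b S (p ++ [⟨l, negativeCrossing e f, r⟩] ++ q) →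
      Gen a b S (p ++ smoothing l r e f ++ q) →
      Gen a b S (p ++ [⟨l, positiveCrossing e f, r⟩] ++ q)
  | neg (p q : List Slice) (l r : List Bool) (e f : Bool) :
      IsTangle a (p ++ [⟨l, negativeCrossing e f, r⟩] ++ q) b →
      Gen a b S (p ++ [⟨l, positiveCrossing e f, r⟩] ++ q) →
      Gen a b S (p ++ smoothing l r e f ++ q) →
      Gen a b S (p ++ [⟨l, negativeCrossing e f, r⟩] ++ q)
  | circle (p q : List Slice) (l r : List Bool) :
      IsTangle a (p ++ [⟨l, .birth true, r⟩, ⟨l, .death true, r⟩] ++ q) b →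
      Gen a b S (p ++ q) →
      Gen a b S (p ++ [⟨l, .birth true, r⟩, ⟨l, .death true, r⟩] ++ q)

namespace Gen

variable {a b : List Bool} {S : List Slice → Prop}

/-- Substitution of diagrams into a larger diagram. -/
theorem context {a' b' : List Bool} {T : List Slice → Prop} {p q w : List Slice}
    (hp : IsTangle a' p a) (hq : IsTangle b q b') (h : Gen a b S w)
    (hST : ∀ v, S v → Gen a' b' T (p ++ v ++ q)) : Gen a' b' T (p ++ w ++ q) := by
  induction h with
  | base h => exact hST _ h
  | iso h _ ih => exact .iso (h.context hp hq) ih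
  | pos p' q' l r e f h _ _ ih1 ih2 =>
    have := Gen.pos (a := a') (b := b') (S := T) (p ++ p') (q' ++ q) l r e f
      (by simpa using (hp.append h).append hq) (by simpa using ih1) (by simpa using ih2)
    simpa using this
  | neg p' q' l r e f h _ _ ih1 ih2 =>
    have := Gen.neg (a := a') (b := b') (S := T) (p ++ p') (q' ++ q) l r e f
      (by simpa using (hp.append h).append hq) (by simpa using ih1) (by simpa using ih2)
    simpa using this
  | circle p' q' l r h _ ih =>
    have := Gen.circle (a := a') (b := b') (S := T) (p ++ p') (q' ++ q) l r
      (by simpa using (hp.append h).append hq) (by simpa using ih)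
    simpa using this

/-- A crossing may be switched at the expense of its smoothing. -/
theorem switch (p q : List Slice) (l r : List Bool) (e f o : Bool)
    (h : IsTangle a (p ++ [⟨l, .cross e f o, r⟩] ++ q) b)
    (h1 : Gen a b S (p ++ [⟨l, .cross e f (!o), r⟩] ++ q))
    (h0 : Gen a b S (p ++ smoothing l r e f ++ q)) :
    Gen a b S (p ++ [⟨l, .cross e f o, r⟩] ++ q) := by
  rcases eq_or_ne o (xor e f) with rfl | ho
  · exact .pos p q l r e f h h1 h0
  · obtain rfl : o = !(xor e f) := by cases o <;> cases e <;> cases f <;> simp_all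
    exact .neg p q l r e f h (by simpa [positiveCrossing] using h1) h0

end Gen

/-! ### Crossings in which the strands going down pass over the strands going up -/

/-- Crossings of two parallel strands, and crossings in which a strand going down passes over a
strand going up. -/
def Slice.IsDescending (s : Slice) : Prop :=
  ∃ l r e f o, s = ⟨l, .cross e f o, r⟩ ∧ (e ≠ f → o = e)

/-- A tangle diagram in which all slices are crossings and strands going down pass over strands going
up. -/
def IsDescendingTangle (a : List Bool) (w : List Slice) (b : List Bool) : Prop :=
  IsTangle a w b ∧ ∀ s ∈ w, s.IsDescending

theorem isTangle_cross (l r : List Bool) (e f o : Bool) :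
    IsTangle (l ++ [e, f] ++ r) [⟨l, .cross e f o, r⟩] (l ++ [f, e] ++ r) := ⟨rfl, rfl⟩

theorem isTangle_birth (l r : List Bool) (e : Bool) :
    IsTangle (l ++ r) [⟨l, .birth e, r⟩] (l ++ [e, !e] ++ r) := by
  simp [IsTangle, Slice.src, Slice.tgt, Piece.src, Piece.tgt]

theorem isTangle_death (l r : List Bool) (e : Bool) :
    IsTangle (l ++ [e, !e] ++ r) [⟨l, .death e, r⟩] (l ++ r) := by
  simp [IsTangle, Slice.src, Slice.tgt, Piece.src, Piece.tgt]

theorem TangleEq.cross_cancel (l r : List Bool) (e f o : Bool) :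
    TangleEq (l ++ [e, f] ++ r) (l ++ [e, f] ++ r)
      [⟨l, .cross e f o, r⟩, ⟨l, .cross f e (!o), r⟩] [] :=
  .of_move (.reidemeisterTwo l r e f o) ⟨rfl, rfl, rfl⟩ rfl

theorem TangleEq.cross_cancel' (l r : List Bool) (e f o : Bool) :
    TangleEq (l ++ [e, f] ++ r) (l ++ [e, f] ++ r)
      [⟨l, .cross e f (!o), r⟩, ⟨l, .cross f e o, r⟩] [] := by
  simpa using TangleEq.cross_cancel l r e f (!o)

namespace IsDescendingTangle

variable {a b c : List Bool} {v w : List Slice}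

theorem nil (a : List Bool) : IsDescendingTangle a [] a := ⟨rfl, by simp⟩

theorem append (hv : IsDescendingTangle a v b) (hw : IsDescendingTangle b w c) :
    IsDescendingTangle a (v ++ w) c :=
  ⟨hv.1.append hw.1, fun s hs => (List.mem_append.1 hs).elim (hv.2 s) (hw.2 s)⟩

theorem cross (l r : List Bool) {e f o : Bool} (h : e ≠ f → o = e) :
    IsDescendingTangle (l ++ [e, f] ++ r) [⟨l, .cross e f o, r⟩] (l ++ [f, e] ++ r) :=
  ⟨isTangle_cross l r e f o, by simpa using ⟨l, r, e, f, o, rfl, h⟩⟩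

theorem shift (h : IsDescendingTangle a w b) (l r : List Bool) :
    IsDescendingTangle (l ++ a ++ r) (shift l r w) (l ++ b ++ r) := by
  refine ⟨h.1.shift l r, fun s hs => ?_⟩
  obtain ⟨t, ht, rfl⟩ := List.mem_map.1 hs
  obtain ⟨l', r', e, f, o, rfl, h⟩ := h.2 t ht
  exact ⟨l ++ l', r' ++ r, e, f, o, rfl, h⟩

theorem of_cons {s : Slice} (h : IsDescendingTangle a (s :: w) b) :
    ∃ l r e f o, s = ⟨l, .cross e f o, r⟩ ∧ (e ≠ f → o = e) ∧ a = l ++ [e, f] ++ r ∧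
      IsDescendingTangle (l ++ [f, e] ++ r) w b := by
  obtain ⟨l, r, e, f, o, rfl, he⟩ := h.2 s (by simp)
  exact ⟨l, r, e, f, o, rfl, he, h.1.1.symm, h.1.2, fun s hs => h.2 s (by simp [hs])⟩

/-- The inverse consists of the opposite crossings in reverse order. In the inverse of an
antiparallel crossing the same strand is on top, so the inverse is descending again. -/
theorem exists_inverse (h : IsDescendingTangle a w b) :
    ∃ w', IsDescendingTangle b w' a ∧ TangleEq a a (w ++ w') [] ∧ TangleEq b b (w' ++ w) [] := by
  induction w generalizing a with
  | nil => obtain rfl : a = b := h.1; exact ⟨[], nil a, .refl rfl, .refl rfl⟩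
  | cons s w ih =>
    obtain ⟨l, r, e, f, o, rfl, he, rfl, hw⟩ := h.of_cons
    obtain ⟨w', h1, h2, h3⟩ := ih hw
    have hc := cross l r (e := f) (f := e) (o := !o)
      (fun hne => by rw [he hne.symm]; cases e <;> cases f <;> simp_all)
    refine ⟨w' ++ [⟨l, .cross f e (!o), r⟩], h1.append hc, ?_, ?_⟩
    · have := (h2.context (isTangle_cross l r e f o) hc.1).trans (by
        simpa using TangleEq.cross_cancel l r e f o)
      simpa using this
    · have := (TangleEq.cross_cancel' l r f e o).context h1.1 hw.1
      simp only [List.append_nil] at this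
      simpa using this.trans h3

theorem count_eq (h : IsDescendingTangle a w b) (e : Bool) : a.count e = b.count e := by
  induction w generalizing a with
  | nil => obtain rfl : a = b := h.1; rfl
  | cons s w ih =>
    obtain ⟨l, r, e', f, o, rfl, he, rfl, hw⟩ := h.of_cons
    rw [← ih hw]
    simp [List.count_cons]
    omega

end IsDescendingTangle

/-! ### Moving maxima and minima to the left -/

/-- The arc passes behind `x` if `x` goes down and in front of it if `x` goes up. One of its two
crossings with `x` is between parallel strands and unconstrained; the other one then has the strand
going down on top. -/
theorem birth_slide_step (x : Bool) (r : List Bool) :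
    ∃ w, IsDescendingTangle ([true, false] ++ x :: r) w (x :: ([true, false] ++ r)) ∧
      TangleEq (x :: r) (x :: ([true, false] ++ r)) [⟨[x], .birth true, r⟩]
        ([⟨[], .birth true, x :: r⟩] ++ w) := by
  refine ⟨[⟨[true], .cross false x (!x), r⟩, ⟨[], .cross true x (!x), false :: r⟩], ?_, ?_⟩
  · refine .append (v := [_]) (.cross [true] r ?_) (.cross [] (false :: r) ?_) <;>
      cases x <;> simp
  · have h1 := (TangleEq.cross_cancel [] (false :: r) x true x).symm.append_left
      (isTangle_birth [x] r true)
    have h2 : TangleEq (x :: r) (true :: x :: false :: r)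
        [⟨[x], .birth true, r⟩, ⟨[], .cross x true x, false :: r⟩]
        [⟨[], .birth true, x :: r⟩, ⟨[true], .cross false x (!x), r⟩] := by
      refine .of_move (by simpa using LocalMove.slideBirth [] r true x x) ?_ ?_ <;>
        simp [IsTangle, Slice.src, Slice.tgt, Piece.src, Piece.tgt]
    have h3 := h2.append_right (isTangle_cross [] (false :: r) true x (!x))
    simpa using h1.trans h3

theorem birth_slide (l r : List Bool) :
    ∃ w, IsDescendingTangle ([true, false] ++ (l ++ r)) w (l ++ [true, false] ++ r) ∧
      TangleEq (l ++ r) (l ++ [true, false] ++ r) [⟨l, .birth true, r⟩]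
        ([⟨[], .birth true, l ++ r⟩] ++ w) := by
  induction l with
  | nil => exact ⟨[], .nil _, .refl (isTangle_birth [] r true)⟩
  | cons x l ih =>
    obtain ⟨w, hw, h⟩ := ih
    obtain ⟨w', hw', h'⟩ := birth_slide_step x (l ++ r)
    have hs := hw.shift [x] []
    refine ⟨w' ++ shift [x] [] w, hw'.append (by simpa using hs), ?_⟩
    have h1 := h.shift [x] []
    have h2 := h'.append_right (by simpa using hs.1)
    simp only [List.append_nil, shift_append, shift_cons, Slice.shift_mk, shift_nil] at h1 h2
    simpa using h1.trans (by simpa using h2)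

/-- Same choice as for maxima: `x` is over the arc exactly if it goes down. -/
theorem death_slide_step (x : Bool) (r : List Bool) :
    ∃ w, IsDescendingTangle (x :: ([true, false] ++ r)) w ([true, false] ++ x :: r) ∧
      TangleEq (x :: ([true, false] ++ r)) (x :: r) [⟨[x], .death true, r⟩]
        (w ++ [⟨[], .death true, x :: r⟩]) := by
  refine ⟨[⟨[], .cross x true x, false :: r⟩, ⟨[true], .cross x false x, r⟩], ?_, ?_⟩
  · refine .append (v := [_]) (.cross [] (false :: r) ?_) (.cross [true] r ?_) <;>
      cases x <;> simp
  · have h1 := (TangleEq.cross_cancel [] (false :: r) x true x).symm.append_right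
      (isTangle_death [x] r true)
    have h2 : TangleEq (true :: x :: false :: r) (x :: r)
        [⟨[], .cross true x (!x), false :: r⟩, ⟨[x], .death true, r⟩]
        [⟨[true], .cross x false x, r⟩, ⟨[], .death true, x :: r⟩] := by
      refine .of_move (by simpa using LocalMove.slideDeath [] r true x (!x)) ?_ ?_ <;>
        simp [IsTangle, Slice.src, Slice.tgt, Piece.src, Piece.tgt]
    have h3 := h2.append_left (isTangle_cross [] (false :: r) x true x)
    simpa using h1.trans h3

theorem death_slide (l r : List Bool) :
    ∃ w, IsDescendingTangle (l ++ [true, false] ++ r) w ([true, false] ++ (l ++ r)) ∧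
      TangleEq (l ++ [true, false] ++ r) (l ++ r) [⟨l, .death true, r⟩]
        (w ++ [⟨[], .death true, l ++ r⟩]) := by
  induction l with
  | nil => exact ⟨[], .nil _, .refl (isTangle_death [] r true)⟩
  | cons x l ih =>
    obtain ⟨w, hw, h⟩ := ih
    obtain ⟨w', hw', h'⟩ := death_slide_step x (l ++ r)
    have hs := hw.shift [x] []
    refine ⟨shift [x] [] w ++ w', .append (by simpa using hs) hw', ?_⟩
    have h1 := h.shift [x] []
    have h2 := h'.append_left (by simpa using hs.1)
    simp only [List.append_nil, shift_append, shift_cons, Slice.shift_mk, shift_nil] at h1 h2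
    simpa using h1.trans (by simpa using h2)

/-! ### Sorting the strands by their orientations -/

/-- `n` strands going down, and to their right `m` strands going up. -/
def sorted (n m : ℕ) : List Bool := List.replicate n true ++ List.replicate m false

/-- A strand going up that passes under `n` strands going down, from right to left. -/
def pull : ℕ → List Slice
  | 0 => []
  | n + 1 => shift [true] [] (pull n) ++ [⟨[], .cross true false true, List.replicate n true⟩]

theorem isDescendingTangle_pull (n : ℕ) :
    IsDescendingTangle (List.replicate n true ++ [false]) (pull n)
      (false :: List.replicate n true) := by
  induction n with
  | zero => exact .nil _
  | succ n ih =>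
    have h1 := ih.shift [true] []
    have h2 := IsDescendingTangle.cross [] (List.replicate n true) (e := true) (f := false)
      (o := true) (by simp)
    exact .append (by simpa [List.replicate_succ] using h1)
      (by simpa [List.replicate_succ] using h2)

/-- The tangle without crossings of parallel strands that brings sorted strands into the order `b`. -/
def unsort : List Bool → List Slice
  | [] => []
  | true :: b => shift [true] [] (unsort b)
  | false :: b => shift [] (List.replicate (b.count false) false) (pull (b.count true)) ++
      shift [false] [] (unsort b)

theorem isDescendingTangle_unsort (b : List Bool) :
    IsDescendingTangle (sorted (b.count true) (b.count false)) (unsort b) b := by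
  induction b with
  | nil => exact .nil _
  | cons x b ih =>
    cases x with
    | true => simpa [unsort, sorted, List.replicate_succ] using ih.shift [true] []
    | false =>
      have h1 := (isDescendingTangle_pull (b.count true)).shift []
        (List.replicate (b.count false) false)
      have h2 := ih.shift [false] []
      have := h1.append (by simpa [sorted] using h2)
      simpa [unsort, sorted, List.replicate_succ] using this

theorem unsort_sorted (n m : ℕ) : unsort (sorted n m) = [] := by
  induction n with
  | zero =>
    induction m with
    | zero => rfl
    | succ m ih =>
      simp only [sorted, List.replicate_zero, List.nil_append] at ih
      simp [sorted, unsort, List.replicate_succ, ih, List.count_replicate, pull]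
  | succ n ih =>
    simp only [sorted] at ih
    simp [sorted, unsort, List.replicate_succ, ih]

/-- A crossing of two adjacent ones among `n` strands of orientation `e`. -/
def IsBraidSlice (e : Bool) (n : ℕ) (s : Slice) : Prop :=
  ∃ i j o, i + 2 + j = n ∧ s = ⟨List.replicate i e, .cross e e o, List.replicate j e⟩

theorem replicate_split {i j n : ℕ} (e : Bool) (h : i + 2 + j = n) :
    List.replicate n e = List.replicate i e ++ [e, e] ++ List.replicate j e := by
  subst h
  rw [show [e, e] = List.replicate 2 e from rfl]
  simp only [List.replicate_append_replicate]

theorem IsBraidSlice.isDescendingTangle {e : Bool} {n : ℕ} {s : Slice} (h : IsBraidSlice e n s) :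
    IsDescendingTangle (List.replicate n e) [s] (List.replicate n e) := by
  obtain ⟨i, j, o, h, rfl⟩ := h
  rw [replicate_split e h]
  exact .cross _ _ (by simp)

theorem isDescendingTangle_of_braid {e : Bool} {n : ℕ} {w : List Slice}
    (h : ∀ s ∈ w, IsBraidSlice e n s) :
    IsDescendingTangle (List.replicate n e) w (List.replicate n e) := by
  induction w with
  | nil => exact .nil _
  | cons s w ih =>
    exact (h s (by simp)).isDescendingTangle.append (ih fun t ht => h t (by simp [ht]))

/-- The pulled strand lies below all strands going down, so their crossings slide over it by the
third Reidemeister move, whatever their sign. A crossing away from the first strand avoids the last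
crossing of `pull`, which makes the induction work. -/
theorem pull_braid {n : ℕ} {s : Slice} (h : IsBraidSlice true n s) :
    TangleEq (List.replicate n true ++ [false]) (false :: List.replicate n true)
      (pull n ++ [s.shift [false] []]) ([s.shift [] [false]] ++ pull n) := by
  obtain ⟨i, j, o, h, rfl⟩ := h
  induction i generalizing n with
  | zero =>
    obtain rfl : n = j + 2 := by omega
    have h1 : TangleEq (true :: true :: false :: List.replicate j true)
        (false :: true :: true :: List.replicate j true)
        [⟨[true], .cross true false true, List.replicate j true⟩,
          ⟨[], .cross true false true, true :: List.replicate j true⟩,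
          ⟨[false], .cross true true o, List.replicate j true⟩]
        [⟨[], .cross true true o, false :: List.replicate j true⟩,
          ⟨[true], .cross true false true, List.replicate j true⟩,
          ⟨[], .cross true false true, true :: List.replicate j true⟩] :=
      .symm (.of_move (by
        simpa using LocalMove.reidemeisterThree [] (List.replicate j true) true true false o true
          true (by simp +contextual)) (by
        simp [IsTangle, Slice.src, Slice.tgt, Piece.src, Piece.tgt]) (by
        simp [IsTangle, Slice.src, Slice.tgt, Piece.src, Piece.tgt]))
    have hp := ((isDescendingTangle_pull j).shift [true, true] []).1
    have h2 := h1.append_left (by simpa using hp)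
    have h3 := (TangleEq.interchange (isTangle_cross [] [] true true o)
      (isDescendingTangle_pull j).1).symm.append_right
      (u := [⟨[true], .cross true false true, List.replicate j true⟩,
          ⟨[], .cross true false true, true :: List.replicate j true⟩])
      (c := false :: true :: true :: List.replicate j true)
      (by simp [IsTangle, Slice.src, Slice.tgt, Piece.src, Piece.tgt])
    simpa [pull, List.replicate_succ] using h2.trans (by simpa using h3)
  | succ i ih =>
    obtain ⟨n, rfl⟩ : ∃ k, n = k + 1 := ⟨n - 1, by omega⟩
    have hb : IsBraidSlice true n
      ⟨List.replicate i true, .cross true true o, List.replicate j true⟩ :=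
        ⟨i, j, o, by omega, rfl⟩
    have h1 := (TangleEq.interchange (isTangle_cross [] [] true false true)
      hb.isDescendingTangle.1).append_left (u := shift [true] [] (pull n))
        (by simpa using ((isDescendingTangle_pull n).shift [true] []).1)
    have h2 := ((ih (n := n) (by omega)).shift [true] []).append_right
      (u := [⟨[], .cross true false true, List.replicate n true⟩])
      (c := false :: true :: List.replicate n true)
      (by simp [IsTangle, Slice.src, Slice.tgt, Piece.src, Piece.tgt])
    simp only [shift_append, shift_cons] at h1 h2
    simpa [pull, List.replicate_succ] using h1.trans (by simpa using h2)

/-- Two strands going up lie below every strand going down, so their crossing slides through, with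
one third Reidemeister move for each strand going down. -/
theorem pull_pull (n : ℕ) (o : Bool) :
    TangleEq (List.replicate n true ++ [false, false]) (false :: false :: List.replicate n true)
      (shift [] [false] (pull n) ++ shift [false] [] (pull n) ++
        [⟨[], .cross false false o, List.replicate n true⟩])
      ([⟨List.replicate n true, .cross false false o, []⟩] ++ shift [] [false] (pull n) ++
        shift [false] [] (pull n)) := by
  induction n with
  | zero => simpa [pull] using TangleEq.refl (isTangle_cross [] [] false false o)
  | succ n ih =>
    have hp := (isDescendingTangle_pull n).1
    have h1 : TangleEq (true :: false :: false :: List.replicate n true)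
        (false :: false :: true :: List.replicate n true)
        [⟨[], .cross true false true, false :: List.replicate n true⟩,
          ⟨[false], .cross true false true, List.replicate n true⟩,
          ⟨[], .cross false false o, true :: List.replicate n true⟩]
        [⟨[true], .cross false false o, List.replicate n true⟩,
          ⟨[], .cross true false true, false :: List.replicate n true⟩,
          ⟨[false], .cross true false true, List.replicate n true⟩] :=
      .of_move (by
        simpa using LocalMove.reidemeisterThree [] (List.replicate n true) true false false true
          true o (by simp)) (by
        simp [IsTangle, Slice.src, Slice.tgt, Piece.src, Piece.tgt]) (by
        simp [IsTangle, Slice.src, Slice.tgt, Piece.src, Piece.tgt])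
    -- Written out, the two pulls are interleaved. Exchanging the last crossing of the first pull
    -- with the rest of the second one makes the pulls past the other `n` strands adjacent, so that
    -- `ih` applies.
    have hx := (TangleEq.interchange (isTangle_cross [] [] true false true) hp).append_left
      (u := shift [true] [false] (pull n)) (a := true :: (List.replicate n true ++ [false, false]))
      (by simpa using hp.shift [true] [false])
    have hpp : IsTangle (true :: (List.replicate n true ++ [false, false]))
        (shift [true] [false] (pull n) ++ shift [true, false] [] (pull n))
        (true :: false :: false :: List.replicate n true) :=
      IsTangle.append (by simpa using hp.shift [true] [false])
        (by simpa using hp.shift [true, false] [])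
    have h2 := hx.append_right
      (u := [⟨[false], .cross true false true, List.replicate n true⟩,
          ⟨[], .cross false false o, true :: List.replicate n true⟩])
      (c := false :: false :: true :: List.replicate n true)
      (by simp [IsTangle, Slice.src, Slice.tgt, Piece.src, Piece.tgt])
    have h3 := h1.append_left hpp
    have h4 := (ih.shift [true] []).append_right
      (u := [⟨[], .cross true false true, false :: List.replicate n true⟩,
          ⟨[false], .cross true false true, List.replicate n true⟩])
      (c := false :: false :: true :: List.replicate n true)
      (by simp [IsTangle, Slice.src, Slice.tgt, Piece.src, Piece.tgt])
    have hc : IsTangle (true :: (List.replicate n true ++ [false, false]))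
        [⟨true :: List.replicate n true, .cross false false o, []⟩]
        (true :: (List.replicate n true ++ [false, false])) := by
      simpa using isTangle_cross (true :: List.replicate n true) [] false false o
    have h5 := (hx.symm.append_left hc).append_right
      (u := [⟨[false], .cross true false true, List.replicate n true⟩])
      (c := false :: false :: true :: List.replicate n true)
      (by simp [IsTangle, Slice.src, Slice.tgt, Piece.src, Piece.tgt])
    simp only [shift_append, shift_cons, shift_shift, shift_nil, Slice.shift_mk, List.append_assoc,
      List.cons_append, List.nil_append, List.append_nil] at h2 h3 h4 h5
    simpa [pull, List.replicate_succ] using h2.trans (h3.trans (h4.trans h5))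

/-! ### Normal form of descending tangles -/

/-- A crossing of two strands going down or of two strands going up, next to sorted strands. -/
def IsParallelSlice (n m : ℕ) (s : Slice) : Prop :=
  (∃ t, IsBraidSlice true n t ∧ s = t.shift [] (List.replicate m false)) ∨
    ∃ t, IsBraidSlice false m t ∧ s = t.shift (List.replicate n true) []

theorem IsBraidSlice.shift {e : Bool} {n : ℕ} {s : Slice} (h : IsBraidSlice e n s) :
    IsBraidSlice e (n + 1) (s.shift [e] []) := by
  obtain ⟨i, j, o, h, rfl⟩ := h
  exact ⟨i + 1, j, o, by omega, by simp [List.replicate_succ]⟩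

theorem IsBraidSlice.isTangle {e : Bool} {n : ℕ} {s : Slice} (h : IsBraidSlice e n s) :
    IsTangle (List.replicate n e) [s] (List.replicate n e) := h.isDescendingTangle.1

theorem IsParallelSlice.isTangle {n m : ℕ} {s : Slice} (h : IsParallelSlice n m s) :
    IsTangle (sorted n m) [s] (sorted n m) := by
  obtain ⟨t, h, rfl⟩ | ⟨t, h, rfl⟩ := h
  · simpa [sorted] using h.isTangle.shift [] (List.replicate m false)
  · simpa [sorted] using h.isTangle.shift (List.replicate n true) []

theorem isTangle_of_parallel {n m : ℕ} {w : List Slice} (h : ∀ s ∈ w, IsParallelSlice n m s) :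
    IsTangle (sorted n m) w (sorted n m) := by
  induction w with
  | nil => rfl
  | cons s w ih =>
    exact IsTangle.append (v := [s]) (h s (by simp)).isTangle (ih fun t ht => h t (by simp [ht]))

theorem isTangle_pull (n : ℕ) (m : ℕ) :
    IsTangle (sorted n (m + 1)) (shift [] (List.replicate m false) (pull n))
      (false :: sorted n m) := by
  simpa [sorted, List.replicate_succ] using
    (isDescendingTangle_pull n).1.shift [] (List.replicate m false)

/-- A crossing of strands going down slides through by `pull_braid`; a crossing of strands going up
lies beside the pull and is exchanged with it. -/
theorem pull_parallel {n m : ℕ} {s : Slice} (h : IsParallelSlice n m s) :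
    ∃ t, IsParallelSlice n (m + 1) t ∧ TangleEq (sorted n (m + 1)) (false :: sorted n m)
      (shift [] (List.replicate m false) (pull n) ++ [s.shift [false] []])
      ([t] ++ shift [] (List.replicate m false) (pull n)) := by
  obtain ⟨t, h, rfl⟩ | ⟨t, h, rfl⟩ := h
  · refine ⟨_, .inl ⟨t, h, rfl⟩, ?_⟩
    simpa [sorted, List.replicate_succ] using
      (pull_braid h).shift [] (List.replicate m false)
  · refine ⟨_, .inr ⟨_, h.shift, rfl⟩, ?_⟩
    simpa [sorted, List.replicate_succ] using
      TangleEq.interchange (isDescendingTangle_pull n).1 h.isTangle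

theorem pull_parallel_word {n m : ℕ} {w : List Slice} (h : ∀ s ∈ w, IsParallelSlice n m s) :
    ∃ v, (∀ s ∈ v, IsParallelSlice n (m + 1) s) ∧
      TangleEq (sorted n (m + 1)) (false :: sorted n m)
        (shift [] (List.replicate m false) (pull n) ++ shift [false] [] w)
        (v ++ shift [] (List.replicate m false) (pull n)) := by
  induction w with
  | nil => exact ⟨[], by simp, by simpa using TangleEq.refl (isTangle_pull n m)⟩
  | cons s w ih =>
    obtain ⟨v, hv, h1⟩ := ih fun t ht => h t (by simp [ht])
    obtain ⟨t, ht, h2⟩ := pull_parallel (h s (by simp))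
    refine ⟨t :: v, by simpa using ⟨ht, hv⟩, ?_⟩
    have hw := (isTangle_of_parallel fun t ht => h t (List.mem_cons_of_mem _ ht)).shift [false] []
    have h3 := h2.append_right (by simpa using hw)
    have h4 := h1.append_left ht.isTangle
    simpa using h3.trans (by simpa using h4)

/-- This is the induction step for the normal form. A crossing of parallel strands travels up
through `unsort` and emerges as a braid crossing. An antiparallel crossing, being descending, either
completes a pull or cancels the last crossing of one, and leaves no braid behind. -/
theorem unsort_cross (l r : List Bool) {e f o : Bool} (ho : e ≠ f → o = e) :
    ∃ v, (∀ s ∈ v, IsParallelSlice ((l ++ [e, f] ++ r).count true)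
        ((l ++ [e, f] ++ r).count false) s) ∧
      TangleEq (sorted ((l ++ [e, f] ++ r).count true) ((l ++ [e, f] ++ r).count false))
        (l ++ [f, e] ++ r) (unsort (l ++ [e, f] ++ r) ++ [⟨l, .cross e f o, r⟩])
        (v ++ unsort (l ++ [f, e] ++ r)) := by
  induction l with
  | nil =>
    have hr := (isDescendingTangle_unsort r).1
    generalize hn : r.count true = n at hr
    generalize hm : r.count false = m at hr
    have hx := (TangleEq.interchange (isTangle_cross [] [] e f o) hr).symm
    have hp := (isDescendingTangle_pull n).1
    match e, f, ho with
    | true, true, _ =>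
      refine ⟨[⟨[], .cross true true o, sorted n m⟩], ?_, ?_⟩
      · simp only [List.mem_singleton, forall_eq]
        refine .inl ⟨⟨[], .cross true true o, List.replicate n true⟩, ⟨0, n, o, ?_, rfl⟩, ?_⟩
        · simp [hn]; omega
        · simp [hm, sorted]
      · simpa [unsort, sorted, hn, hm, List.replicate_succ] using hx
    | true, false, ho =>
      obtain rfl : o = true := ho (by simp)
      refine ⟨[], by simp, ?_⟩
      have h1 := hx.append_left (u := shift [true] (List.replicate m false) (pull n))
        (a := true :: sorted n (m + 1)) (by
          simpa [sorted, List.replicate_succ] using hp.shift [true] (List.replicate m false))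
      simpa [unsort, sorted, hn, hm, pull, List.replicate_succ] using h1
    | false, true, ho =>
      obtain rfl : o = false := ho (by simp)
      refine ⟨[], by simp, ?_⟩
      have hq := hp.shift [true] (List.replicate m false)
      have h1 := hx.append_left (u := shift [] (List.replicate m false) (pull (n + 1)))
        (a := true :: sorted n (m + 1)) (by
          simpa [sorted, List.replicate_succ] using
            (isDescendingTangle_pull (n + 1)).1.shift [] (List.replicate m false))
      have h2 := ((TangleEq.cross_cancel [] (sorted n m) true false true).append_left
        (u := shift [true] (List.replicate m false) (pull n)) (a := true :: sorted n (m + 1)) (by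
          simpa [sorted, List.replicate_succ] using hq)).append_right
          (by simpa using hr.shift [true, false] [])
      simp only [shift_append, shift_cons, shift_shift, pull, shift_nil, Slice.shift_mk,
        List.append_assoc, List.cons_append, List.nil_append, List.append_nil, sorted] at h1 h2
      simpa [unsort, sorted, hn, hm, pull, List.replicate_succ] using h1.trans (by simpa using h2)
    | false, false, _ =>
      refine ⟨[⟨List.replicate n true, .cross false false o, List.replicate m false⟩], ?_, ?_⟩
      · simp only [List.mem_singleton, forall_eq]
        refine .inr ⟨⟨[], .cross false false o, List.replicate m false⟩, ⟨0, m, o, ?_, rfl⟩, ?_⟩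
        · simp [hm]; omega
        · simp [hn]
      · have h1 := hx.append_left (u := shift [] (false :: List.replicate m false) (pull n) ++
          shift [false] (List.replicate m false) (pull n)) (a := sorted n (m + 2)) (by
            refine IsTangle.append (b := false :: sorted n (m + 1)) ?_ ?_
            · exact isTangle_pull n (m + 1)
            · simpa using (isTangle_pull n m).shift [false] [])
        have h2 := ((pull_pull n o).shift [] (List.replicate m false)).append_right
          (by simpa [sorted] using hr.shift [false, false] [])
        simp only [shift_append, shift_cons, shift_shift, shift_nil, Slice.shift_mk,
          List.append_assoc, List.cons_append, List.nil_append, List.append_nil, sorted] at h1 h2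
        simpa [unsort, sorted, hn, hm, List.replicate_succ] using h1.trans (by simpa [List.replicate_succ] using h2)
  | cons x l ih =>
    obtain ⟨v, hv, h⟩ := ih
    have hc : ∀ y, (l ++ [f, e] ++ r).count y = (l ++ [e, f] ++ r).count y := by
      intro y; simp [List.count_cons]; omega
    have hu := (isDescendingTangle_unsort (l ++ [f, e] ++ r)).1
    rw [hc, hc] at hu
    have hc1 := hc true
    have hc2 := hc false
    simp only [List.append_assoc, List.cons_append, List.nil_append] at hc1 hc2 hv h hu
    generalize hn : (l ++ e :: f :: r).count true = n at hv h hc1 hu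
    generalize hm : (l ++ e :: f :: r).count false = m at hv h hc2 hu
    cases x with
    | true =>
      refine ⟨shift [true] [] v, ?_, ?_⟩
      · intro s hs
        obtain ⟨t, ht, rfl⟩ := List.mem_map.1 hs
        have : IsParallelSlice (n + 1) m (t.shift [true] []) := by
          obtain ⟨t, h, rfl⟩ | ⟨t, h, rfl⟩ := hv t ht
          · exact .inl ⟨_, h.shift, by simp⟩
          · exact .inr ⟨t, h, by simp [List.replicate_succ]⟩
        simpa [hn, hm] using this
      · simpa [unsort, sorted, List.replicate_succ, hn, hm] using h.shift [true] []
    | false =>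
      obtain ⟨v', hv', h'⟩ := pull_parallel_word hv
      refine ⟨v', by simpa [hn, hm] using hv', ?_⟩
      have h1 := (h.shift [false] []).append_left (by simpa using isTangle_pull n m)
      have h2 := h'.append_right (by simpa using hu.shift [false] [])
      simp only [shift_append, shift_cons, shift_nil, Slice.shift_mk,
          List.append_assoc, List.cons_append, List.nil_append, List.append_nil] at h1 h2
      simpa [unsort, hn, hm, hc1, hc2] using h1.trans (by simpa using h2)

/-- A descending tangle on sorted strands consists of a braid of the strands going down, a braid of
the strands going up and a crossingless part. -/
theorem IsDescendingTangle.normal_form {n m : ℕ} {w : List Slice} {b : List Bool}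
    (h : IsDescendingTangle (sorted n m) w b) :
    ∃ v, (∀ s ∈ v, IsParallelSlice n m s) ∧ TangleEq (sorted n m) b w (v ++ unsort b) := by
  induction w using List.reverseRecOn generalizing b with
  | nil =>
    obtain rfl : sorted n m = b := h.1
    exact ⟨[], by simp, by simpa [unsort_sorted] using TangleEq.refl h.1⟩
  | append_singleton w s ih =>
    obtain ⟨c, hw, hs⟩ := isTangle_append.1 h.1
    have hw' : IsDescendingTangle (sorted n m) w c := ⟨hw, fun t ht => h.2 t (by simp [ht])⟩
    obtain ⟨v, hv, h1⟩ := ih hw'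
    obtain ⟨l, r, e, f, o, rfl, ho⟩ := h.2 s (by simp)
    obtain ⟨rfl, rfl⟩ := hs
    have hc1 := hw'.count_eq true
    have hc2 := hw'.count_eq false
    simp only [sorted, List.count_append, List.count_replicate, beq_self_eq_true, if_true] at hc1 hc2
    obtain ⟨v', hv', h2⟩ := unsort_cross l r ho
    have e1 : (l ++ [e, f] ++ r).count true = n := by
      simpa [Slice.src, Piece.src] using hc1.symm
    have e2 : (l ++ [e, f] ++ r).count false = m := by
      simpa [Slice.src, Piece.src] using hc2.symm
    rw [e1, e2] at hv' h2
    refine ⟨v ++ v', fun s hs => (List.mem_append.1 hs).elim (hv s) (hv' s), ?_⟩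
    have h3 := h1.append_right (isTangle_cross l r e f o)
    have h4 := h2.append_left (isTangle_of_parallel hv)
    simpa [Slice.tgt, Piece.tgt] using h3.trans (by simpa [Slice.src, Piece.src] using h4)

/-! ### Braids on open arcs -/

theorem openArcs_succ (n : ℕ) : openArcs (n + 1) = openArcs n ++
    [⟨List.replicate n true, .birth true, List.replicate n false⟩] := by
  simp [openArcs, List.range_succ]

/-- The crossing slides through both maxima, from the right legs to the left legs. Each slide
reverses the over-bit, so that it is unchanged in the end. -/
theorem nested_births_cross (o : Bool) :
    ∃ o', TangleEq [] [true, true, false, false]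
      [⟨[], .birth true, []⟩, ⟨[true], .birth true, [false]⟩,
        ⟨[true, true], .cross false false o, []⟩]
      [⟨[], .birth true, []⟩, ⟨[true], .birth true, [false]⟩,
        ⟨[], .cross true true o', [false, false]⟩] := by
  refine ⟨o, .symm ?_⟩
  have h1 : TangleEq [true, false] [true, true, false, false]
      [⟨[true], .birth true, [false]⟩, ⟨[], .cross true true o, [false, false]⟩]
      [⟨[], .birth true, [true, false]⟩, ⟨[true], .cross false true (!o), [false]⟩] := by
    refine .of_move (by simpa using LocalMove.slideBirth [] [false] true true o) ?_ ?_ <;>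
      simp [IsTangle, Slice.src, Slice.tgt, Piece.src, Piece.tgt]
  have h2 := (TangleEq.interchange (isTangle_birth [] [] true) (isTangle_birth [] [] true)).symm
  have h3 : TangleEq [true, false] [true, true, false, false]
      [⟨[true, false], .birth true, []⟩, ⟨[true], .cross false true (!o), [false]⟩]
      [⟨[true], .birth true, [false]⟩, ⟨[true, true], .cross false false o, []⟩] := by
    refine .of_move (by simpa using LocalMove.slideBirth [true] [] true false (!o)) ?_ ?_ <;>
      simp [IsTangle, Slice.src, Slice.tgt, Piece.src, Piece.tgt]
  have h4 := h1.append_left (isTangle_birth [] [] true)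
  have h5 := h2.append_right (isTangle_cross [true] [false] false true (!o))
  have h6 := h3.append_left (isTangle_birth [] [] true)
  exact h4.trans (.trans (by simpa using h5) (by simpa using h6))

theorem IsBraidSlice.shift_right {e : Bool} {n : ℕ} {s : Slice} (h : IsBraidSlice e n s) :
    IsBraidSlice e (n + 1) (s.shift [] [e]) := by
  obtain ⟨i, j, o, h, rfl⟩ := h
  exact ⟨i, j + 1, o, by omega, by simp [List.replicate_succ']⟩

theorem isTangle_openArcs' (n : ℕ) : IsTangle [] (openArcs n) (sorted n n) := isTangle_openArcs n

theorem sorted_append_birth (n : ℕ) : sorted (n + 1) (n + 1) =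
    List.replicate n true ++ [true, false] ++ List.replicate n false := by
  rw [sorted, List.replicate_succ', List.replicate_succ]
  simp

theorem replicate_true_succ (n : ℕ) :
    List.replicate (n + 1) true = List.replicate n true ++ [true] := List.replicate_succ'

theorem replicate_false_succ (n : ℕ) :
    List.replicate (n + 1) false = false :: List.replicate n false := List.replicate_succ

/-- Index 0 on the strands going up belongs to the two innermost arcs. A crossing further out avoids
the innermost maximum, which can be lowered below it, and induction on the index applies. -/
theorem openArcs_braid_up {n : ℕ} {s : Slice} (h : IsBraidSlice false n s) :
    ∃ t, IsBraidSlice true n t ∧ TangleEq [] (sorted n n)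
      (openArcs n ++ [s.shift (List.replicate n true) []])
      (openArcs n ++ [t.shift [] (List.replicate n false)]) := by
  obtain ⟨i, j, o, h, rfl⟩ := h
  induction i generalizing n with
  | zero =>
    obtain rfl : n = j + 2 := by omega
    obtain ⟨o', h1⟩ := nested_births_cross o
    refine ⟨⟨List.replicate j true, .cross true true o', []⟩, ⟨j, 0, o', rfl, rfl⟩, ?_⟩
    have h2 := (h1.shift (List.replicate j true) (List.replicate j false)).append_left
      (by simpa [sorted] using isTangle_openArcs' j)
    rw [sorted_append_birth]
    simpa [openArcs_succ, replicate_true_succ, replicate_false_succ] using h2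
  | succ i ih =>
    obtain ⟨n, rfl⟩ : ∃ k, n = k + 1 := ⟨n - 1, by omega⟩
    obtain ⟨t, ht, h1⟩ := ih (n := n) (by omega)
    refine ⟨_, ht.shift_right, ?_⟩
    have hs : IsBraidSlice false n
      ⟨List.replicate i false, .cross false false o, List.replicate j false⟩ :=
        ⟨i, j, o, by omega, rfl⟩
    have h2 := ((TangleEq.interchange (isTangle_birth [] [] true) hs.isTangle).shift
      (List.replicate n true) []).append_left (by simpa [sorted] using isTangle_openArcs' n)
    have h3 := h1.append_right (u := [⟨List.replicate n true, .birth true, List.replicate n false⟩])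
      (c := sorted (n + 1) (n + 1)) (by
        rw [sorted_append_birth]
        exact isTangle_birth (List.replicate n true) (List.replicate n false) true)
    have h4 := (TangleEq.interchange ht.isTangle
      (isTangle_birth [] (List.replicate n false) true)).append_left (isTangle_openArcs' n)
    rw [sorted_append_birth] at h3 ⊢
    simp only [shift_cons, shift_nil, Slice.shift_mk, List.append_assoc, List.cons_append, List.nil_append, List.append_nil] at h2 h3 h4
    have h5 := h2.trans (h3.trans h4)
    simpa [openArcs_succ, replicate_true_succ, replicate_false_succ] using h5

theorem openArcs_parallel {n : ℕ} {w : List Slice} (h : ∀ s ∈ w, IsParallelSlice n n s) :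
    ∃ v, (∀ s ∈ v, IsBraidSlice true n s) ∧ TangleEq [] (sorted n n) (openArcs n ++ w)
      (openArcs n ++ shift [] (List.replicate n false) v) := by
  induction w using List.reverseRecOn with
  | nil => exact ⟨[], by simp, by simpa using TangleEq.refl (isTangle_openArcs' n)⟩
  | append_singleton w s ih =>
    obtain ⟨v, hv, h1⟩ := ih fun t ht => h t (by simp [ht])
    have hs := h s (by simp)
    have h2 := h1.append_right hs.isTangle
    obtain ⟨t, ht, rfl⟩ | ⟨t, ht, rfl⟩ := hs
    · refine ⟨v ++ [t], fun s hs => (List.mem_append.1 hs).elim (hv s) ?_, by simpa using h2⟩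
      simp only [List.mem_singleton]
      rintro rfl
      exact ht
    · obtain ⟨t', ht', h3⟩ := openArcs_braid_up ht
      -- The transferred crossing lands directly under the maxima, hence in front of the braid
      -- collected so far.
      refine ⟨t' :: v, by simpa using ⟨ht', hv⟩, ?_⟩
      have hv' := (isDescendingTangle_of_braid hv).1
      have h4 := (TangleEq.interchange hv' ht.isTangle).append_left (isTangle_openArcs' n)
      have h5 := h3.append_right (by simpa [sorted] using hv'.shift [] (List.replicate n false))
      simp only [List.append_assoc] at h2 h5
      simpa using h2.trans (h4.trans (by simpa using h5))

/-! ### Words in the positive generators of the braid group -/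

/-- The word in the generators of the braid group on `n` strands with the given indices. -/
def braid (n : ℕ) (w : List ℕ) : List Slice :=
  w.map fun i => ⟨List.replicate i true, .cross true true true, List.replicate (n - 2 - i) true⟩

@[simp] theorem braid_nil (n : ℕ) : braid n [] = [] := rfl

@[simp] theorem braid_cons (n i : ℕ) (w : List ℕ) : braid n (i :: w) =
    ⟨List.replicate i true, .cross true true true, List.replicate (n - 2 - i) true⟩ ::
      braid n w := rfl

@[simp] theorem braid_append (n : ℕ) (v w : List ℕ) : braid n (v ++ w) = braid n v ++ braid n w :=
  List.map_append

theorem isBraidSlice_of_mem_braid {n : ℕ} {w : List ℕ} (h : ∀ i ∈ w, i + 2 ≤ n) {s : Slice}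
    (hs : s ∈ braid n w) : IsBraidSlice true n s := by
  obtain ⟨i, hi, rfl⟩ := List.mem_map.1 hs
  exact ⟨i, n - 2 - i, true, by have := h i hi; omega, rfl⟩

theorem isTangle_braid {n : ℕ} {w : List ℕ} (h : ∀ i ∈ w, i + 2 ≤ n) :
    IsTangle (List.replicate n true) (braid n w) (List.replicate n true) :=
  (isDescendingTangle_of_braid fun _ hs => isBraidSlice_of_mem_braid h hs).1

/-- The skein relation expresses a braid by positive braids. -/
theorem gen_positive {n : ℕ} {v : List Slice} (h : ∀ s ∈ v, IsBraidSlice true n s) :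
    Gen (List.replicate n true) (List.replicate n true)
      (fun u => ∃ w : List ℕ, (∀ i ∈ w, i + 2 ≤ n) ∧ u = braid n w) v := by
  induction v with
  | nil => exact .base ⟨[], by simp, rfl⟩
  | cons s v ih =>
    have ih := ih fun t ht => h t (by simp [ht])
    have hv := (isDescendingTangle_of_braid fun t ht => h t (List.mem_cons_of_mem _ ht)).1
    have hs := h s (by simp)
    have hs' := hs.isTangle
    obtain ⟨i, j, o, hij, rfl⟩ := hs
    have e1 : n - 2 - i = j := by omega
    have key : Gen (List.replicate n true) (List.replicate n true)
        (fun u => ∃ w : List ℕ, (∀ i ∈ w, i + 2 ≤ n) ∧ u = braid n w)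
        ([⟨List.replicate i true, .cross true true true, List.replicate j true⟩] ++ v ++ []) := by
      refine ih.context ((IsBraidSlice.isTangle ⟨i, j, true, hij, rfl⟩)) rfl ?_
      rintro _ ⟨w, hw, rfl⟩
      exact .base ⟨i :: w, by simpa using ⟨by omega, hw⟩, by simp [e1]⟩
    cases o with
    | true => simpa using key
    | false =>
      exact Gen.switch [] v (List.replicate i true) (List.replicate j true) true true false
        (hs'.append hv) (by simpa using key) (by simpa [smoothing] using ih)

theorem braid_far {n k : ℕ} {w : List ℕ} (hk : k + 2 ≤ n) (h : ∀ i ∈ w, i + 2 ≤ k) :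
    TangleEq (List.replicate n true) (List.replicate n true) (braid n (w ++ [k]))
      (braid n (k :: w)) := by
  have h1 := TangleEq.interchange (isTangle_braid h)
    (IsBraidSlice.isTangle (e := true) (n := n - k) ⟨0, n - 2 - k, true, by omega, rfl⟩)
  have h2 : shift [] (List.replicate (n - k) true) (braid k w) = braid n w := by
    simp only [shift, braid, List.map_map]
    refine List.map_congr_left fun i hi => ?_
    have := h i hi
    simp only [Function.comp, Slice.shift_mk, List.replicate_append_replicate, List.nil_append]
    congr 2
    omega
  rw [h2, List.replicate_append_replicate, Nat.add_sub_cancel' (by omega)] at h1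
  simpa using h1

theorem braid_three {n k : ℕ} (hk : k + 3 ≤ n) :
    TangleEq (List.replicate n true) (List.replicate n true) (braid n [k + 1, k, k + 1])
      (braid n [k, k + 1, k]) := by
  obtain ⟨j, rfl⟩ := Nat.exists_eq_add_of_le hk
  have h := LocalMove.reidemeisterThree (List.replicate k true) (List.replicate j true)
    true true true true true true (by simp)
  have e1 : k + 3 + j - 2 - k = j + 1 := by omega
  have e2 : k + 3 + j - 2 - (k + 1) = j := by omega
  refine .symm (.of_move ?_ ?_ ?_)
  · simpa [e1, e2, List.replicate_succ (n := j), replicate_true_succ k] using h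
  · exact isTangle_braid (by simp; omega)
  · exact isTangle_braid (by simp; omega)

/-- This is the quadratic relation of the Hecke algebra: switching one of the two crossings makes
them cancel, smoothing it leaves the other one. -/
theorem gen_braid_sq {n k : ℕ} (hk : k + 2 ≤ n) {S : List Slice → Prop}
    (h0 : S []) (h1 : S (braid n [k])) :
    Gen (List.replicate n true) (List.replicate n true) S (braid n [k, k]) := by
  have hs : IsBraidSlice true n ⟨List.replicate k true, .cross true true true,
    List.replicate (n - 2 - k) true⟩ := ⟨k, n - 2 - k, true, by omega, rfl⟩
  have hc := TangleEq.cross_cancel (List.replicate k true) (List.replicate (n - 2 - k) true)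
    true true true
  rw [← replicate_split (n := n) true (by omega)] at hc
  exact Gen.switch [⟨List.replicate k true, .cross true true true,
    List.replicate (n - 2 - k) true⟩] [] _ _ true true true
    (by simpa using hs.isTangle.append hs.isTangle) (.iso (by simpa using hc) (.base h0))
    (.base (by simpa [smoothing] using h1))

theorem TangleEq.braid_context {n : ℕ} {x y p q : List ℕ}
    (h : TangleEq (List.replicate n true) (List.replicate n true) (braid n x) (braid n y))
    (hp : ∀ i ∈ p, i + 2 ≤ n) (hq : ∀ i ∈ q, i + 2 ≤ n) :
    TangleEq (List.replicate n true) (List.replicate n true) (braid n (p ++ x ++ q))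
      (braid n (p ++ y ++ q)) := by
  simpa using h.context (isTangle_braid hp) (isTangle_braid hq)

/-- A word in which the last generator `k` occurs at most once. -/
def IsReduced (k : ℕ) (w : List ℕ) : Prop :=
  (∀ i ∈ w, i < k) ∨ ∃ u v : List ℕ, (∀ i ∈ u, i < k) ∧ (∀ i ∈ v, i < k) ∧ w = u ++ [k] ++ v

/-- The letters of `u` commute with `k + 1`, so the two occurrences of `k + 1` meet in a square. -/
theorem gen_reduced_far {n k : ℕ} (hk : k + 1 + 2 ≤ n) {u v : List ℕ} (hu : ∀ i ∈ u, i < k)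
    (hv : ∀ i ∈ v, i < k + 1) :
    Gen (List.replicate n true) (List.replicate n true)
      (fun u => ∃ w, IsReduced (k + 1) w ∧ u = braid n w)
      (braid n ([k + 1] ++ u ++ ([k + 1] ++ v))) := by
  have hu' : ∀ i ∈ u, i + 2 ≤ n := fun i hi => by have := hu i hi; omega
  have hv' : ∀ i ∈ v, i + 2 ≤ n := fun i hi => by have := hv i hi; omega
  have h1 := (braid_far (k := k + 1) (w := u) hk fun i hi => by
    have := hu i hi; omega).symm.braid_context (p := []) (q := [k + 1] ++ v) (by simp)
      (by simpa using ⟨by omega, hv'⟩)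
  have h2 := (gen_braid_sq (k := k + 1) hk (S := fun s => s = [] ∨ s = braid n [k + 1])
    (.inl rfl) (.inr rfl)).context (isTangle_braid hu') (isTangle_braid hv')
    (T := fun u => ∃ w, IsReduced (k + 1) w ∧ u = braid n w) (by
      rintro _ (rfl | rfl)
      · refine .base ⟨u ++ v, .inl fun i hi => ?_, by simp⟩
        obtain hi | hi := List.mem_append.1 hi
        · have := hu i hi; omega
        · exact hv i hi
      · refine .base ⟨u ++ [k + 1] ++ v, .inr ⟨u, v, fun i hi => ?_, hv, rfl⟩, by simp⟩
        have := hu i hi; omega)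
  refine .iso ?_ h2
  simpa using h1

/-- Commuting `u₁` and `u₂` outwards leaves `k + 1, k, k + 1`, and the braid relation trades this
for a word with a single `k + 1`. -/
theorem gen_reduced_three {n k : ℕ} (hk : k + 1 + 2 ≤ n) {u₁ u₂ v : List ℕ}
    (h₁ : ∀ i ∈ u₁, i < k) (h₂ : ∀ i ∈ u₂, i < k) (hv : ∀ i ∈ v, i < k + 1) :
    Gen (List.replicate n true) (List.replicate n true)
      (fun u => ∃ w, IsReduced (k + 1) w ∧ u = braid n w)
      (braid n ([k + 1] ++ (u₁ ++ [k] ++ u₂) ++ ([k + 1] ++ v))) := by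
  have h₁' : ∀ i ∈ u₁, i + 2 ≤ n := fun i hi => by have := h₁ i hi; omega
  have h₂' : ∀ i ∈ u₂, i + 2 ≤ n := fun i hi => by have := h₂ i hi; omega
  have hv' : ∀ i ∈ v, i + 2 ≤ n := fun i hi => by have := hv i hi; omega
  have f₁ := (braid_far (k := k + 1) (w := u₁) hk fun i hi => by
    have := h₁ i hi; omega).symm.braid_context (p := []) (q := [k] ++ u₂ ++ [k + 1] ++ v)
      (by simp) (by
        simp only [List.mem_append, List.mem_singleton]
        rintro i (((rfl | h) | rfl) | h)
        exacts [by omega, h₂' i h, by omega, hv' i h])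
  have f₂ := (braid_far (k := k + 1) (w := u₂) hk fun i hi => by
    have := h₂ i hi; omega).braid_context (p := u₁ ++ [k + 1, k]) (q := v) (by
        simp only [List.mem_append, List.mem_cons, List.not_mem_nil, or_false]
        rintro i (h | rfl | rfl)
        exacts [h₁' i h, by omega, by omega]) hv'
  have f₃ := (braid_three (k := k) hk).braid_context (p := u₁) (q := u₂ ++ v) h₁' (by
        simp only [List.mem_append]
        rintro i (h | h)
        exacts [h₂' i h, hv' i h])
  refine .iso (.trans (by simpa using f₁) (.trans (by simpa using f₂) f₃)) (.base
    ⟨_, .inr ⟨u₁ ++ [k], [k] ++ u₂ ++ v, ?_, ?_, ?_⟩, rfl⟩)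
  · simp only [List.mem_append, List.mem_singleton]
    rintro i (h | rfl)
    · have := h₁ i h; omega
    · omega
  · simp only [List.mem_append, List.mem_singleton]
    rintro i ((rfl | h) | h)
    · omega
    · have := h₂ i h; omega
    · exact hv i h
  · simp

/-- The diagrams of the words in the generators up to `k` with the last generator occurring at most
once span the positive braids on the first `k + 2` strands. -/
theorem gen_reduced {n k : ℕ} (hk : k + 2 ≤ n) {w : List ℕ} (h : ∀ i ∈ w, i ≤ k) :
    Gen (List.replicate n true) (List.replicate n true)
      (fun u => ∃ w, IsReduced k w ∧ u = braid n w) (braid n w) := by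
  induction k generalizing w with
  | zero =>
    induction w with
    | nil => exact .base ⟨[], .inl (by simp), rfl⟩
    | cons i w ih =>
      obtain rfl : i = 0 := by simpa using h i (by simp)
      have hi : IsTangle (List.replicate n true) (braid n [0]) (List.replicate n true) :=
        isTangle_braid (by simpa using hk)
      have := (ih fun i hi => h i (by simp [hi])).context hi (q := []) rfl
        (T := fun u => ∃ w, IsReduced 0 w ∧ u = braid n w) (by
          rintro _ ⟨w, h | ⟨u, v, hu, hv, rfl⟩, rfl⟩
          · obtain rfl : w = [] := List.eq_nil_iff_forall_not_mem.2 fun i hi => by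
              simpa using h i hi
            exact .base ⟨[0], .inr ⟨[], [], by simp, by simp, rfl⟩, by simp⟩
          · obtain rfl : u = [] := List.eq_nil_iff_forall_not_mem.2 fun i hi => by
              simpa using hu i hi
            obtain rfl : v = [] := List.eq_nil_iff_forall_not_mem.2 fun i hi => by
              simpa using hv i hi
            exact gen_braid_sq (k := 0) hk ⟨[], .inl (by simp), rfl⟩
              ⟨[0], .inr ⟨[], [], by simp, by simp, rfl⟩, rfl⟩)
      simpa using this
  | succ k ihk =>
    induction w with
    | nil => exact .base ⟨[], .inl (by simp), rfl⟩
    | cons i w ih =>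
      have hi := h i (by simp)
      have ht : IsTangle (List.replicate n true) (braid n [i]) (List.replicate n true) :=
        isTangle_braid (by simp; omega)
      have := (ih fun i hi => h i (by simp [hi])).context ht (q := []) rfl
        (T := fun u => ∃ w, IsReduced (k + 1) w ∧ u = braid n w) (by
          rintro _ ⟨w, hw, rfl⟩
          rw [List.append_nil, ← braid_append, List.singleton_append]
          rcases hi.lt_or_eq with hi | rfl
          · refine .base ⟨i :: w, ?_, rfl⟩
            obtain h | ⟨u, v, hu, hv, rfl⟩ := hw
            · exact .inl (List.forall_mem_cons.2 ⟨hi, h⟩)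
            · exact .inr ⟨i :: u, v, List.forall_mem_cons.2 ⟨hi, hu⟩, hv, rfl⟩
          · obtain h | ⟨u, v, hu, hv, rfl⟩ := hw
            · exact .base ⟨_, .inr ⟨[], w, by simp, h, rfl⟩, rfl⟩
            · have hvt : IsTangle (List.replicate n true) (braid n ([k + 1] ++ v))
                  (List.replicate n true) :=
                isTangle_braid (by simp; exact ⟨by omega, fun i hi => by have := hv i hi; omega⟩)
              -- Now `k + 1` would occur twice. The part `u` between the occurrences is reduced
              -- first, so that `k` occurs in it at most once.
              have := (ihk (by omega) fun i hi => Nat.lt_succ_iff.1 (hu i hi)).context ht hvt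
                (T := fun u => ∃ w, IsReduced (k + 1) w ∧ u = braid n w) (by
                  rintro _ ⟨u, h, rfl⟩
                  rw [← braid_append, ← braid_append]
                  obtain h | ⟨u₁, u₂, h₁, h₂, rfl⟩ := h
                  · exact gen_reduced_far hk h hv
                  · exact gen_reduced_three hk h₁ h₂ hv)
              simpa using this)
      simpa using this

/-! ### Every diagram is a combination of standard diagrams -/

/-- Nested maxima, followed by a descending tangle. -/
def IsStandard (b : List Bool) (w : List Slice) : Prop :=
  ∃ n u, IsDescendingTangle (sorted n n) u b ∧ w = openArcs n ++ u

theorem IsStandard.append {b c : List Bool} {w u : List Slice} (h : IsStandard b w)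
    (hu : IsDescendingTangle b u c) : IsStandard c (w ++ u) := by
  obtain ⟨n, v, hv, rfl⟩ := h
  exact ⟨n, v ++ u, hv.append hu, by simp⟩

theorem Gen.append_descending {b c : List Bool} {w u : List Slice}
    (h : Gen [] b (IsStandard b) w) (hu : IsDescendingTangle b u c) :
    Gen [] c (IsStandard c) (w ++ u) := by
  have := h.context (a' := []) (p := []) (T := IsStandard c) rfl hu.1 fun v hv =>
    .base (hv.append hu)
  simpa using this

theorem shift_smoothing (l r l' r' : List Bool) (e f : Bool) :
    shift l r (smoothing l' r' e f) = smoothing (l ++ l') (r' ++ r) e f := by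
  unfold smoothing
  split <;> simp

theorem Gen.shift {a b : List Bool} {S T : List Slice → Prop} {w : List Slice} (l r : List Bool)
    (h : Gen a b S w) (hST : ∀ v, S v → T (shift l r v)) :
    Gen (l ++ a ++ r) (l ++ b ++ r) T (shift l r w) := by
  induction h with
  | base h => exact .base (hST _ h)
  | iso h _ ih => exact .iso (h.shift l r) ih
  | pos p q l' r' e f h _ _ ih1 ih2 =>
    have h' := h.shift l r
    simp only [shift_append, shift_cons, shift_nil, Slice.shift_mk, shift_smoothing] at h' ih1 ih2 ⊢
    exact .pos _ _ _ _ e f h' ih1 ih2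
  | neg p q l' r' e f h _ _ ih1 ih2 =>
    have h' := h.shift l r
    simp only [shift_append, shift_cons, shift_nil, Slice.shift_mk, shift_smoothing] at h' ih1 ih2 ⊢
    exact .neg _ _ _ _ e f h' ih1 ih2
  | circle p q l' r' h _ ih =>
    have h' := h.shift l r
    simp only [shift_append, shift_cons, shift_nil, Slice.shift_mk] at h' ih ⊢
    exact .circle _ _ _ _ h' ih

/-- The first Reidemeister moves at hand concern a crossing of the two legs of one maximum or
minimum. Sliding the crossing through the maximum brings the curl into that form, and a zigzag
remains. -/
theorem curl_cancel (o : Bool) : TangleEq [true] [true]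
    [⟨[true], .birth true, []⟩, ⟨[], .cross true true o, [false]⟩, ⟨[true], .death true, []⟩] [] := by
  have h1 : TangleEq [true] [true, true, false]
      [⟨[true], .birth true, []⟩, ⟨[], .cross true true o, [false]⟩]
      [⟨[], .birth true, [true]⟩, ⟨[true], .cross false true (!o), []⟩] := by
    refine .of_move (by simpa using LocalMove.slideBirth [] [] true true o) ?_ ?_ <;>
      simp [IsTangle, Slice.src, Slice.tgt, Piece.src, Piece.tgt]
  have h2 : TangleEq [true, false, true] [true]
      [⟨[true], .cross false true (!o), []⟩, ⟨[true], .death true, []⟩]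
      [⟨[true], .death false, []⟩] := by
    refine .of_move (by simpa using LocalMove.reidemeisterOneDeath [true] [] false (!o)) ?_ ?_ <;>
      simp [IsTangle, Slice.src, Slice.tgt, Piece.src, Piece.tgt]
  have h3 : TangleEq [true] [true]
      [⟨[], .birth true, [true]⟩, ⟨[true], .death false, []⟩] [] := by
    refine .of_move (by simpa using LocalMove.zigzagRight [] [] true) ?_ ?_ <;>
      simp [IsTangle, Slice.src, Slice.tgt, Piece.src, Piece.tgt]
  have h4 := h1.append_right (isTangle_death [true] [] true)
  have h5 := h2.append_left (isTangle_birth [] [true] true)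
  exact h4.trans (.trans h5 h3)

theorem braid_succ {n : ℕ} {w : List ℕ} (h : ∀ i ∈ w, i + 2 ≤ n) :
    braid (n + 1) w = shift [] [true] (braid n w) := by
  simp only [shift, braid, List.map_map]
  refine List.map_congr_left fun i hi => ?_
  have := h i hi
  simp only [Function.comp, Slice.shift_mk, List.nil_append, ← List.replicate_succ']
  congr 2
  omega

theorem isDescendingTangle_braid {n : ℕ} (m : ℕ) {w : List ℕ} (h : ∀ i ∈ w, i + 2 ≤ n) :
    IsDescendingTangle (sorted n m) (shift [] (List.replicate m false) (braid n w)) (sorted n m) := by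
  simpa [sorted] using (isDescendingTangle_of_braid fun _ hs => isBraidSlice_of_mem_braid h hs).shift
    [] (List.replicate m false)

theorem birth_braid {n : ℕ} (m : ℕ) {w : List ℕ} (h : ∀ i ∈ w, i + 2 ≤ n) :
    TangleEq (sorted n m) (sorted (n + 1) (m + 1))
      ([⟨List.replicate n true, .birth true, List.replicate m false⟩] ++
        shift [] (List.replicate (m + 1) false) (braid (n + 1) w))
      (shift [] (List.replicate m false) (braid n w) ++
        [⟨List.replicate n true, .birth true, List.replicate m false⟩]) := by
  have := (TangleEq.interchange (isTangle_braid h)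
    (isTangle_birth [] (List.replicate m false) true)).symm
  simpa [braid_succ h, sorted, replicate_true_succ, replicate_false_succ] using this

theorem braid_death {n : ℕ} (m : ℕ) {w : List ℕ} (h : ∀ i ∈ w, i + 2 ≤ n) :
    TangleEq (sorted (n + 1) (m + 1)) (sorted n m)
      (shift [] (List.replicate (m + 1) false) (braid (n + 1) w) ++
        [⟨List.replicate n true, .death true, List.replicate m false⟩])
      ([⟨List.replicate n true, .death true, List.replicate m false⟩] ++
        shift [] (List.replicate m false) (braid n w)) := by
  have := TangleEq.interchange (isTangle_braid h)
    (isTangle_death [] (List.replicate m false) true)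
  simpa [braid_succ h, sorted, replicate_true_succ, replicate_false_succ] using this

theorem isTangle_death_sorted (n m : ℕ) : IsTangle (sorted (n + 1) (m + 1))
    [⟨List.replicate n true, .death true, List.replicate m false⟩] (sorted n m) := by
  simpa [sorted, replicate_true_succ, replicate_false_succ] using
    isTangle_death (List.replicate n true) (List.replicate m false) true

/-- No generator touches the last strand, so its maximum can be lowered to the minimum, and the two
form a circle. -/
theorem gen_partial_closure_of_lt {m : ℕ} {w : List ℕ} (h : ∀ i ∈ w, i + 2 ≤ m) :
    Gen [] (sorted m m) (IsStandard (sorted m m)) (openArcs (m + 1) ++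
      shift [] (List.replicate (m + 1) false) (braid (m + 1) w) ++
      [⟨List.replicate m true, .death true, List.replicate m false⟩]) := by
  have h1 := (birth_braid m h).context (isTangle_openArcs' m) (isTangle_death_sorted m m)
  have h2 := Gen.circle (S := IsStandard (sorted m m)) (a := []) (b := sorted m m)
    (openArcs m ++ shift [] (List.replicate m false) (braid m w)) [] (List.replicate m true)
    (List.replicate m false) (by simpa using h1.right)
    (.base ⟨m, _, isDescendingTangle_braid m h, by simp⟩)
  refine .iso (w := _ ++ _ ++ _) ?_ h2
  simpa [openArcs_succ] using h1

/-- Of a word `u ++ [k] ++ v` the part `u` rises above the last maximum and `v` sinks below the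
minimum; the crossing left between them forms a curl. -/
theorem gen_partial_closure_of_reduced {k : ℕ} {w : List ℕ} (h : IsReduced k w) :
    Gen [] (sorted (k + 1) (k + 1)) (IsStandard (sorted (k + 1) (k + 1))) (openArcs (k + 2) ++
      shift [] (List.replicate (k + 2) false) (braid (k + 2) w) ++
      [⟨List.replicate (k + 1) true, .death true, List.replicate (k + 1) false⟩]) := by
  obtain h | ⟨u, v, hu, hv, rfl⟩ := h
  · exact gen_partial_closure_of_lt fun i hi => by have := h i hi; omega
  · have hu' : ∀ i ∈ u, i + 2 ≤ k + 1 := fun i hi => by have := hu i hi; omega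
    have hv' : ∀ i ∈ v, i + 2 ≤ k + 1 := fun i hi => by have := hv i hi; omega
    have hg := (isDescendingTangle_braid (n := k + 2) (w := [k]) (k + 2) (by simp)).1
    have h1 := (birth_braid (k + 1) hu').append (.append (.refl hg) (braid_death (k + 1) hv'))
    have h2 := ((curl_cancel true).shift (List.replicate k true) (List.replicate (k + 1) false)).context
      (p := shift [] (List.replicate (k + 1) false) (braid (k + 1) u))
      (q := shift [] (List.replicate (k + 1) false) (braid (k + 1) v))
      (a' := sorted (k + 1) (k + 1)) (b' := sorted (k + 1) (k + 1))
      (by simpa [sorted, replicate_true_succ] using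
        (isDescendingTangle_braid (k + 1) hu').1)
      (by simpa [sorted, replicate_true_succ] using
        (isDescendingTangle_braid (k + 1) hv').1)
    have h3 := (h1.trans (by
      simpa [replicate_true_succ, replicate_false_succ] using h2)).append_left
        (isTangle_openArcs' (k + 1))
    refine .iso (by simpa [openArcs_succ (k + 1)] using h3) (.base ⟨k + 1, _,
      (isDescendingTangle_braid (k + 1) hu').append (isDescendingTangle_braid (k + 1) hv'), ?_⟩)
    simp [replicate_false_succ]

theorem gen_partial_closure_positive {m : ℕ} {w : List ℕ} (h : ∀ i ∈ w, i + 2 ≤ m + 1) :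
    Gen [] (sorted m m) (IsStandard (sorted m m)) (openArcs (m + 1) ++
      shift [] (List.replicate (m + 1) false) (braid (m + 1) w) ++
      [⟨List.replicate m true, .death true, List.replicate m false⟩]) := by
  cases m with
  | zero =>
    refine gen_partial_closure_of_lt fun i hi => ?_
    have := h i hi
    omega
  | succ k =>
    have h1 := (gen_reduced (n := k + 2) (k := k) le_rfl (w := w) fun i hi => by
      have := h i hi; omega).shift (T := fun u => ∃ w, IsReduced k w ∧
        u = shift [] (List.replicate (k + 2) false) (braid (k + 2) w)) []
        (List.replicate (k + 2) false) (by rintro _ ⟨w, hw, rfl⟩; exact ⟨w, hw, rfl⟩)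
    refine h1.context (isTangle_openArcs' (k + 2)) (isTangle_death_sorted (k + 1) (k + 1)) ?_
    rintro _ ⟨w, hw, rfl⟩
    exact gen_partial_closure_of_reduced hw

/-- The normal form splits `u` into a braid going down and a braid going up; the latter is
transferred across the maxima, and the skein relation then leaves positive words only. -/
theorem gen_partial_closure {m : ℕ} {u : List Slice}
    (hu : IsDescendingTangle (sorted (m + 1) (m + 1)) u (sorted (m + 1) (m + 1))) :
    Gen [] (sorted m m) (IsStandard (sorted m m)) (openArcs (m + 1) ++ u ++
      [⟨List.replicate m true, .death true, List.replicate m false⟩]) := by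
  obtain ⟨v, hv, h1⟩ := hu.normal_form
  rw [unsort_sorted, List.append_nil] at h1
  obtain ⟨x, hx, h2⟩ := openArcs_parallel hv
  have h3 := ((h1.append_left (isTangle_openArcs' (m + 1))).trans h2).append_right
    (isTangle_death_sorted m m)
  refine .iso h3 ?_
  have h4 := (gen_positive hx).shift (T := fun u => ∃ w : List ℕ, (∀ i ∈ w, i + 2 ≤ m + 1) ∧
        u = shift [] (List.replicate (m + 1) false) (braid (m + 1) w)) []
        (List.replicate (m + 1) false) (by rintro _ ⟨w, hw, rfl⟩; exact ⟨w, hw, rfl⟩)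
  refine h4.context (isTangle_openArcs' (m + 1)) (isTangle_death_sorted m m) ?_
  rintro _ ⟨w, hw, rfl⟩
  exact gen_partial_closure_positive hw

/-- The minimum is slid to the left edge (`g`), the remaining strands are sorted by `s` above it and
unsorted again below it, and it is moved into the middle (`g''`). What lies between the maxima and
the minimum is then a descending tangle between sorted strands. -/
theorem IsStandard.death_true {l r : List Bool} {w : List Slice}
    (h : IsStandard (l ++ [true, false] ++ r) w) :
    Gen [] (l ++ r) (IsStandard (l ++ r)) (w ++ [⟨l, .death true, r⟩]) := by
  obtain ⟨n, u, hu, rfl⟩ := h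
  have c1 := hu.count_eq true
  have c2 := hu.count_eq false
  simp [sorted, List.count_replicate] at c1 c2
  obtain ⟨m, rfl⟩ : ∃ m, n = m + 1 := ⟨n - 1, by omega⟩
  have e1 : (l ++ r).count true = m := by simp; omega
  have e2 : (l ++ r).count false = m := by simp; omega
  have hs := isDescendingTangle_unsort (l ++ r)
  rw [e1, e2] at hs
  obtain ⟨s, hs1, -, hs2⟩ := hs.exists_inverse
  obtain ⟨g, hg, h1⟩ := death_slide l r
  obtain ⟨g', hg', h2⟩ := death_slide (List.replicate m true) (List.replicate m false)
  obtain ⟨g'', hg'', -, h3⟩ := hg'.exists_inverse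
  have hB := (h2.append_left hg''.1).trans (by
    simpa [sorted] using h3.append_right (by simpa [sorted] using isTangle_death [] (sorted m m) true))
  have hA := (TangleEq.interchange (isTangle_death [] [] true) hs1.1).append_right hs.1
  have hC := (hs2.append_left (by simpa using isTangle_death [] (l ++ r) true)).symm
  have hw : IsDescendingTangle ([true, false] ++ (l ++ r))
    (shift [true, false] [] s ++ g'') (sorted (m + 1) (m + 1)) := by
    refine .append (by simpa using hs1.shift [true, false] []) ?_
    simpa [sorted, replicate_true_succ, replicate_false_succ] using hg''
  have hD := hB.symm.context (p := shift [true, false] [] s) (q := unsort (l ++ r))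
    (by simpa [sorted] using hs1.1.shift [true, false] []) (by simpa [sorted] using hs.1)
  have hE := (hC.trans (.trans (by simpa using hA) (by simpa [sorted] using hD))).append_left
    (hu.append hg).1
  have hF := (h1.append_left hu.1).trans (by simpa using hE)
  have hG := (gen_partial_closure ((hu.append hg).append hw)).append_descending hs
  refine .iso ?_ hG
  simpa using hF.append_left (isTangle_openArcs' (m + 1))

/-- Slid to the left edge, the maximum rises past `u` and then moves in to become the innermost of
the nested maxima. All crossings created on the way are descending. -/
theorem IsStandard.birth_true {l r : List Bool} {w : List Slice} (h : IsStandard (l ++ r) w) :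
    Gen [] (l ++ [true, false] ++ r) (IsStandard (l ++ [true, false] ++ r))
      (w ++ [⟨l, .birth true, r⟩]) := by
  obtain ⟨n, u, hu, rfl⟩ := h
  obtain ⟨g, hg, h1⟩ := birth_slide l r
  obtain ⟨g', hg', h2⟩ := birth_slide (List.replicate n true) (List.replicate n false)
  obtain ⟨g'', hg'', h3, -⟩ := hg'.exists_inverse
  have hA := TangleEq.interchange (isTangle_birth [] [] true) hu.1
  have hB := (h2.append_right hg''.1).trans (by
    simpa [sorted] using h3.append_left (isTangle_birth [] (sorted n n) true))
  have hu' := hu.shift [true, false] []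
  simp only [List.append_nil] at hu'
  have hC := hB.symm.append_right hu'.1
  have hD := (h1.append_left hu.1).trans (by
    simpa using (hA.symm.trans (by simpa [sorted] using hC)).append_right hg.1)
  refine .iso (by simpa using hD.append_left (isTangle_openArcs' n)) (.base ⟨n + 1,
    g'' ++ (shift [true, false] [] u ++ g), ?_, ?_⟩)
  · rw [sorted_append_birth]
    exact hg''.append (hu'.append hg)
  · simp [openArcs_succ]

theorem Gen.birth {l r : List Bool} {w : List Slice} (h : Gen [] (l ++ r) (IsStandard (l ++ r)) w)
    (hw : IsTangle [] w (l ++ r)) (e : Bool) :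
    Gen [] (l ++ [e, !e] ++ r) (IsStandard (l ++ [e, !e] ++ r)) (w ++ [⟨l, .birth e, r⟩]) := by
  have h1 : Gen [] (l ++ [true, false] ++ r) (IsStandard (l ++ [true, false] ++ r))
      (w ++ [⟨l, .birth true, r⟩]) := by
    have := h.context (p := []) (T := IsStandard (l ++ [true, false] ++ r)) rfl
      (isTangle_birth l r true) fun v hv => hv.birth_true
    simpa using this
  cases e with
  | true => exact h1
  | false =>
    have h2 := h1.append_descending (.cross l r (e := true) (f := false) (o := true) (by simp))
    refine .iso ?_ h2
    -- A maximum of the other orientation is one of this orientation with its legs crossed.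
    have h3 : TangleEq (l ++ r) (l ++ [false, true] ++ r) [⟨l, .birth false, r⟩]
        [⟨l, .birth true, r⟩, ⟨l, .cross true false true, r⟩] :=
      .symm (.of_move (.reidemeisterOneBirth l r true true)
        (.append (v := [_]) (isTangle_birth l r true) (isTangle_cross l r true false true))
        (isTangle_birth l r false))
    simpa using h3.append_left hw

theorem Gen.death {l r : List Bool} {w : List Slice} {e : Bool}
    (h : Gen [] (l ++ [e, !e] ++ r) (IsStandard (l ++ [e, !e] ++ r)) w)
    (hw : IsTangle [] w (l ++ [e, !e] ++ r)) :
    Gen [] (l ++ r) (IsStandard (l ++ r)) (w ++ [⟨l, .death e, r⟩]) := by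
  have key : ∀ {w}, Gen [] (l ++ [true, false] ++ r) (IsStandard (l ++ [true, false] ++ r)) w →
      Gen [] (l ++ r) (IsStandard (l ++ r)) (w ++ [⟨l, .death true, r⟩]) := by
    intro w h
    have := h.context (p := []) (T := IsStandard (l ++ r)) rfl
      (isTangle_death l r true) fun v hv => hv.death_true
    simpa using this
  cases e with
  | true => exact key h
  | false =>
    have h2 := key (h.append_descending (.cross l r (e := false) (f := true) (o := false)
      (by simp)))
    refine .iso ?_ h2
    have h3 : TangleEq (l ++ [false, true] ++ r) (l ++ r) [⟨l, .death false, r⟩]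
        [⟨l, .cross false true false, r⟩, ⟨l, .death true, r⟩] :=
      .symm (.of_move (.reidemeisterOneDeath l r false false)
        (.append (v := [_]) (isTangle_cross l r false true false) (isTangle_death l r true))
        (isTangle_death l r false))
    simpa using h3.append_left hw

/-- Every tangle without ends at the top is a combination of standard ones. -/
theorem gen_standard {w : List Slice} {b : List Bool} (h : IsTangle [] w b) :
    Gen [] b (IsStandard b) w := by
  induction w using List.reverseRecOn generalizing b with
  | nil =>
    obtain rfl : [] = b := h
    exact .base ⟨0, [], .nil _, rfl⟩
  | append_singleton w s ih =>
    obtain ⟨c, hw, hs⟩ := isTangle_append.1 h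
    have ih := ih hw
    obtain ⟨l, x, r⟩ := s
    obtain ⟨rfl, rfl⟩ := hs
    cases x with
    | birth e =>
      simp only [Slice.src, Slice.tgt, Piece.src, Piece.tgt, List.append_nil] at *
      exact ih.birth hw e
    | death e =>
      simp only [Slice.src, Slice.tgt, Piece.src, Piece.tgt, List.append_nil] at *
      exact ih.death hw
    | cross e f o =>
      simp only [Slice.src, Slice.tgt, Piece.src, Piece.tgt] at *
      by_cases ho : e ≠ f → o = e
      · exact ih.append_descending (.cross l r ho)
      -- Here the strand going up is on top. The switched crossing is descending, and the smoothing
      -- is a minimum followed by a maximum, so both are covered by the other cases.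
      · obtain ⟨hef, hoe⟩ : e ≠ f ∧ o ≠ e := by simpa using ho
        have h1 := ih.append_descending (.cross l r (e := e) (f := f) (o := !o) fun _ => by
          revert hoe; cases o <;> cases e <;> simp)
        obtain rfl : f = !e := by revert hef; cases e <;> cases f <;> simp
        have h2 := (ih.death hw).birth (hw.append (isTangle_death l r e)) (!e)
        have := Gen.switch (S := IsStandard (l ++ [!e, e] ++ r)) w [] l r e (!e) o
          (by simpa using h) (by simpa using h1) (by simpa [smoothing, hef] using h2)
        simpa using this

/-! ### Every non-empty diagram is a multiple of the unknot -/

/-- With two antiparallel strands every crossing is one of the two legs of the maximum; the first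
Reidemeister move removes it and reverses the orientation `e`. -/
theorem closed_curl {e e' : Bool} {u : List Slice}
    (h : IsDescendingTangle [e, !e] u [e', !e']) :
    TangleEq [] [] ([⟨[], .birth e, []⟩] ++ u ++ [⟨[], .death e', []⟩]) unknot.word := by
  induction u generalizing e with
  | nil =>
    obtain rfl : e = e' := by simpa using (List.cons.inj h.1).1
    cases e with
    | true => exact .refl unknot.closed
    | false =>
      have h1 : TangleEq [] [false, true] [⟨[], .birth true, []⟩, ⟨[], .cross true false true, []⟩]
          [⟨[], .birth false, []⟩] :=
        .of_move (.reidemeisterOneBirth [] [] true true) ⟨rfl, rfl, rfl⟩ ⟨rfl, rfl⟩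
      have h2 : TangleEq [true, false] [] [⟨[], .cross true false true, []⟩, ⟨[], .death false, []⟩]
          [⟨[], .death true, []⟩] :=
        .of_move (.reidemeisterOneDeath [] [] true true) ⟨rfl, rfl, rfl⟩ ⟨rfl, rfl⟩
      have h3 := h1.symm.append_right (isTangle_death [] [] false)
      have h4 := h2.append_left (isTangle_birth [] [] true)
      exact h3.trans h4
  | cons s u ih =>
    obtain ⟨l, r, a, b, o, rfl, ho, hl, hu⟩ := h.of_cons
    obtain rfl : l = [] := by
      have := congrArg List.length hl
      exact List.eq_nil_of_length_eq_zero (by simp at this; omega)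
    obtain rfl : r = [] := by
      have := congrArg List.length hl
      exact List.eq_nil_of_length_eq_zero (by simpa using this)
    obtain ⟨rfl, rfl⟩ : e = a ∧ (!e) = b := by simpa using hl
    have h1 : TangleEq [] [!e, e] [⟨[], .birth e, []⟩, ⟨[], .cross e (!e) o, []⟩]
        [⟨[], .birth (!e), []⟩] :=
      .of_move (.reidemeisterOneBirth [] [] e o)
        (by simp [IsTangle, Slice.src, Slice.tgt, Piece.src, Piece.tgt])
        (by simp [IsTangle, Slice.src, Slice.tgt, Piece.src, Piece.tgt])
    have h2 := h1.append_right (hu.1.append (isTangle_death [] [] e'))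
    exact .trans (by simpa using h2) (by simpa using ih (e := !e) (by simpa using hu))

/-- The last slice must be a minimum. Above it there is one strand going down and one going up, so a
standard diagram there has exactly one maximum. Thus the reduction ends at the unknot and never at
the empty diagram. -/
theorem gen_unknot {w : List Slice} (h : IsTangle [] w []) (hw : w ≠ []) :
    Gen [] [] (fun u => u = unknot.word) w := by
  obtain ⟨w, s, rfl⟩ := List.eq_nil_or_concat' w |>.resolve_left hw
  obtain ⟨c, hw, hs⟩ := isTangle_append.1 h
  obtain ⟨l, x, r⟩ := s
  obtain ⟨rfl, hs⟩ := hs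
  obtain ⟨⟨rfl, hx⟩, rfl⟩ : (l = [] ∧ x.tgt = []) ∧ r = [] := by
    simpa [IsTangle, Slice.tgt, and_assoc] using hs
  cases x with
  | birth e => simp [Piece.tgt] at hx
  | cross e f o => simp [Piece.tgt] at hx
  | death e =>
    have := (gen_standard hw).context (p := []) (T := fun u => u = unknot.word) rfl
      (isTangle_death [] [] e) (by
        rintro _ ⟨n, u, hu, rfl⟩
        have hc := hu.count_eq true
        obtain rfl : n = 1 := by
          cases e <;> simpa [sorted, Slice.src, Piece.src, List.count_replicate] using hc
        exact .iso (closed_curl (e := true) (e' := e)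
          (by simpa [sorted, Slice.src, Piece.src] using hu))
          (.base rfl))
    simpa using this

end OrientedLink

/-! ### The vertex model: numerical invariants with the skein relation. -/

namespace OrientedLink

/-! ### The vertex model -/

/-- The weight of a maximum whose left leg goes down. -/
noncomputable def capWeight (N : ℕ) (q : ℂ) (k : ℕ) : ℂ := q ^ (2 * (k : ℤ) + 1 - N)

/-- The diagonal entries of the `R`-matrix and of its inverse. -/
noncomputable def diagEntry (q : ℂ) (o : Bool) (i j : ℕ) : ℂ :=
  if i = j then (if o then q⁻¹ else q)
  else if o then (if j < i then -(q - q⁻¹) else 0) else (if i < j then q - q⁻¹ else 0)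

/-- The factor that makes the `R`-matrix invariant under the first Reidemeister move. -/
noncomputable def framing (N : ℕ) (q : ℂ) (o : Bool) : ℂ :=
  if o then q ^ (N : ℤ) else q ^ (-(N : ℤ))

variable {N : ℕ} {q : ℂ}

theorem capWeight_ne_zero (hq : q ≠ 0) (k : ℕ) : capWeight N q k ≠ 0 := zpow_ne_zero _ hq

theorem capWeight_succ (hq : q ≠ 0) (k : ℕ) :
    capWeight N q (k + 1) = q ^ 2 * capWeight N q k := by
  unfold capWeight
  rw [← zpow_natCast q 2, ← zpow_add₀ hq]
  congr 1
  push_cast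
  ring

theorem capWeight_zero (hq : q ≠ 0) : capWeight N q 0 = q * q ^ (-(N : ℤ)) := by
  unfold capWeight
  rw [← zpow_one_add₀ hq]
  congr 1

theorem capWeight_self (hq : q ≠ 0) : capWeight N q N = q * q ^ (N : ℤ) := by
  unfold capWeight
  rw [← zpow_one_add₀ hq]
  congr 1
  ring

/-- The weighted sums of the model are geometric, as `capWeight` grows by the factor q². Each is
evaluated by naming a primitive `H`. -/
theorem sum_eq_of_telescope {G H : ℕ → ℂ} (h : ∀ k, H (k + 1) - H k = G k) :
    ∑ k : Fin N, G k = H N - H 0 := by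
  rw [← Finset.sum_range_sub, ← Fin.sum_univ_eq_sum_range]
  simp [h]

theorem framing_mul (hq : q ≠ 0) (o : Bool) : framing N q o * framing N q (!o) = 1 := by
  cases o <;> simp [framing, hq]

/-- Partial trace of the `R`-matrix over the right strand. -/
theorem sum_capWeight_mul_diagEntry (hq : q ≠ 0) (o : Bool) (k : Fin N) :
    framing N q o * ∑ j : Fin N, capWeight N q j * diagEntry q o k j = 1 := by
  cases o with
  | false =>
    -- Beyond the diagonal, the summand (q - q⁻¹) u_j is the difference of u_(j+1)/q and u_j/q,
    -- where u is `capWeight`; the diagonal summand q u_k is the first value u_(k+1)/q.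
    rw [sum_eq_of_telescope (N := N) (G := fun j => capWeight N q j * diagEntry q false k j)
      (H := fun j => if (k : ℕ) < j then capWeight N q j / q else 0)]
    · have := capWeight_self (N := N) hq
      simp only [k.2, if_true, this, Nat.not_lt_zero, if_false, framing]
      field_simp
      simp [hq]
    · intro j
      rcases lt_trichotomy (k : ℕ) j with h | h | h
      · simp [diagEntry, h, h.ne, Nat.lt_succ_of_lt h, capWeight_succ hq]
        field_simp
      · simp [diagEntry, ← h, capWeight_succ hq]
        field_simp
      · have h1 : ¬ (k : ℕ) < j := by omega
        have h2 : ¬ (k : ℕ) < j + 1 := by omega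
        simp [diagEntry, h1, h2, h.ne']
  | true =>
    rw [sum_eq_of_telescope (N := N) (G := fun j => capWeight N q j * diagEntry q true k j)
      (H := fun j => if j ≤ (k : ℕ) then (capWeight N q 0 - capWeight N q j) / q
        else capWeight N q 0 / q)]
    · have := capWeight_zero (N := N) hq
      have hk : ¬ N ≤ (k : ℕ) := by omega
      simp only [hk, this, Nat.zero_le, if_true, if_false, framing]
      field_simp
      simp [hq]
    · intro j
      rcases lt_trichotomy (k : ℕ) j with h | h | h
      · have h1 : ¬ j ≤ (k : ℕ) := by omega
        have h2 : ¬ j + 1 ≤ (k : ℕ) := by omega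
        have h3 : ¬ j < (k : ℕ) := by omega
        simp [diagEntry, h1, h2, h3, h.ne]
      · simp [diagEntry, ← h]
        field_simp
        ring
      · simp [diagEntry, h, h.le, Nat.succ_le_of_lt h, h.ne', capWeight_succ hq]
        field_simp
        ring

/-- Partial trace of the `R`-matrix over the left strand. -/
theorem sum_inv_capWeight_mul_diagEntry (hq : q ≠ 0) (o : Bool) (k : Fin N) :
    framing N q o * ∑ j : Fin N, (capWeight N q j)⁻¹ * diagEntry q o j k = 1 := by
  have hu := fun k => capWeight_ne_zero (N := N) hq k
  cases o with
  | false =>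
    rw [sum_eq_of_telescope (N := N) (G := fun j => (capWeight N q j)⁻¹ * diagEntry q false j k)
      (H := fun j => if j ≤ (k : ℕ) then q * ((capWeight N q 0)⁻¹ - (capWeight N q j)⁻¹)
        else q * (capWeight N q 0)⁻¹)]
    · have := capWeight_zero (N := N) hq
      have hk : ¬ N ≤ (k : ℕ) := by omega
      simp only [hk, this, Nat.zero_le, if_true, if_false, framing]
      field_simp
      simp
    · intro j
      have := hu j
      have := hu 0
      rcases lt_trichotomy (k : ℕ) j with h | h | h
      · have h1 : ¬ j ≤ (k : ℕ) := by omega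
        have h2 : ¬ j + 1 ≤ (k : ℕ) := by omega
        have h3 : ¬ j < (k : ℕ) := by omega
        simp [diagEntry, h1, h2, h3, h.ne']
      · have := hu k
        simp [diagEntry, ← h]
        field_simp
        ring
      · simp [diagEntry, h, h.le, Nat.succ_le_of_lt h, h.ne, capWeight_succ hq]
        field_simp
        ring
  | true =>
    rw [sum_eq_of_telescope (N := N) (G := fun j => (capWeight N q j)⁻¹ * diagEntry q true j k)
      (H := fun j => if (k : ℕ) < j then q * (capWeight N q j)⁻¹ else 0)]
    · have := capWeight_self (N := N) hq
      simp only [k.2, if_true, this, Nat.not_lt_zero, if_false, framing]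
      field_simp
      simp
    · intro j
      have := hu j
      rcases lt_trichotomy (k : ℕ) j with h | h | h
      · simp [diagEntry, h, h.ne', Nat.lt_succ_of_lt h, capWeight_succ hq]
        field_simp
      · have := hu k
        simp [diagEntry, ← h, capWeight_succ hq]
        field_simp
      · have h1 : ¬ (k : ℕ) < j := by omega
        have h2 : ¬ (k : ℕ) < j + 1 := by omega
        simp [diagEntry, h1, h2, h.ne]

/-- This is what the second Reidemeister move for antiparallel strands requires beyond the
invertibility of the `R`-matrix. For `i ≠ m` only labels `k` between them contribute, and the terms
`k = i` and `k = m` cancel the geometric series of the others. -/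
theorem sum_diagEntry_mul_diagEntry (hq : q ≠ 0) (o : Bool) (i m : Fin N) :
    ∑ k : Fin N, diagEntry q (!o) k i * diagEntry q o k m * (capWeight N q m / capWeight N q k) =
      if i = m then 1 else 0 := by
  have hu := fun k => capWeight_ne_zero (N := N) hq k
  split_ifs with h
  · subst h
    rw [Finset.sum_eq_single i]
    · have := hu i
      cases o <;> simp [diagEntry] <;> field_simp
    · intro k _ hk
      have hk' : (k : ℕ) ≠ i := fun h => hk (Fin.ext h)
      rcases lt_or_gt_of_ne hk' with h | h
      · have : ¬ (i : ℕ) < k := by omega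
        cases o <;> simp [diagEntry, hk', this]
      · have : ¬ (k : ℕ) < i := by omega
        cases o <;> simp [diagEntry, hk', this]
    · simp
  · have him : (i : ℕ) ≠ m := fun h' => h (Fin.ext h')
    cases o with
    | false =>
      rw [sum_eq_of_telescope (N := N)
        (G := fun k => diagEntry q (!false) k i * diagEntry q false k m *
          (capWeight N q m / capWeight N q k))
        (H := fun k => if (i : ℕ) < k ∧ k ≤ (m : ℕ) then
          (q - q⁻¹) * q * (capWeight N q m / capWeight N q k) else 0)]
      · have : ¬ N ≤ (m : ℕ) := by omega
        simp [this]
      · intro k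
        have := hu k
        have := hu m
        have := hu i
        rcases lt_trichotomy (i : ℕ) k with h1 | h1 | h1 <;>
          rcases lt_trichotomy k (m : ℕ) with h2 | h2 | h2
        · simp [diagEntry, h1, h1.ne', h2, h2.ne, h2.le, Nat.lt_succ_of_lt h1, Nat.succ_le_of_lt h2,
            capWeight_succ hq]
          field_simp
        · subst h2
          simp [diagEntry, h1, h1.ne']
          field_simp
          ring
        · have a1 : ¬ k ≤ (m : ℕ) := by omega
          have a2 : ¬ k < (m : ℕ) := by omega
          simp [diagEntry, a1, a2, h2.ne']
        · subst h1
          simp [diagEntry, h2, h2.ne, Nat.succ_le_of_lt h2, capWeight_succ hq]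
          field_simp
        · omega
        · have a1 : ¬ k ≤ (m : ℕ) := by omega
          have a2 : ¬ k < (m : ℕ) := by omega
          simp [diagEntry, a1, a2, h2.ne']
        all_goals
          have a1 : ¬ (i : ℕ) < k := by omega
          have a2 : ¬ (i : ℕ) < k + 1 := by omega
          simp [diagEntry, a1, a2, h1.ne]
    | true =>
      rw [sum_eq_of_telescope (N := N)
        (G := fun k => diagEntry q (!true) k i * diagEntry q true k m *
          (capWeight N q m / capWeight N q k))
        (H := fun k => if (m : ℕ) < k ∧ k ≤ (i : ℕ) then
          (q - q⁻¹) * q * (capWeight N q m / capWeight N q k) else 0)]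
      · have : ¬ N ≤ (i : ℕ) := by omega
        simp [this]
      · intro k
        have := hu k
        have := hu m
        have := hu i
        rcases lt_trichotomy (m : ℕ) k with h1 | h1 | h1 <;>
          rcases lt_trichotomy k (i : ℕ) with h2 | h2 | h2
        · simp [diagEntry, h1, h1.ne', h2, h2.ne, h2.le, Nat.lt_succ_of_lt h1, Nat.succ_le_of_lt h2,
            capWeight_succ hq]
          field_simp
        · subst h2
          simp [diagEntry, h1, h1.ne']
          field_simp
          ring
        · have a1 : ¬ k ≤ (i : ℕ) := by omega
          have a2 : ¬ k < (i : ℕ) := by omega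
          simp [diagEntry, a1, a2, h2.ne']
        · subst h1
          simp [diagEntry, h2, h2.ne, Nat.succ_le_of_lt h2, capWeight_succ hq]
          field_simp
        · omega
        · have a1 : ¬ k ≤ (i : ℕ) := by omega
          have a2 : ¬ k < (i : ℕ) := by omega
          simp [diagEntry, a1, a2, h2.ne']
        all_goals
          have a1 : ¬ (m : ℕ) < k := by omega
          have a2 : ¬ (m : ℕ) < k + 1 := by omega
          simp [diagEntry, a1, a2, h1.ne]

end OrientedLink

namespace OrientedLink

/-! ### Crossing weights -/

/-- The weight of a crossing of two strands going down, with labels `i`, `j` at the top and `k`, `l`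
at the bottom. -/
noncomputable def parallelEntry (N : ℕ) (q : ℂ) (o : Bool) (i j k l : Fin N) : ℂ :=
  framing N q o * if k = i ∧ l = j then diagEntry q o i j else if k = j ∧ l = i then 1 else 0

/-- The weight of a crossing, with labels `i`, `j` at the top and `k`, `l` at the bottom. -/
noncomputable def crossEntry (N : ℕ) (q : ℂ) : Bool → Bool → Bool →
    Fin N → Fin N → Fin N → Fin N → ℂ
  | true, true, o, i, j, k, l => parallelEntry N q o i j k l
  | false, false, o, i, j, k, l => parallelEntry N q o l k j i
  | true, false, o, i, j, k, l => parallelEntry N q (!o) k i l j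
  | false, true, o, i, j, k, l =>
    capWeight N q l / capWeight N q i * parallelEntry N q (!o) j l i k

/-- The weight of a maximum. -/
noncomputable def birthWeight (N : ℕ) (q : ℂ) (e : Bool) (i : Fin N) : ℂ :=
  if e then capWeight N q i else 1

/-- The weight of a minimum. -/
noncomputable def deathWeight (N : ℕ) (q : ℂ) (e : Bool) (i : Fin N) : ℂ :=
  if e then 1 else (capWeight N q i)⁻¹

variable {N : ℕ} {q : ℂ}

theorem birthWeight_ne_zero (hq : q ≠ 0) (e : Bool) (i : Fin N) : birthWeight N q e i ≠ 0 := by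
  cases e <;> simp [birthWeight, capWeight_ne_zero hq]

theorem deathWeight_not (e : Bool) (i : Fin N) :
    deathWeight N q (!e) i = (birthWeight N q e i)⁻¹ := by
  cases e <;> simp [birthWeight, deathWeight]

/-- The weights of a crossing and of the crossing turned by a right angle. -/
theorem crossEntry_rotate (hq : q ≠ 0) (e f o : Bool) (i k l x : Fin N) :
    birthWeight N q e k * crossEntry N q (!e) f (!o) k x l i =
      birthWeight N q e i * crossEntry N q f e o x i k l := by
  have hu := fun k => capWeight_ne_zero (N := N) hq k
  cases e <;> cases f <;> simp only [birthWeight, crossEntry, Bool.not_true, Bool.not_false,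
    if_true, Bool.not_not, Bool.false_eq_true, if_false]
  · rw [parallelEntry]
    have := hu i
    have := hu x
    split_ifs with h1 h2
    · obtain ⟨rfl, rfl⟩ := h1
      field_simp
    · obtain ⟨rfl, rfl⟩ := h2
      field_simp
    · simp
  · have := hu k
    field_simp

/-- Labels are kept or swapped, so at most two terms survive. For `i = j` the two possibilities
coincide and only the diagonal entry counts. -/
theorem sum_parallelEntry_mul (o : Bool) (i j : Fin N) (g : Fin N → Fin N → ℂ) :
    ∑ k, ∑ l, parallelEntry N q o i j k l * g k l =
      framing N q o * ((if i = j then 0 else g j i) + diagEntry q o i j * g i j) := by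
  have h : ∀ k l, parallelEntry N q o i j k l * g k l =
      framing N q o * ((if k = j then if l = i then if i = j then 0 else g j i else 0 else 0) +
        if k = i then if l = j then diagEntry q o i j * g i j else 0 else 0) := by
    intro k l
    unfold parallelEntry
    grind
  simp only [h, ← Finset.mul_sum, Finset.sum_add_distrib]
  simp

theorem diagEntry_add_swap {i j : Fin N} (h : i ≠ j) (o : Bool) :
    diagEntry q (!o) j i + diagEntry q o i j = 0 := by
  have h' : (i : ℕ) ≠ j := fun h' => h (Fin.ext h')
  rcases lt_or_gt_of_ne h' with h1 | h1 <;> cases o <;>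
    simp [diagEntry, h1, h1.ne, h1.ne', not_lt.2 h1.le]

theorem diagEntry_mul_of_ne {i j : Fin N} (h : i ≠ j) (o : Bool) :
    diagEntry q o i j * diagEntry q (!o) i j = 0 := by
  have h' : (i : ℕ) ≠ j := fun h' => h (Fin.ext h')
  rcases lt_or_gt_of_ne h' with h1 | h1 <;> cases o <;>
    simp [diagEntry, h1, h1.ne, h1.ne', not_lt.2 h1.le]

theorem diagEntry_mul_self (hq : q ≠ 0) (i : ℕ) (o : Bool) :
    diagEntry q o i i * diagEntry q (!o) i i = 1 := by
  cases o <;> simp [diagEntry, hq]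

theorem sum_parallelEntry_mul_parallelEntry (hq : q ≠ 0) (o : Bool) (i j i' j' : Fin N) :
    ∑ k, ∑ l, parallelEntry N q o i j k l * parallelEntry N q (!o) k l i' j' =
      if i = i' ∧ j = j' then 1 else 0 := by
  rw [sum_parallelEntry_mul]
  have hf := framing_mul (N := N) hq o
  unfold parallelEntry
  by_cases h : i = j
  · subst h
    have hd := diagEntry_mul_self (q := q) hq i o
    grind
  · have hd := diagEntry_add_swap (q := q) h o
    have hd' := diagEntry_mul_of_ne (q := q) h o
    grind

/-- A crossing as a matrix. -/
noncomputable def crossMatrix (N : ℕ) (q : ℂ) (e f o : Bool) :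
    Matrix (Fin N × Fin N) (Fin N × Fin N) ℂ :=
  .of fun x y => crossEntry N q e f o x.1 x.2 y.1 y.2

/-- Antiparallel crossings are parallel ones turned by a right angle. In their product the swapping
terms give the identity off the diagonal labels, and the label of the loop between the crossings is
summed by `sum_diagEntry_mul_diagEntry`. -/
theorem crossMatrix_down_up (hq : q ≠ 0) (o : Bool) :
    crossMatrix N q true false o * crossMatrix N q false true (!o) = 1 := by
  have hu := fun k => capWeight_ne_zero (N := N) hq k
  ext ⟨i, j⟩ ⟨i', j'⟩
  have h : ∀ k l, crossEntry N q true false o i j k l * crossEntry N q false true (!o) k l i' j' =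
      (if l = i then if k = j then if i' = i ∧ j' = j ∧ i ≠ j then 1 else 0 else 0 else 0) +
      if l = k then if i = j ∧ i' = j' then diagEntry q (!o) k i * diagEntry q o k j' *
        (capWeight N q j' / capWeight N q k) else 0 else 0 := by
    intro k l
    have hf := framing_mul (N := N) hq o
    have := hu k
    simp only [crossEntry, parallelEntry, Bool.not_not]
    have hk : capWeight N q k / capWeight N q k = 1 := div_self (hu k)
    generalize hz : capWeight N q j' / capWeight N q k = z at *
    by_cases h1 : l = k
    · subst h1
      grind
    · grind
  simp only [Matrix.mul_apply, crossMatrix, Matrix.of_apply, Fintype.sum_prod_type, h,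
    Finset.sum_add_distrib]
  have hs := sum_diagEntry_mul_diagEntry (N := N) hq o i j'
  by_cases h1 : i = j ∧ i' = j'
  · obtain ⟨rfl, rfl⟩ := h1
    simp [hs, Matrix.one_apply]
  · simp only [Matrix.one_apply, Prod.mk.injEq]
    simp
    grind

end OrientedLink

namespace OrientedLink

variable {N : ℕ} {q : ℂ}

/-! ### The moves for crossing weights -/

theorem crossMatrix_mul (hq : q ≠ 0) (e f o : Bool) :
    crossMatrix N q e f o * crossMatrix N q f e (!o) = 1 := by
  cases e <;> cases f
  · ext ⟨i, j⟩ ⟨i', j'⟩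
    have := sum_parallelEntry_mul_parallelEntry (N := N) hq (!o) j' i' j i
    simp only [Matrix.mul_apply, crossMatrix, Matrix.of_apply, Fintype.sum_prod_type, crossEntry]
    rw [Finset.sum_comm]
    simp only [Bool.not_not] at this
    simp only [mul_comm (parallelEntry N q o _ _ _ _), this, Matrix.one_apply, Prod.mk.injEq]
    grind
  · have := crossMatrix_down_up (N := N) hq (!o)
    rw [Bool.not_not] at this
    -- A one-sided inverse of a finite square matrix is two-sided, so the other antiparallel case
    -- needs no new sum.
    exact _root_.mul_eq_one_comm.1 this
  · exact crossMatrix_down_up hq o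
  · ext ⟨i, j⟩ ⟨i', j'⟩
    simp [Matrix.mul_apply, crossMatrix, Fintype.sum_prod_type, crossEntry,
      sum_parallelEntry_mul_parallelEntry hq, Matrix.one_apply]

theorem sum_crossEntry_mul_crossEntry (hq : q ≠ 0) (e f o : Bool) (i j i' j' : Fin N) :
    ∑ k, ∑ l, crossEntry N q e f o i j k l * crossEntry N q f e (!o) k l i' j' =
      if i = i' ∧ j = j' then 1 else 0 := by
  have := congrFun (congrFun (crossMatrix_mul (N := N) hq e f o) (i, j)) (i', j')
  simpa [Matrix.mul_apply, crossMatrix, Fintype.sum_prod_type, Matrix.one_apply] using this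

theorem sum_birthWeight_mul_crossEntry (hq : q ≠ 0) (e o : Bool) (k l : Fin N) :
    ∑ i, birthWeight N q e i * crossEntry N q e (!e) o i i k l =
      if k = l then birthWeight N q (!e) k else 0 := by
  have hu := fun k => capWeight_ne_zero (N := N) hq k
  cases e
  · have h : ∀ i, birthWeight N q false i * crossEntry N q false (!false) o i i k l =
        if k = l then capWeight N q l *
          (framing N q (!o) * ((capWeight N q i)⁻¹ * diagEntry q (!o) i l)) else 0 := by
      intro i
      simp only [birthWeight, Bool.not_false, crossEntry, parallelEntry]
      grind
    simp only [h]
    split_ifs with hkl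
    · rw [← Finset.mul_sum, ← Finset.mul_sum, sum_inv_capWeight_mul_diagEntry hq]
      simp [birthWeight, hkl]
    · simp
  · have h : ∀ i, birthWeight N q true i * crossEntry N q true (!true) o i i k l =
        if k = l then framing N q (!o) * (capWeight N q i * diagEntry q (!o) k i) else 0 := by
      intro i
      simp only [birthWeight, Bool.not_true, crossEntry, parallelEntry]
      grind
    simp only [h]
    split_ifs with hkl
    · rw [← Finset.mul_sum, sum_capWeight_mul_diagEntry hq]
      simp [birthWeight]
    · simp

theorem sum_crossEntry_mul_deathWeight (hq : q ≠ 0) (e o : Bool) (i j : Fin N) :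
    ∑ k, crossEntry N q e (!e) o i j k k * deathWeight N q (!e) k =
      if i = j then deathWeight N q e i else 0 := by
  have hu := fun k => capWeight_ne_zero (N := N) hq k
  cases e
  · have h : ∀ k, crossEntry N q false (!false) o i j k k * deathWeight N q (!false) k =
        if i = j then (capWeight N q i)⁻¹ *
          (framing N q (!o) * (capWeight N q k * diagEntry q (!o) j k)) else 0 := by
      intro k
      simp only [deathWeight, Bool.not_false, crossEntry, parallelEntry]
      grind
    simp only [h]
    split_ifs with hij
    · rw [← Finset.mul_sum, ← Finset.mul_sum, sum_capWeight_mul_diagEntry hq]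
      simp [deathWeight]
    · simp
  · have h : ∀ k, crossEntry N q true (!true) o i j k k * deathWeight N q (!true) k =
        if i = j then framing N q (!o) * ((capWeight N q k)⁻¹ * diagEntry q (!o) k i) else 0 := by
      intro k
      simp only [deathWeight, Bool.not_true, crossEntry, parallelEntry]
      grind
    simp only [h]
    split_ifs with hij
    · rw [← Finset.mul_sum, sum_inv_capWeight_mul_diagEntry hq]
      simp [deathWeight]
    · simp

/-- The value of `l` in the vertex model. -/
noncomputable def lValue (N : ℕ) (q : ℂ) : ℂ := Complex.I * q ^ (N : ℤ)

/-- The value of `m` in the vertex model. -/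
noncomputable def mValue (q : ℂ) : ℂ := -Complex.I * (q - q⁻¹)

/-- The weight of a smoothed crossing. -/
noncomputable def smoothEntry (N : ℕ) (q : ℂ) (e f : Bool) (i j k l : Fin N) : ℂ :=
  if e = f then (if k = i ∧ l = j then 1 else 0)
  else if i = j ∧ k = l then deathWeight N q e i * birthWeight N q f k else 0

/-- The factors q^(±N) in l^(±1) cancel the framing factors. What remains is the Hecke relation: the
`R`-matrix and its inverse differ by q - q⁻¹ times the identity, their swapping parts being equal.
-/
theorem parallelEntry_skein (hq : q ≠ 0) (i j k l : Fin N) :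
    lValue N q * parallelEntry N q false i j k l +
      (lValue N q)⁻¹ * parallelEntry N q true i j k l +
      mValue q * (if k = i ∧ l = j then 1 else 0) = 0 := by
  have hI : Complex.I ≠ 0 := Complex.I_ne_zero
  have hI2 : Complex.I⁻¹ = -Complex.I := Complex.inv_I
  have hN : q ^ (N : ℤ) ≠ 0 := zpow_ne_zero _ hq
  have h1 : ∀ x, lValue N q * (framing N q false * x) = Complex.I * x := by
    intro x
    simp only [lValue, framing, zpow_neg]
    simp
    field_simp
  have h2 : ∀ x, (lValue N q)⁻¹ * (framing N q true * x) = -Complex.I * x := by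
    intro x
    simp only [lValue, framing, mul_inv, hI2]
    simp
    field_simp
  simp only [parallelEntry, h1, h2, mValue]
  have hd : diagEntry q false i j - diagEntry q true i j = q - q⁻¹ := by
    simp only [diagEntry]
    rcases lt_trichotomy (i : ℕ) j with h | h | h
    · simp [h, h.ne, not_lt.2 h.le]
    · simp [h]
    · simp [h, h.ne', not_lt.2 h.le]
  split_ifs
  · linear_combination Complex.I * hd
  · ring
  · ring

/-- A turn by a right angle takes the two vertical strands to a minimum above a maximum, and the
quotient of cap weights is the weight of that pair. So the mixed orientations follow from the
parallel case. -/
theorem crossEntry_skein (hq : q ≠ 0) (e f : Bool) (i j k l : Fin N) :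
    lValue N q * crossEntry N q e f (xor e f) i j k l +
      (lValue N q)⁻¹ * crossEntry N q e f (!(xor e f)) i j k l +
      mValue q * smoothEntry N q e f i j k l = 0 := by
  have hu := fun k => capWeight_ne_zero (N := N) hq k
  cases e <;> cases f
  · have := parallelEntry_skein hq l k j i
    simp only [smoothEntry, crossEntry]
    grind
  · have := parallelEntry_skein hq j l i k
    simp only [smoothEntry, crossEntry, deathWeight, birthWeight]
    have h1 := hu i
    simp
    by_cases h : i = j ∧ k = l
    · have h' : i = j ∧ k = l := h
      rw [if_pos h]
      rw [if_pos ⟨h.1, h.2⟩] at this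
      rw [div_eq_mul_inv]
      linear_combination capWeight N q l * (capWeight N q i)⁻¹ * this +
        mValue q * (capWeight N q i)⁻¹ * (congrArg (fun k : Fin N => capWeight N q k) h.2)
    · have h' : ¬ (i = j ∧ k = l) := h
      rw [if_neg h]
      rw [if_neg h'] at this
      linear_combination capWeight N q l / (capWeight N q i) * this
  · have := parallelEntry_skein hq k i l j
    simp only [smoothEntry, crossEntry, deathWeight, birthWeight]
    grind
  · have := parallelEntry_skein hq i j k l
    simpa [smoothEntry, crossEntry] using this

/-! ### The Yang-Baxter equation -/

/-- An operator on the first two of three strands. -/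
def onLeft (A : Fin N → Fin N → Fin N → Fin N → ℂ) :
    Matrix (Fin N × Fin N × Fin N) (Fin N × Fin N × Fin N) ℂ :=
  .of fun x y => if x.2.2 = y.2.2 then A x.1 x.2.1 y.1 y.2.1 else 0

/-- An operator on the last two of three strands. -/
def onRight (A : Fin N → Fin N → Fin N → Fin N → ℂ) :
    Matrix (Fin N × Fin N × Fin N) (Fin N × Fin N × Fin N) ℂ :=
  .of fun x y => if x.1 = y.1 then A x.2.1 x.2.2 y.2.1 y.2.2 else 0

open Matrix in
theorem onLeft_mulVec (A : Fin N → Fin N → Fin N → Fin N → ℂ) (g : Fin N × Fin N × Fin N → ℂ)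
    (i j k : Fin N) : (onLeft A *ᵥ g) (i, j, k) = ∑ x, ∑ y, A i j x y * g (x, y, k) := by
  simp [Matrix.mulVec, dotProduct, onLeft, Fintype.sum_prod_type]

open Matrix in
theorem onRight_mulVec (A : Fin N → Fin N → Fin N → Fin N → ℂ) (g : Fin N × Fin N × Fin N → ℂ)
    (i j k : Fin N) : (onRight A *ᵥ g) (i, j, k) = ∑ x, ∑ y, A j k x y * g (i, x, y) := by
  simp [Matrix.mulVec, dotProduct, onRight, Fintype.sum_prod_type]

theorem onLeft_onRight_onLeft (A B C : Fin N → Fin N → Fin N → Fin N → ℂ)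
    (i j k i' j' k' : Fin N) : (onLeft A * onRight B * onLeft C) (i, j, k) (i', j', k') =
      ∑ x, ∑ y, ∑ z, A i j x y * B y k z k' * C x z i' j' := by
  simp [Matrix.mul_apply, onLeft, onRight, Fintype.sum_prod_type]
  simp only [Finset.sum_mul]
  exact Finset.sum_congr rfl fun x _ => Finset.sum_comm

theorem onRight_onLeft_onRight (A B C : Fin N → Fin N → Fin N → Fin N → ℂ)
    (i j k i' j' k' : Fin N) : (onRight A * onLeft B * onRight C) (i, j, k) (i', j', k') =
      ∑ x, ∑ y, ∑ z, A j k x y * B i x i' z * C z y j' k' := by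
  simp [Matrix.mul_apply, onLeft, onRight, Fintype.sum_prod_type]
  simp only [Finset.sum_mul]
  rw [Finset.sum_congr rfl fun x _ => Finset.sum_comm, Finset.sum_comm]
  exact Finset.sum_congr rfl fun x _ => Finset.sum_comm

theorem onLeft_cross_cancel (hq : q ≠ 0) (e f o : Bool) :
    onLeft (crossEntry N q e f o) * onLeft (crossEntry N q f e (!o)) = 1 := by
  ext ⟨i, j, k⟩ ⟨i', j', k'⟩
  have := sum_crossEntry_mul_crossEntry (N := N) hq e f o i j i' j'
  simp [Matrix.mul_apply, onLeft, Fintype.sum_prod_type, Matrix.one_apply]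
  split_ifs <;> simp_all

theorem onRight_cross_cancel (hq : q ≠ 0) (e f o : Bool) :
    onRight (crossEntry N q e f o) * onRight (crossEntry N q f e (!o)) = 1 := by
  ext ⟨i, j, k⟩ ⟨i', j', k'⟩
  have := sum_crossEntry_mul_crossEntry (N := N) hq e f o j k j' k'
  simp [Matrix.mul_apply, onRight, Fintype.sum_prod_type, Matrix.one_apply]
  split_ifs <;> simp_all

/-- The Yang-Baxter equation for three strands with the orientations `a`, `b`, `c`. -/
def YangBaxter (N : ℕ) (q : ℂ) (a b c oab oac obc : Bool) : Prop :=
  onLeft (crossEntry N q a b oab) * onRight (crossEntry N q a c oac) *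
      onLeft (crossEntry N q b c obc) =
    onRight (crossEntry N q b c obc) * onLeft (crossEntry N q a c oac) *
      onRight (crossEntry N q a b oab)

/-- Multiply by the inverse of the crossing of `a` and `b` on the left of one side and on the right
of the other: each side loses that factor and gains its inverse at the opposite end. -/
theorem YangBaxter.swap (hq : q ≠ 0) {a b c oab oac obc : Bool}
    (h : YangBaxter N q a b c oab oac obc) : YangBaxter N q b a c (!oab) obc oac := by
  have h1 := onLeft_cross_cancel (N := N) hq b a (!oab)
  have h2 := onRight_cross_cancel (N := N) hq a b oab
  rw [Bool.not_not] at h1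
  unfold YangBaxter at h ⊢
  calc _ = onLeft (crossEntry N q b a (!oab)) * (onRight (crossEntry N q b c obc) *
          onLeft (crossEntry N q a c oac) * onRight (crossEntry N q a b oab)) *
          onRight (crossEntry N q b a (!oab)) := by
        simp only [mul_assoc, h2, mul_one]
    _ = _ := by
        rw [← h]
        simp only [← mul_assoc, h1, one_mul]

/-- Bending the strand `c` around to the far left turns its two crossings by a right angle, so the
equation is that for `a, b, c` with permuted labels. -/
theorem YangBaxter.rotate (hq : q ≠ 0) {a b c oab oac obc : Bool}
    (h : YangBaxter N q a b c oab oac obc) : YangBaxter N q (!c) a b (!oac) (!obc) oab := by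
  ext ⟨i, j, k⟩ ⟨i', j', k'⟩
  have hw := fun i => birthWeight_ne_zero (N := N) hq c i
  have hr : ∀ (f o : Bool) (k x l i : Fin N), crossEntry N q (!c) f (!o) k x l i =
      birthWeight N q c i / birthWeight N q c k * crossEntry N q f c o x i k l := by
    intro f o k x l i
    have := crossEntry_rotate hq c f o i k l x
    have := hw k
    field_simp
    linear_combination crossEntry_rotate hq c f o i k l x
  -- The ends of `c` are now labelled `i` and `k'`. The birth weights at its inner label cancel, so
  -- both sides carry the same factor.
  have h1 := congrFun (congrFun h (j, k, k')) (i, i', j')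
  rw [onLeft_onRight_onLeft, onRight_onLeft_onRight] at h1
  rw [onLeft_onRight_onLeft, onRight_onLeft_onRight]
  have h2 : ∀ x y z : Fin N, crossEntry N q (!c) a (!oac) i j x y *
      crossEntry N q (!c) b (!obc) y k z k' * crossEntry N q a b oab x z i' j' =
      birthWeight N q c k' / birthWeight N q c i * (crossEntry N q b c obc k k' y z *
        crossEntry N q a c oac j y i x * crossEntry N q a b oab x z i' j') := by
    intro x y z
    have := hw y
    have := hw i
    rw [hr, hr]
    field_simp
  have h3 : ∀ x y z : Fin N, crossEntry N q a b oab j k x y *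
      crossEntry N q (!c) b (!obc) i x i' z * crossEntry N q (!c) a (!oac) z y j' k' =
      birthWeight N q c k' / birthWeight N q c i * (crossEntry N q a b oab j k x y *
        crossEntry N q a c oac y k' z j' * crossEntry N q b c obc x z i i') := by
    intro x y z
    have := hw z
    have := hw i
    rw [hr, hr]
    field_simp
  simp only [h2, h3, ← Finset.mul_sum]
  rw [h1]
  congr 1
  rw [Finset.sum_comm]
  exact Finset.sum_congr rfl fun x _ => Finset.sum_comm

end OrientedLink

namespace OrientedLink

variable {N : ℕ} {q : ℂ}

theorem YangBaxter.swap_right (hq : q ≠ 0) {a b c oab oac obc : Bool}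
    (h : YangBaxter N q a b c oab oac obc) : YangBaxter N q a c b oac oab (!obc) := by
  have h1 := onRight_cross_cancel (N := N) hq c b (!obc)
  have h2 := onLeft_cross_cancel (N := N) hq b c obc
  rw [Bool.not_not] at h1
  unfold YangBaxter at h ⊢
  calc _ = onRight (crossEntry N q c b (!obc)) * (onRight (crossEntry N q b c obc) *
          onLeft (crossEntry N q a c oac) * onRight (crossEntry N q a b oab)) *
          onLeft (crossEntry N q c b (!obc)) := by
        simp only [← mul_assoc, h1, one_mul]
    _ = _ := by
        rw [← h]
        simp only [mul_assoc, h2, mul_one]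

theorem yangBaxter_positive (hq : q ≠ 0) : YangBaxter N q true true true false false false := by
  -- Comparing the actions on an arbitrary vector `g` lets `sum_parallelEntry_mul` collapse each
  -- crossing to two terms.
  refine Matrix.ext_of_mulVec_single fun x => ?_
  generalize (Pi.single x 1 : Fin N × Fin N × Fin N → ℂ) = g
  ext ⟨i, j, k⟩
  simp only [← Matrix.mulVec_mulVec, onLeft_mulVec, onRight_mulVec, crossEntry,
    sum_parallelEntry_mul]
  generalize framing N q false = c
  have hd : ∀ i j : Fin N, i < j → diagEntry q false i j = q - q⁻¹ := fun i j h => by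
    simp [diagEntry, h, Fin.val_inj, h.ne]
  have hd' : ∀ i j : Fin N, j < i → diagEntry q false i j = 0 := fun i j h => by
    simp [diagEntry, Fin.val_inj, h.ne', not_lt_of_gt h]
  have hd0 : ∀ i : Fin N, diagEntry q false i i = q := fun i => by simp [diagEntry]
  have hq' : q * q⁻¹ = 1 := mul_inv_cancel₀ hq
  -- Only the relative order of the three labels matters.
  rcases lt_trichotomy i j with h1 | h1 | h1 <;>
    rcases lt_trichotomy j k with h2 | h2 | h2 <;>
      rcases lt_trichotomy i k with h3 | h3 | h3 <;> try omega
  all_goals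
    subst_vars
    simp [*, -mul_eq_mul_left_iff, ne_of_lt, ne_of_gt]
  all_goals first | done | ring1 | (field_simp; done) | (field_simp; ring1)

/-- The hypothesis excludes the two cyclic choices of over-bits. The other six are the height orders
of three strands, and the two swaps lead from one of them to all. -/
theorem yangBaxter_down (hq : q ≠ 0) (oab oac obc : Bool) (h : oab = obc → oac = oab) :
    YangBaxter N q true true true oab oac obc := by
  have h1 := yangBaxter_positive (N := N) hq
  cases oab <;> cases oac <;> cases obc
  · exact h1
  · exact h1.swap_right hq
  · simp at h
  · exact (h1.swap hq).swap_right hq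
  · exact h1.swap hq
  · simp at h
  · exact (h1.swap_right hq).swap hq
  · exact ((h1.swap hq).swap_right hq).swap hq

/-- Repeated rotation runs through six of the eight orientations; the two alternating ones come from
neighbours by a swap. -/
theorem yangBaxter (hq : q ≠ 0) (a b c oab oac obc : Bool) (h : oab = obc → oac = oab) :
    YangBaxter N q a b c oab oac obc := by
  have h0 := yangBaxter_down (N := N) hq
  have h1 : ∀ oab oac obc, (oab = obc → oac = oab) → YangBaxter N q false true true oab oac obc :=
    fun x y z h => by
      simpa using (h0 z (!x) (!y) (by revert h; cases x <;> cases y <;> cases z <;> simp)).rotate hq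
  have h2 : ∀ oab oac obc, (oab = obc → oac = oab) → YangBaxter N q false false true oab oac obc :=
    fun x y z h => by
      simpa using (h1 z (!x) (!y) (by revert h; cases x <;> cases y <;> cases z <;> simp)).rotate hq
  have h3 : ∀ oab oac obc, (oab = obc → oac = oab) → YangBaxter N q false false false oab oac obc :=
    fun x y z h => by
      simpa using (h2 z (!x) (!y) (by revert h; cases x <;> cases y <;> cases z <;> simp)).rotate hq
  have h4 : ∀ oab oac obc, (oab = obc → oac = oab) → YangBaxter N q true false false oab oac obc :=
    fun x y z h => by
      simpa using (h3 z (!x) (!y) (by revert h; cases x <;> cases y <;> cases z <;> simp)).rotate hq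
  have h5 : ∀ oab oac obc, (oab = obc → oac = oab) → YangBaxter N q true true false oab oac obc :=
    fun x y z h => by
      simpa using (h4 z (!x) (!y) (by revert h; cases x <;> cases y <;> cases z <;> simp)).rotate hq
  cases a <;> cases b <;> cases c
  · exact h3 _ _ _ h
  · exact h2 _ _ _ h
  · simpa using (h4 (!oab) obc oac (by
      revert h; cases oab <;> cases oac <;> cases obc <;> simp)).swap hq
  · exact h1 _ _ _ h
  · exact h4 _ _ _ h
  · simpa using (h1 (!oab) obc oac (by
      revert h; cases oab <;> cases oac <;> cases obc <;> simp)).swap hq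
  · exact h5 _ _ _ h
  · exact h0 _ _ _ h

end OrientedLink

namespace OrientedLink

variable {N : ℕ} {q : ℂ}

/-! ### The state sum of a tangle diagram -/

/-- The operator of a piece, on functions of the labels at its bottom. -/
noncomputable def pieceAct (N : ℕ) (q : ℂ) :
    Piece → (List (Fin N) → ℂ) → List (Fin N) → ℂ
  | .birth e, g, [] => ∑ i, birthWeight N q e i * g [i, i]
  | .death e, g, [i, j] => if i = j then deathWeight N q e i * g [] else 0
  | .cross e f o, g, [i, j] => ∑ k, ∑ l, crossEntry N q e f o i j k l * g [k, l]
  | _, _, _ => 0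

/-- The operator of a slice. -/
noncomputable def sliceAct (N : ℕ) (q : ℂ) (s : Slice) (f : List (Fin N) → ℂ)
    (L : List (Fin N)) : ℂ :=
  pieceAct N q s.piece (fun M => f (L.take s.left.length ++ M ++
    L.drop (s.left.length + s.piece.src.length)))
    ((L.drop s.left.length).take s.piece.src.length)

/-- The state sum of a tangle diagram, as an operator on functions of the labels at its bottom. -/
noncomputable def stateSum (N : ℕ) (q : ℂ) : List Slice → (List (Fin N) → ℂ) → List (Fin N) → ℂ
  | [], f => f
  | s :: w, f => sliceAct N q s (stateSum N q w f)

theorem stateSum_append (v w : List Slice) (f : List (Fin N) → ℂ) :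
    stateSum N q (v ++ w) f = stateSum N q v (stateSum N q w f) := by
  induction v with
  | nil => rfl
  | cons s v ih => simp [stateSum, ih]

theorem sliceAct_append (s : Slice) (f : List (Fin N) → ℂ) {A M B : List (Fin N)}
    (hA : A.length = s.left.length) (hM : M.length = s.piece.src.length) :
    sliceAct N q s f (A ++ M ++ B) = pieceAct N q s.piece (fun M' => f (A ++ M' ++ B)) M := by
  unfold sliceAct
  rw [← hA, ← hM]
  simp [List.drop_append, List.drop_eq_nil_of_le (Nat.le_add_right A.length M.length)]

/-- Functions of labels live on lists of all lengths. Only lists that fit the strands matter, hence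
the length hypotheses here and below. -/
theorem pieceAct_congr (x : Piece) {f g : List (Fin N) → ℂ} (M : List (Fin N))
    (h : ∀ M, M.length = x.tgt.length → f M = g M) : pieceAct N q x f M = pieceAct N q x g M := by
  unfold pieceAct
  split
  · simp [h _ (show [_, _].length = _ from rfl)]
  · rw [h [] rfl]
  · simp [h _ (show [_, _].length = _ from rfl)]
  · rfl

theorem exists_split {a b c : List Bool} {L : List (Fin N)} (h : L.length = (a ++ b ++ c).length) :
    ∃ A M B, L = A ++ M ++ B ∧ A.length = a.length ∧ M.length = b.length ∧
      B.length = c.length := by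
  simp only [List.length_append] at h
  refine ⟨L.take a.length, (L.drop a.length).take b.length, L.drop (a.length + b.length), ?_,
    ?_, ?_, ?_⟩
  · rw [List.append_assoc, ← List.drop_drop, List.take_append_drop, List.take_append_drop]
  · simp; omega
  · simp; omega
  · simp; omega

theorem sliceAct_congr (s : Slice) {f g : List (Fin N) → ℂ} {L : List (Fin N)}
    (hL : L.length = s.src.length) (h : ∀ M, M.length = s.tgt.length → f M = g M) :
    sliceAct N q s f L = sliceAct N q s g L := by
  obtain ⟨A, M, B, rfl, hA, hM, hB⟩ := exists_split hL
  rw [sliceAct_append s f hA hM, sliceAct_append s g hA hM]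
  refine pieceAct_congr _ _ fun M' hM' => h _ ?_
  simp [Slice.tgt, hA, hB, hM']

theorem stateSum_congr {a b : List Bool} {w : List Slice} (hw : IsTangle a w b)
    {f g : List (Fin N) → ℂ} {L : List (Fin N)} (hL : L.length = a.length)
    (h : ∀ M, M.length = b.length → f M = g M) : stateSum N q w f L = stateSum N q w g L := by
  induction w generalizing a L with
  | nil =>
    obtain rfl : a = b := hw
    exact h L hL
  | cons s w ih =>
    obtain ⟨rfl, hw⟩ := hw
    exact sliceAct_congr s hL fun M hM => ih hw hM

/-- Vertical strands at the sides merely carry their labels along, so the moves need to be checked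
only without them. -/
theorem stateSum_shift {a b : List Bool} {w : List Slice} (hw : IsTangle a w b) (l r : List Bool)
    (f : List (Fin N) → ℂ) {A M B : List (Fin N)} (hA : A.length = l.length)
    (hM : M.length = a.length) :
    stateSum N q (shift l r w) f (A ++ M ++ B) =
      stateSum N q w (fun M' => f (A ++ M' ++ B)) M := by
  induction w generalizing a M with
  | nil => rfl
  | cons s w ih =>
    obtain ⟨rfl, hw⟩ := hw
    obtain ⟨A', M, B', rfl, hA', hM', hB'⟩ := exists_split hM
    have e : A ++ (A' ++ M ++ B') ++ B = (A ++ A') ++ M ++ (B' ++ B) := by simp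
    rw [shift_cons, stateSum, stateSum, sliceAct_append s _ hA' hM', e,
      sliceAct_append (s.shift l r) _ (by simp [Slice.shift, hA, hA']) hM']
    refine pieceAct_congr _ _ fun M'' hM'' => ?_
    rw [← ih hw (M := A' ++ M'' ++ B')]
    · simp
    · simp only [Slice.shift] at hM''
      simp [Slice.tgt, hA', hB', hM'']

theorem stateSum_shift_eq {a b : List Bool} {v w : List Slice} (hv : IsTangle a v b)
    (hw : IsTangle a w b) (h : ∀ (f : List (Fin N) → ℂ) M, M.length = a.length →
      stateSum N q v f M = stateSum N q w f M) (l r : List Bool) (f : List (Fin N) → ℂ)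
    {L : List (Fin N)} (hL : L.length = (l ++ a ++ r).length) :
    stateSum N q (shift l r v) f L = stateSum N q (shift l r w) f L := by
  obtain ⟨A, M, B, rfl, hA, hM, hB⟩ := exists_split hL
  rw [stateSum_shift hv l r f hA hM, stateSum_shift hw l r f hA hM, h _ _ hM]

/-- A finite combination of evaluations commutes with another one and is linear. This makes distant
pieces commute without inspecting their types. -/
theorem exists_pieceAct_eq_sum (N : ℕ) (q : ℂ) (x : Piece) (M : List (Fin N)) :
    ∃ (ι : Type) (_ : Fintype ι) (c : ι → ℂ) (φ : ι → List (Fin N)),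
      ∀ g, pieceAct N q x g M = ∑ t, c t * g (φ t) := by
  have h0 : (∀ g, pieceAct N q x g M = 0) → ∃ (ι : Type) (_ : Fintype ι) (c : ι → ℂ)
      (φ : ι → List (Fin N)), ∀ g, pieceAct N q x g M = ∑ t, c t * g (φ t) := fun h =>
    ⟨Empty, inferInstance, fun _ => 0, fun _ => [], fun g => by simp [h]⟩
  match x, M with
  | .birth e, [] => exact ⟨Fin N, inferInstance, birthWeight N q e, fun i => [i, i], fun _ => rfl⟩
  | .death e, [i, j] =>
    exact ⟨Unit, inferInstance, fun _ => if i = j then deathWeight N q e i else 0, fun _ => [],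
      fun g => by simp [pieceAct]⟩
  | .cross e f o, [i, j] =>
    exact ⟨Fin N × Fin N, inferInstance, fun t => crossEntry N q e f o i j t.1 t.2,
      fun t => [t.1, t.2], fun g => by rw [Fintype.sum_prod_type]; rfl⟩
  | .birth _, _ :: _ => exact h0 fun _ => rfl
  | .death _, [] => exact h0 fun _ => rfl
  | .death _, [_] => exact h0 fun _ => rfl
  | .death _, _ :: _ :: _ :: _ => exact h0 fun _ => rfl
  | .cross .., [] => exact h0 fun _ => rfl
  | .cross .., [_] => exact h0 fun _ => rfl
  | .cross .., _ :: _ :: _ :: _ => exact h0 fun _ => rfl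

theorem pieceAct_comm (x y : Piece) (g : List (Fin N) → List (Fin N) → ℂ) (X Y : List (Fin N)) :
    pieceAct N q x (fun X' => pieceAct N q y (fun Y' => g X' Y') Y) X =
      pieceAct N q y (fun Y' => pieceAct N q x (fun X' => g X' Y') X) Y := by
  obtain ⟨ι, _, c, φ, h⟩ := exists_pieceAct_eq_sum N q x X
  obtain ⟨κ, _, d, ψ, h'⟩ := exists_pieceAct_eq_sum N q y Y
  simp only [h, h', Finset.mul_sum]
  rw [Finset.sum_comm]
  exact Finset.sum_congr rfl fun _ _ => Finset.sum_congr rfl fun _ _ => by ring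

theorem exists_stateSum_eq_sum (N : ℕ) (q : ℂ) (w : List Slice) (L : List (Fin N)) :
    ∃ (ι : Type) (_ : Fintype ι) (c : ι → ℂ) (φ : ι → List (Fin N)),
      ∀ f, stateSum N q w f L = ∑ t, c t * f (φ t) := by
  induction w generalizing L with
  | nil => exact ⟨Unit, inferInstance, fun _ => 1, fun _ => L, fun f => by simp [stateSum]⟩
  | cons s w ih =>
    obtain ⟨ι, _, c, φ, h⟩ := exists_pieceAct_eq_sum N q s.piece
      ((L.drop s.left.length).take s.piece.src.length)
    choose κ hκ d ψ h' using ih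
    refine ⟨Σ t : ι, κ (L.take s.left.length ++ φ t ++
      L.drop (s.left.length + s.piece.src.length)), inferInstance, fun t => c t.1 * d _ t.2,
      fun t => ψ _ t.2, fun f => ?_⟩
    rw [stateSum, sliceAct, h, Fintype.sum_sigma]
    refine Finset.sum_congr rfl fun t _ => ?_
    rw [h', Finset.mul_sum]
    exact Finset.sum_congr rfl fun _ _ => (mul_assoc _ _ _).symm

theorem stateSum_add (w : List Slice) (f g : List (Fin N) → ℂ) (L : List (Fin N)) :
    stateSum N q w (fun M => f M + g M) L = stateSum N q w f L + stateSum N q w g L := by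
  obtain ⟨ι, _, c, φ, h⟩ := exists_stateSum_eq_sum N q w L
  simp only [h, mul_add, Finset.sum_add_distrib]

theorem stateSum_smul (w : List Slice) (a : ℂ) (f : List (Fin N) → ℂ) (L : List (Fin N)) :
    stateSum N q w (fun M => a * f M) L = a * stateSum N q w f L := by
  obtain ⟨ι, _, c, φ, h⟩ := exists_stateSum_eq_sum N q w L
  simp only [h, Finset.mul_sum]
  exact Finset.sum_congr rfl fun _ _ => by ring

theorem stateSum_zero (w : List Slice) (L : List (Fin N)) :
    stateSum N q w (fun _ => 0) L = 0 := by
  simpa using stateSum_smul (q := q) w 0 (fun _ => 0) L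

end OrientedLink

namespace OrientedLink

variable {N : ℕ} {q : ℂ}

/-! ### Invariance of the state sum -/

theorem stateSum_zigzagLeft (hq : q ≠ 0) (e : Bool) (f : List (Fin N) → ℂ) (i : Fin N) :
    stateSum N q [⟨[e], .birth (!e), []⟩, ⟨[], .death e, [e]⟩] f [i] = f [i] := by
  have := birthWeight_ne_zero hq (!e) i
  have h := deathWeight_not (N := N) (q := q) (!e) i
  simp [stateSum, sliceAct, pieceAct, Piece.src]
  rw [Bool.not_not] at h
  rw [h]
  field_simp

theorem stateSum_zigzagRight (hq : q ≠ 0) (e : Bool) (f : List (Fin N) → ℂ) (i : Fin N) :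
    stateSum N q [⟨[], .birth e, [e]⟩, ⟨[e], .death (!e), []⟩] f [i] = f [i] := by
  have := birthWeight_ne_zero hq e i
  have h := deathWeight_not (N := N) (q := q) e i
  simp [stateSum, sliceAct, pieceAct, Piece.src]
  rw [h]
  field_simp

theorem stateSum_slideBirth (hq : q ≠ 0) (e g o : Bool) (f : List (Fin N) → ℂ) (i : Fin N) :
    stateSum N q [⟨[g], .birth e, []⟩, ⟨[], .cross g e o, [!e]⟩] f [i] =
      stateSum N q [⟨[], .birth e, [g]⟩, ⟨[e], .cross (!e) g (!o), []⟩] f [i] := by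
  simp [stateSum, sliceAct, pieceAct, Piece.src]
  simp only [Finset.mul_sum]
  rw [Finset.sum_comm]
  refine Finset.sum_congr rfl fun y _ => ?_
  rw [Finset.sum_comm]
  refine Finset.sum_congr rfl fun z _ => Finset.sum_congr rfl fun x _ => ?_
  rw [← mul_assoc, ← mul_assoc, crossEntry_rotate hq]

theorem stateSum_slideDeath (hq : q ≠ 0) (e g o : Bool) (f : List (Fin N) → ℂ) (i j k : Fin N) :
    stateSum N q [⟨[], .cross e g o, [!e]⟩, ⟨[g], .death e, []⟩] f [i, j, k] =
      stateSum N q [⟨[e], .cross g (!e) (!o), []⟩, ⟨[], .death e, [g]⟩] f [i, j, k] := by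
  simp [stateSum, sliceAct, pieceAct, Piece.src]
  refine Finset.sum_congr rfl fun x _ => ?_
  have h := crossEntry_rotate (N := N) hq (!e) g (!o) k i x j
  have hi := birthWeight_ne_zero hq (!e) i
  have hk := birthWeight_ne_zero hq (!e) k
  have hd := fun i => deathWeight_not (N := N) (q := q) (!e) i
  simp only [Bool.not_not] at h hd
  rw [hd, hd]
  field_simp
  linear_combination f [x] * h

theorem stateSum_reidemeisterOneBirth (hq : q ≠ 0) (e o : Bool) (f : List (Fin N) → ℂ) :
    stateSum N q [⟨[], .birth e, []⟩, ⟨[], .cross e (!e) o, []⟩] f [] =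
      stateSum N q [⟨[], .birth (!e), []⟩] f [] := by
  simp [stateSum, sliceAct, pieceAct, Piece.src]
  simp only [Finset.mul_sum]
  rw [Finset.sum_comm]
  have h := sum_birthWeight_mul_crossEntry (N := N) hq e o
  refine Finset.sum_congr rfl fun x _ => ?_
  rw [Finset.sum_comm]
  simp only [← mul_assoc, ← Finset.sum_mul, h]
  simp

theorem stateSum_reidemeisterOneDeath (hq : q ≠ 0) (e o : Bool) (f : List (Fin N) → ℂ)
    (i j : Fin N) :
    stateSum N q [⟨[], .cross e (!e) o, []⟩, ⟨[], .death (!e), []⟩] f [i, j] =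
      stateSum N q [⟨[], .death e, []⟩] f [i, j] := by
  simp [stateSum, sliceAct, pieceAct, Piece.src]
  simp only [← mul_assoc, ← Finset.sum_mul, sum_crossEntry_mul_deathWeight hq]
  simp

open Matrix in
theorem stateSum_reidemeisterTwo (hq : q ≠ 0) (e g o : Bool) (f : List (Fin N) → ℂ)
    (i j : Fin N) :
    stateSum N q [⟨[], .cross e g o, []⟩, ⟨[], .cross g e (!o), []⟩] f [i, j] = f [i, j] := by
  simp [stateSum, sliceAct, pieceAct, Piece.src]
  have h := congrArg (fun A => (A *ᵥ fun x => f [x.1, x.2]) (i, j))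
    (crossMatrix_mul (N := N) hq e g o)
  simp only [← Matrix.mulVec_mulVec, Matrix.one_mulVec] at h
  simpa [crossMatrix, Matrix.mulVec, dotProduct, Fintype.sum_prod_type] using h

open Matrix in
theorem stateSum_reidemeisterThree (hq : q ≠ 0) (a b c oab oac obc : Bool)
    (h : oab = obc → oac = oab) (f : List (Fin N) → ℂ) (i j k : Fin N) :
    stateSum N q [⟨[], .cross a b oab, [c]⟩, ⟨[b], .cross a c oac, []⟩,
        ⟨[], .cross b c obc, [a]⟩] f [i, j, k] =
      stateSum N q [⟨[a], .cross b c obc, []⟩, ⟨[], .cross a c oac, [b]⟩,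
        ⟨[c], .cross a b oab, []⟩] f [i, j, k] := by
  have := congrArg (fun A => (A *ᵥ fun x => f [x.1, x.2.1, x.2.2]) (i, j, k))
    (yangBaxter (N := N) hq a b c oab oac obc h)
  simp only [← Matrix.mulVec_mulVec, onLeft_mulVec, onRight_mulVec] at this
  simpa [stateSum, sliceAct, pieceAct, Piece.src] using this

/-- The exchange move is `pieceAct_comm`; every other move is an identity of weights on at most
three strands, extended by `stateSum_shift_eq`. -/
theorem LocalMove.stateSum_eq (hq : q ≠ 0) {a b : List Bool} {v w : List Slice} (h : LocalMove v w)
    (hv : IsTangle a v b) (f : List (Fin N) → ℂ) {L : List (Fin N)} (hL : L.length = a.length) :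
    stateSum N q v f L = stateSum N q w f L := by
  cases h with
  | exchange l m r x y =>
    obtain ⟨rfl, -⟩ := hv
    obtain ⟨A, X, B, rfl, hA, hX, hB⟩ := exists_split hL
    obtain ⟨C, Y, D, rfl, hC, hY, hD⟩ := exists_split hB
    have e : A ++ X ++ (C ++ Y ++ D) = A ++ X ++ C ++ Y ++ D := by simp
    simp only [stateSum]
    rw [sliceAct_append _ _ hA hX, e, sliceAct_append _ _ (by simp [hA, hX, hC]) hY]
    trans pieceAct N q x (fun X' => pieceAct N q y (fun Y' => f (A ++ X' ++ C ++ Y' ++ D)) Y) X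
    · refine pieceAct_congr _ _ fun X' hX' => ?_
      have e' : A ++ X' ++ (C ++ Y ++ D) = A ++ X' ++ C ++ Y ++ D := by simp
      rw [e', sliceAct_append _ _ (by simp [hA, hX', hC]) hY]
    · rw [pieceAct_comm]
      refine pieceAct_congr _ _ fun Y' hY' => ?_
      have e' : A ++ X ++ C ++ Y' ++ D = A ++ X ++ (C ++ Y' ++ D) := by simp
      rw [e', sliceAct_append ⟨l, x, m ++ y.tgt ++ r⟩ f hA hX]
      simp
  | zigzagLeft l r e =>
    obtain ⟨rfl, -⟩ := hv
    have := stateSum_shift_eq (N := N) (q := q) (a := [e]) (b := [e])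
      (v := [⟨[e], .birth (!e), []⟩, ⟨[], .death e, [e]⟩])
      (w := [])
      (by simp [IsTangle, Slice.src, Slice.tgt, Piece.src, Piece.tgt])
      rfl
      (fun f M hM => by
        obtain ⟨i, rfl⟩ := List.length_eq_one_iff.1 hM
        exact stateSum_zigzagLeft hq e f i) l r f (by simpa [Slice.src, Piece.src] using hL)
    simpa using this
  | zigzagRight l r e =>
    obtain ⟨rfl, -⟩ := hv
    have := stateSum_shift_eq (N := N) (q := q) (a := [e]) (b := [e])
      (v := [⟨[], .birth e, [e]⟩, ⟨[e], .death (!e), []⟩])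
      (w := [])
      (by simp [IsTangle, Slice.src, Slice.tgt, Piece.src, Piece.tgt])
      rfl
      (fun f M hM => by
        obtain ⟨i, rfl⟩ := List.length_eq_one_iff.1 hM
        exact stateSum_zigzagRight hq e f i) l r f (by simpa [Slice.src, Piece.src] using hL)
    simpa using this
  | slideBirth l r e g o =>
    obtain ⟨rfl, -⟩ := hv
    have := stateSum_shift_eq (N := N) (q := q) (a := [g]) (b := [e, g, !e])
      (v := [⟨[g], .birth e, []⟩, ⟨[], .cross g e o, [!e]⟩])
      (w := [⟨[], .birth e, [g]⟩, ⟨[e], .cross (!e) g (!o), []⟩])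
      (by simp [IsTangle, Slice.src, Slice.tgt, Piece.src, Piece.tgt])
      (by simp [IsTangle, Slice.src, Slice.tgt, Piece.src, Piece.tgt])
      (fun f M hM => by
        obtain ⟨i, rfl⟩ := List.length_eq_one_iff.1 hM
        exact stateSum_slideBirth hq e g o f i) l r f (by simpa [Slice.src, Piece.src] using hL)
    simpa using this
  | slideDeath l r e g o =>
    obtain ⟨rfl, -⟩ := hv
    have := stateSum_shift_eq (N := N) (q := q) (a := [e, g, !e]) (b := [g])
      (v := [⟨[], .cross e g o, [!e]⟩, ⟨[g], .death e, []⟩])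
      (w := [⟨[e], .cross g (!e) (!o), []⟩, ⟨[], .death e, [g]⟩])
      (by simp [IsTangle, Slice.src, Slice.tgt, Piece.src, Piece.tgt])
      (by simp [IsTangle, Slice.src, Slice.tgt, Piece.src, Piece.tgt])
      (fun f M hM => by
        obtain ⟨i, j, k, rfl⟩ := List.length_eq_three.1 hM
        exact stateSum_slideDeath hq e g o f i j k) l r f (by simpa [Slice.src, Piece.src] using hL)
    simpa using this
  | reidemeisterOneBirth l r e o =>
    obtain ⟨rfl, -⟩ := hv
    have := stateSum_shift_eq (N := N) (q := q) (a := []) (b := [!e, e])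
      (v := [⟨[], .birth e, []⟩, ⟨[], .cross e (!e) o, []⟩])
      (w := [⟨[], .birth (!e), []⟩])
      (by simp [IsTangle, Slice.src, Slice.tgt, Piece.src, Piece.tgt])
      (by simp [IsTangle, Slice.src, Slice.tgt, Piece.src, Piece.tgt])
      (fun f M hM => by
        obtain rfl := List.length_eq_zero_iff.1 hM
        exact stateSum_reidemeisterOneBirth hq e o f) l r f (by simpa [Slice.src, Piece.src] using hL)
    simpa using this
  | reidemeisterOneDeath l r e o =>
    obtain ⟨rfl, -⟩ := hv
    have := stateSum_shift_eq (N := N) (q := q) (a := [e, !e]) (b := [])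
      (v := [⟨[], .cross e (!e) o, []⟩, ⟨[], .death (!e), []⟩])
      (w := [⟨[], .death e, []⟩])
      (by simp [IsTangle, Slice.src, Slice.tgt, Piece.src, Piece.tgt])
      (by simp [IsTangle, Slice.src, Slice.tgt, Piece.src, Piece.tgt])
      (fun f M hM => by
        obtain ⟨i, j, rfl⟩ := List.length_eq_two.1 hM
        exact stateSum_reidemeisterOneDeath hq e o f i j) l r f (by simpa [Slice.src, Piece.src] using hL)
    simpa using this
  | reidemeisterTwo l r e g o =>
    obtain ⟨rfl, -⟩ := hv
    have := stateSum_shift_eq (N := N) (q := q) (a := [e, g]) (b := [e, g])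
      (v := [⟨[], .cross e g o, []⟩, ⟨[], .cross g e (!o), []⟩])
      (w := [])
      (by simp [IsTangle, Slice.src, Slice.tgt, Piece.src, Piece.tgt])
      rfl
      (fun f M hM => by
        obtain ⟨i, j, rfl⟩ := List.length_eq_two.1 hM
        exact stateSum_reidemeisterTwo hq e g o f i j) l r f (by simpa [Slice.src, Piece.src] using hL)
    simpa using this
  | reidemeisterThree l r a b c oab oac obc h =>
    obtain ⟨rfl, -⟩ := hv
    have := stateSum_shift_eq (N := N) (q := q) (a := [a, b, c]) (b := [c, b, a])
      (v := [⟨[], .cross a b oab, [c]⟩, ⟨[b], .cross a c oac, []⟩,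
        ⟨[], .cross b c obc, [a]⟩])
      (w := [⟨[a], .cross b c obc, []⟩, ⟨[], .cross a c oac, [b]⟩,
        ⟨[c], .cross a b oab, []⟩])
      (by simp [IsTangle, Slice.src, Slice.tgt, Piece.src, Piece.tgt])
      (by simp [IsTangle, Slice.src, Slice.tgt, Piece.src, Piece.tgt])
      (fun f M hM => by
        obtain ⟨i, j, k, rfl⟩ := List.length_eq_three.1 hM
        exact stateSum_reidemeisterThree hq a b c oab oac obc h f i j k) l r f (by simpa [Slice.src, Piece.src] using hL)
    simpa using this

theorem TangleEq.stateSum_eq (hq : q ≠ 0) {a b : List Bool} {v w : List Slice}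
    (h : TangleEq a b v w) (f : List (Fin N) → ℂ) {L : List (Fin N)} (hL : L.length = a.length) :
    stateSum N q v f L = stateSum N q w f L := by
  induction h with
  | refl => rfl
  | move p p' h hv hw =>
    obtain ⟨c, hc, -⟩ := isTangle_append.1 hv
    obtain ⟨c', hc', hd⟩ := isTangle_append.1 hc
    simp only [stateSum_append]
    exact stateSum_congr hc' hL fun M hM => h.stateSum_eq hq hd _ hM
  | symm _ ih => exact ih.symm
  | trans _ _ ih1 ih2 => exact ih1.trans ih2

end OrientedLink

namespace OrientedLink

variable {N : ℕ} {q : ℂ}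

/-! ### The skein relation of the state sum -/

theorem stateSum_smoothing (l r : List Bool) (e f : Bool) (g : List (Fin N) → ℂ)
    {A B : List (Fin N)} (hA : A.length = l.length) (i j : Fin N) :
    stateSum N q (smoothing l r e f) g (A ++ [i, j] ++ B) =
      ∑ k, ∑ m, smoothEntry N q e f i j k m * g (A ++ [k, m] ++ B) := by
  unfold smoothing smoothEntry
  split_ifs with h
  · simp [stateSum, ite_and]
  · have := stateSum_shift (N := N) (q := q) (a := [e, f]) (b := [f, e])
      (w := [⟨[], .death e, []⟩, ⟨[], .birth f, []⟩])
      (by cases e <;> cases f <;> simp_all [IsTangle, Slice.src, Slice.tgt, Piece.src, Piece.tgt])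
      l r g hA (M := [i, j]) (B := B) rfl
    simp only [shift_cons, shift_nil, Slice.shift_mk, List.append_nil, List.nil_append] at this
    rw [this]
    simp [stateSum, sliceAct, pieceAct, Piece.src, ite_and, Finset.mul_sum, mul_assoc]

theorem stateSum_skein_slice (hq : q ≠ 0) (l r : List Bool) (e f : Bool) (g : List (Fin N) → ℂ)
    {L : List (Fin N)} (hL : L.length = (l ++ [e, f] ++ r).length) :
    lValue N q * stateSum N q [⟨l, positiveCrossing e f, r⟩] g L +
      (lValue N q)⁻¹ * stateSum N q [⟨l, negativeCrossing e f, r⟩] g L +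
      mValue q * stateSum N q (smoothing l r e f) g L = 0 := by
  obtain ⟨A, M, B, rfl, hA, hM, hB⟩ := exists_split hL
  obtain ⟨i, j, rfl⟩ := List.length_eq_two.1 hM
  rw [stateSum_smoothing l r e f g hA]
  simp only [stateSum]
  rw [sliceAct_append _ _ hA (by rfl), sliceAct_append _ _ hA (by rfl)]
  simp only [positiveCrossing, negativeCrossing, pieceAct, Finset.mul_sum,
    ← Finset.sum_add_distrib]
  refine Finset.sum_eq_zero fun k _ => Finset.sum_eq_zero fun m _ => ?_
  linear_combination g (A ++ [k, m] ++ B) * crossEntry_skein (N := N) hq e f i j k m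

theorem stateSum_skein (hq : q ≠ 0) {a b : List Bool} (p p' : List Slice) (l r : List Bool)
    (e f : Bool) (h : IsTangle a (p ++ [⟨l, positiveCrossing e f, r⟩] ++ p') b)
    (g : List (Fin N) → ℂ) {L : List (Fin N)} (hL : L.length = a.length) :
    lValue N q * stateSum N q (p ++ [⟨l, positiveCrossing e f, r⟩] ++ p') g L +
      (lValue N q)⁻¹ * stateSum N q (p ++ [⟨l, negativeCrossing e f, r⟩] ++ p') g L +
      mValue q * stateSum N q (p ++ smoothing l r e f ++ p') g L = 0 := by
  obtain ⟨c, hc, -⟩ := isTangle_append.1 h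
  obtain ⟨c', hc', hd⟩ := isTangle_append.1 hc
  obtain ⟨rfl, -⟩ := hd
  simp only [stateSum_append]
  rw [← stateSum_smul p, ← stateSum_smul p, ← stateSum_smul p, ← stateSum_add, ← stateSum_add]
  rw [stateSum_congr hc' hL fun M hM => stateSum_skein_slice hq l r e f (stateSum N q p' g) hM,
    stateSum_zero]

theorem stateSum_circle_slice (l r : List Bool) (g : List (Fin N) → ℂ)
    {L : List (Fin N)} (hL : L.length = (l ++ [] ++ r).length) :
    stateSum N q [⟨l, .birth true, r⟩, ⟨l, .death true, r⟩] g L =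
      (∑ i : Fin N, capWeight N q i) * g L := by
  obtain ⟨A, M, B, rfl, hA, hM, hB⟩ := exists_split hL
  obtain rfl := List.length_eq_zero_iff.1 hM
  have := stateSum_shift (N := N) (q := q) (a := []) (b := [])
      (w := [⟨[], .birth true, []⟩, ⟨[], .death true, []⟩]) ⟨rfl, rfl, rfl⟩ l r g hA (M := [])
      (B := B) rfl
  simp only [shift_cons, shift_nil, Slice.shift_mk, List.append_nil, List.nil_append] at this ⊢
  rw [this]
  simp [stateSum, sliceAct, pieceAct, Piece.src, birthWeight, deathWeight, Finset.sum_mul]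

theorem stateSum_circle {a b : List Bool} (p p' : List Slice) (l r : List Bool)
    (h : IsTangle a (p ++ [⟨l, .birth true, r⟩, ⟨l, .death true, r⟩] ++ p') b)
    (g : List (Fin N) → ℂ) {L : List (Fin N)} (hL : L.length = a.length) :
    stateSum N q (p ++ [⟨l, .birth true, r⟩, ⟨l, .death true, r⟩] ++ p') g L =
      (∑ i : Fin N, capWeight N q i) * stateSum N q (p ++ p') g L := by
  obtain ⟨c, hc, -⟩ := isTangle_append.1 h
  obtain ⟨c', hc', hd⟩ := isTangle_append.1 hc
  obtain ⟨rfl, -⟩ := hd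
  simp only [stateSum_append]
  rw [← stateSum_smul p]
  exact stateSum_congr hc' hL fun M hM => stateSum_circle_slice l r _ hM

/-- The state sum of a link diagram. -/
noncomputable def linkSum (N : ℕ) (q : ℂ) (w : List Slice) : ℂ := stateSum N q w (fun _ => 1) []

theorem linkSum_unknot : linkSum N q unknot.word = ∑ i : Fin N, capWeight N q i := by
  have := stateSum_circle (N := N) (q := q) (a := []) (b := []) [] [] [] [] unknot.closed
    (fun _ => 1) (L := []) rfl
  simpa [stateSum, linkSum, unknot] using this

/-- The circle has the value -(l + l⁻¹)/m that the skein relation dictates; its weights sum as a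
geometric series. -/
theorem mValue_mul_sum_capWeight (hq : q ≠ 0) :
    mValue q * ∑ i : Fin N, capWeight N q i = -(lValue N q + (lValue N q)⁻¹) := by
  have h : ∑ i : Fin N, (q ^ 2 - 1) * capWeight N q i = capWeight N q N - capWeight N q 0 :=
    sum_eq_of_telescope (G := fun k => (q ^ 2 - 1) * capWeight N q k) (H := capWeight N q)
      fun k => by rw [capWeight_succ hq]; ring
  rw [← Finset.mul_sum, capWeight_self hq, capWeight_zero hq, zpow_neg] at h
  have hI : Complex.I⁻¹ = -Complex.I := Complex.inv_I
  have hm : mValue q = -Complex.I * q⁻¹ * (q ^ 2 - 1) := by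
    unfold mValue
    field_simp
  rw [lValue, mul_inv, hI, hm, mul_assoc, h]
  field_simp
  ring

end OrientedLink

/-! ### Interpolation of the numerical invariants by Laurent polynomials. -/

namespace OrientedLink

/-! ### Evaluation of Laurent polynomials -/

/-- The value of a Laurent polynomial in `l` and `m`. -/
noncomputable def evalHom (l m : ℂˣ) : HomflyRing →+* ℂ :=
  LaurentPolynomial.eval₂ (LaurentPolynomial.eval₂ (RingHom.id ℂ) l) m

theorem evalHom_lPow (l m : ℂˣ) (k : ℤ) : evalHom l m (lPow k) = (l : ℂ) ^ k := by
  simp [evalHom, lPow]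

theorem evalHom_T (l m : ℂˣ) (k : ℤ) : evalHom l m (T k) = (m : ℂ) ^ k := by
  simp [evalHom]

theorem eq_zero_of_eval₂_eq_zero {u : ℕ → ℂˣ} (hu : Function.Injective u) (p : ℂ[T;T⁻¹])
    (h : ∀ k, LaurentPolynomial.eval₂ (RingHom.id ℂ) (u k) p = 0) : p = 0 := by
  obtain ⟨n, f, hf⟩ := p.exists_T_pow
  suffices f = 0 by
    rw [this, map_zero] at hf
    exact ((isUnit_T _).mul_left_eq_zero.1 hf.symm)
  refine f.eq_zero_of_infinite_isRoot (Set.Infinite.mono ?_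
    (Set.infinite_range_of_injective (Units.val_injective.comp hu)))
  rintro _ ⟨k, rfl⟩
  have := congrArg (LaurentPolynomial.eval₂ (RingHom.id ℂ) (u k)) hf
  rwa [map_mul, h, zero_mul, eval₂_toLaurent] at this

/-- For fixed `n` the infinitely many values of l kill the Laurent polynomial in l obtained at m =
`m n`; then infinitely many constants `m n` are roots over the domain ℂ[l, l⁻¹]. The values of l may
therefore depend on `n`. -/
theorem eq_zero_of_evalHom_eq_zero {l : ℕ → ℕ → ℂˣ} {m : ℕ → ℂˣ}
    (hl : ∀ n, Function.Injective (l n)) (hm : Function.Injective m) (p : HomflyRing)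
    (h : ∀ n k, evalHom (l n k) (m n) p = 0) : p = 0 := by
  obtain ⟨n, f, hf⟩ := LaurentPolynomial.exists_T_pow p
  suffices f = 0 by
    rw [this, map_zero] at hf
    exact ((isUnit_T _).mul_left_eq_zero.1 hf.symm)
  have hC : Function.Injective (C : ℂ →+* ℂ[T;T⁻¹]) := RingHom.injective _
  refine f.eq_zero_of_infinite_isRoot (Set.Infinite.mono ?_
    (Set.infinite_range_of_injective (hC.comp (Units.val_injective.comp hm))))
  rintro _ ⟨n, rfl⟩
  refine eq_zero_of_eval₂_eq_zero (hl n) _ fun k => ?_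
  have := congrArg (evalHom (l n k) (m n)) hf
  rw [map_mul, h, zero_mul, evalHom, eval₂_toLaurent] at this
  rw [← Polynomial.eval₂_at_apply]
  simpa using this

/-- The value `l = i q ^ N` in the vertex model for `q = n + 2` and `N = k + 1`. -/
noncomputable def lUnit (n k : ℕ) : ℂˣ :=
  Units.mk0 (lValue (k + 1) (n + 2 : ℕ))
    (mul_ne_zero Complex.I_ne_zero (zpow_ne_zero _ (Nat.cast_ne_zero.2 (by omega))))

theorem mValue_ne_zero (n : ℕ) : mValue (n + 2 : ℕ) ≠ 0 := by
  have h : ((n + 2 : ℕ) : ℂ) ≠ 0 := Nat.cast_ne_zero.2 (by omega)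
  refine mul_ne_zero (neg_ne_zero.2 Complex.I_ne_zero) fun h' => ?_
  field_simp at h'
  have : ((n + 2 : ℕ) : ℂ) ^ 2 = 1 := by linear_combination h'
  norm_cast at this
  rw [Nat.pow_eq_one] at this
  omega

/-- The value of `m` in the vertex model for `q = n + 2`. -/
noncomputable def mUnit (n : ℕ) : ℂˣ := Units.mk0 (mValue (n + 2 : ℕ)) (mValue_ne_zero n)

theorem lUnit_injective (n : ℕ) : Function.Injective (lUnit n) := by
  intro k k' h
  have h1 : lValue (k + 1) (n + 2 : ℕ) = lValue (k' + 1) (n + 2 : ℕ) := congrArg Units.val h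
  have h2 := mul_left_cancel₀ Complex.I_ne_zero h1
  rw [zpow_natCast, zpow_natCast] at h2
  have h3 : (n + 2) ^ (k + 1) = (n + 2) ^ (k' + 1) := by exact_mod_cast h2
  have := Nat.pow_right_injective (show 2 ≤ n + 2 by omega) h3
  omega

theorem mUnit_injective : Function.Injective mUnit := by
  intro n n' h
  have h1 : mValue (n + 2 : ℕ) = mValue (n' + 2 : ℕ) := congrArg Units.val h
  have h2 := mul_left_cancel₀ (neg_ne_zero.2 Complex.I_ne_zero) h1
  have hn : ((n + 2 : ℕ) : ℂ) ≠ 0 := Nat.cast_ne_zero.2 (by omega)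
  have hn' : ((n' + 2 : ℕ) : ℂ) ≠ 0 := Nat.cast_ne_zero.2 (by omega)
  have h3 : (((n + 2 : ℕ) : ℂ) - (n' + 2 : ℕ)) * ((n + 2 : ℕ) * (n' + 2 : ℕ) + 1) = 0 := by
    field_simp at h2
    linear_combination h2
  rcases mul_eq_zero.1 h3 with h4 | h4
  · have : n + 2 = n' + 2 := by exact_mod_cast sub_eq_zero.1 h4
    omega
  · norm_cast at h4

/-- The state sum of a link diagram for `q = n + 2` and `N = k + 1`. -/
noncomputable def linkValue (n k : ℕ) (w : List Slice) : ℂ := linkSum (k + 1) (n + 2 : ℕ) w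

/-- Here l² = -q^(2N) with an integer q ≥ 2, so l² ≠ -1. This is why the unknot has a non-zero state
sum and normalization is possible. -/
theorem lUnit_ne (n k : ℕ) : (lUnit n k : ℂ) + (lUnit n k : ℂ)⁻¹ ≠ 0 := by
  intro h
  have h0 := (lUnit n k).ne_zero
  field_simp at h
  have : (lUnit n k : ℂ) ^ 2 = -((n + 2 : ℕ) ^ (2 * (k + 1)) : ℕ) := by
    simp only [lUnit, Units.val_mk0, lValue, zpow_natCast]
    rw [mul_pow, Complex.I_sq, ← pow_mul, mul_comm (k + 1)]
    push_cast
    ring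
  rw [this] at h
  have h1 : (((n + 2 : ℕ) ^ (2 * (k + 1)) : ℕ) : ℂ) = 1 := by linear_combination -h
  have h2 : (n + 2 : ℕ) ^ (2 * (k + 1)) = 1 := by exact_mod_cast h1
  have := Nat.one_lt_pow (n := 2 * (k + 1)) (by omega) (show 1 < n + 2 by omega)
  omega

theorem mUnit_mul_unknot (n k : ℕ) :
    (mUnit n : ℂ) * linkValue n k unknot.word = -((lUnit n k : ℂ) + (lUnit n k : ℂ)⁻¹) := by
  rw [linkValue, linkSum_unknot]
  exact mValue_mul_sum_capWeight (Nat.cast_ne_zero.2 (by omega))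

theorem linkValue_unknot_ne_zero (n k : ℕ) : linkValue n k unknot.word ≠ 0 := by
  intro h
  have := mUnit_mul_unknot n k
  rw [h, mul_zero] at this
  exact lUnit_ne n k (neg_eq_zero.1 this.symm)

theorem linkValue_eq {v w : List Slice} (h : TangleEq [] [] v w) (n k : ℕ) :
    linkValue n k v = linkValue n k w :=
  h.stateSum_eq (Nat.cast_ne_zero.2 (by omega)) _ rfl

theorem linkValue_skein (p p' : List Slice) (l r : List Bool) (e f : Bool)
    (h : IsTangle [] (p ++ [⟨l, positiveCrossing e f, r⟩] ++ p') []) (n k : ℕ) :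
    lUnit n k * linkValue n k (p ++ [⟨l, positiveCrossing e f, r⟩] ++ p') +
      (lUnit n k : ℂ)⁻¹ * linkValue n k (p ++ [⟨l, negativeCrossing e f, r⟩] ++ p') +
      mUnit n * linkValue n k (p ++ smoothing l r e f ++ p') = 0 :=
  stateSum_skein (Nat.cast_ne_zero.2 (by omega)) p p' l r e f h _ rfl

theorem linkValue_circle (p p' : List Slice) (l r : List Bool)
    (h : IsTangle [] (p ++ [⟨l, .birth true, r⟩, ⟨l, .death true, r⟩] ++ p') []) (n k : ℕ) :
    linkValue n k (p ++ [⟨l, .birth true, r⟩, ⟨l, .death true, r⟩] ++ p') =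
      linkValue n k unknot.word * linkValue n k (p ++ p') := by
  rw [linkValue, linkValue, linkSum_unknot]
  exact stateSum_circle p p' l r h _ rfl

/-! ### The HOMFLY polynomial -/

/-- `p` interpolates the normalized state sums of the link diagram `w`. -/
def Interpolates (w : List Slice) (p : HomflyRing) : Prop :=
  ∀ n k, linkValue n k w = evalHom (lUnit n k) (mUnit n) p * linkValue n k unknot.word

/-- This uniqueness makes the polynomial independent of the chosen skein reduction and transfers
identities from numbers to polynomials. -/
theorem Interpolates.unique {w : List Slice} {p p' : HomflyRing} (h : Interpolates w p)
    (h' : Interpolates w p') : p = p' := by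
  refine sub_eq_zero.1 (eq_zero_of_evalHom_eq_zero lUnit_injective mUnit_injective _ fun n k => ?_)
  rw [map_sub, sub_eq_zero]
  exact mul_right_cancel₀ (linkValue_unknot_ne_zero n k) ((h n k).symm.trans (h' n k))

theorem Gen.interpolates {w : List Slice} (h : Gen [] [] (fun u => u = unknot.word) w) :
    ∃ p, Interpolates w p := by
  induction h with
  | base h => exact ⟨1, fun n k => by rw [h, map_one, one_mul]⟩
  | iso h _ ih =>
    obtain ⟨p, hp⟩ := ih
    exact ⟨p, fun n k => (linkValue_eq h n k).trans (hp n k)⟩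
  | pos s s' l r e f h _ _ ih1 ih2 =>
    obtain ⟨p1, h1⟩ := ih1
    obtain ⟨p2, h2⟩ := ih2
    -- The skein relation solved for the positive crossing.
    refine ⟨-(lPow (-1) * (lPow (-1) * p1 + mVar * p2)), fun n k => ?_⟩
    have := linkValue_skein s s' l r e f h n k
    rw [h1, h2] at this
    have hl := (lUnit n k).ne_zero
    simp only [map_neg, map_mul, map_add, evalHom_lPow, mVar, evalHom_T, zpow_neg, zpow_one]
    field_simp at this ⊢
    linear_combination this
  | neg s s' l r e f h _ _ ih1 ih2 =>
    obtain ⟨p1, h1⟩ := ih1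
    obtain ⟨p2, h2⟩ := ih2
    refine ⟨-(lPow 1 * (lPow 1 * p1 + mVar * p2)), fun n k => ?_⟩
    have hp : IsTangle [] (s ++ [⟨l, positiveCrossing e f, r⟩] ++ s') [] := by
      simp only [isTangle_append, isTangle_singleton] at h ⊢
      exact h
    have := linkValue_skein s s' l r e f hp n k
    rw [h1, h2] at this
    have hl := (lUnit n k).ne_zero
    simp only [map_neg, map_mul, map_add, evalHom_lPow, mVar, evalHom_T, zpow_one]
    field_simp at this ⊢
    linear_combination this
  | circle s s' l r h _ ih =>
    obtain ⟨p, hp⟩ := ih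
    -- The factor is -(l + l⁻¹)/m, the outer `T (-1)` being m⁻¹.
    refine ⟨-(T (-1) * (lPow 1 + lPow (-1)) * p), fun n k => ?_⟩
    have hm := (mUnit n).ne_zero
    have hu : linkValue n k unknot.word =
        -((mUnit n : ℂ)⁻¹ * ((lUnit n k : ℂ) + (lUnit n k : ℂ)⁻¹)) := by
      rw [← mul_neg, ← mUnit_mul_unknot, inv_mul_cancel_left₀ hm]
    rw [linkValue_circle s s' l r h, hp]
    simp only [map_neg, map_mul, map_add, evalHom_lPow, evalHom_T, zpow_neg, zpow_one]
    linear_combination (evalHom (lUnit n k) (mUnit n) p * linkValue n k unknot.word) * hu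

end OrientedLink

/-! ### Existence of the HOMFLY polynomial, and the expansion formulas. -/

namespace OrientedLink

theorem LocalMove.ne_nil {v w : List Slice} (h : LocalMove v w) : v ≠ [] := by
  cases h <;> simp

theorem LinkDiagram.tangleEq {L L' : LinkDiagram} {p p' v w : List Slice} (h : LocalMove v w)
    (hL : L.word = p ++ v ++ p') (hL' : L'.word = p ++ w ++ p') :
    TangleEq [] [] L.word L'.word := by
  have h1 := L.closed
  have h2 := L'.closed
  rw [hL] at h1 ⊢
  rw [hL'] at h2 ⊢
  exact .move p p' h h1 h2

/-- No local move leads to the empty diagram. -/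
theorem Step.word_ne_nil {L L' : LinkDiagram} (h : Step L L') : L.word ≠ [] ∧ L'.word ≠ [] := by
  obtain ⟨p, p', v, w, h, hL, hL'⟩ := h
  have hv := h.ne_nil
  refine ⟨by simp [hL, hv], fun h0 => ?_⟩
  rw [h0] at hL'
  simp only [List.nil_eq, List.append_eq_nil_iff] at hL'
  obtain ⟨⟨rfl, rfl⟩, rfl⟩ := hL'
  have hc := L.closed
  rw [hL] at hc
  cases h with
  | zigzagLeft l r e => simpa [Slice.src] using hc.1
  | zigzagRight l r e => simpa [Slice.src] using hc.1
  | reidemeisterTwo l r e f o => simpa [Slice.src, Piece.src] using hc.1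

/-- The value on the empty diagram is arbitrary: no move and no skein triple involves that diagram.
-/
theorem LinkDiagram.exists_interpolates (L : LinkDiagram) :
    ∃ p, L.word ≠ [] → Interpolates L.word p := by
  by_cases h : L.word = []
  · exact ⟨0, fun h' => absurd h h'⟩
  · obtain ⟨p, hp⟩ := (gen_unknot L.closed h).interpolates
    exact ⟨p, fun _ => hp⟩

/-- The HOMFLY polynomial of a link diagram. -/
noncomputable def homfly (L : LinkDiagram) : HomflyRing := L.exists_interpolates.choose

theorem homfly_interpolates {L : LinkDiagram} (h : L.word ≠ []) : Interpolates L.word (homfly L) :=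
  L.exists_interpolates.choose_spec h

theorem homfly_step {L L' : LinkDiagram} (h : Step L L') : homfly L = homfly L' := by
  obtain ⟨h1, h2⟩ := h.word_ne_nil
  obtain ⟨p, p', v, w, h, hL, hL'⟩ := h
  exact (homfly_interpolates h1).unique fun n k =>
    (linkValue_eq (LinkDiagram.tangleEq h hL hL') n k).trans (homfly_interpolates h2 n k)

theorem homfly_skein {Lp Lm L0 : LinkDiagram} (h : SkeinTriple Lp Lm L0) :
    lPow 1 * homfly Lp + lPow (-1) * homfly Lm + mVar * homfly L0 = 0 := by
  obtain ⟨p, p', l, r, e, f, hp, hm, h0⟩ := h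
  have hp' : Lp.word ≠ [] := by simp [hp]
  have hm' : Lm.word ≠ [] := by simp [hm]
  -- If the smoothed diagram were empty, nothing would lie above the crossing, whose two upper ends
  -- would then be ends of a closed diagram.
  have h0' : L0.word ≠ [] := by
    intro h
    rw [h0] at h
    simp only [List.append_eq_nil_iff] at h
    obtain ⟨⟨rfl, -⟩, -⟩ := h
    have := Lp.closed
    rw [hp] at this
    simpa [Slice.src, positiveCrossing, Piece.src] using this.1
  refine eq_zero_of_evalHom_eq_zero lUnit_injective mUnit_injective _ fun n k => ?_
  have ht := Lp.closed
  rw [hp] at ht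
  have := linkValue_skein p p' l r e f ht n k
  rw [← hp, ← hm, ← h0, homfly_interpolates hp', homfly_interpolates hm',
    homfly_interpolates h0'] at this
  refine (mul_eq_zero.1 (?_ : _ * linkValue n k unknot.word = 0)).resolve_right
    (linkValue_unknot_ne_zero n k)
  simp only [map_mul, map_add, evalHom_lPow, mVar, evalHom_T, zpow_neg, zpow_one]
  linear_combination this

theorem isHomfly_homfly : IsHomfly homfly where
  invariant L L' h := by
    induction h with
    | rel _ _ h => exact homfly_step h
    | refl => rfl
    | symm _ _ _ ih => exact ih.symm
    | trans _ _ _ _ _ ih1 ih2 => exact ih1.trans ih2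
  normalized := (homfly_interpolates (L := unknot) (by simp [unknot])).unique fun n k => by simp
  skein _ _ _ h := homfly_skein h

/-! ### The expansion formulas -/

theorem specialize_lPow (k : ℤ) : specialize (lPow k) = T k := by simp [specialize, lPow]

theorem specialize_mVar : specialize mVar = -2 := by
  simp only [specialize, mVar, eval₂_T, zpow_one, negTwo]
  exact (map_neg C 2).trans (congrArg Neg.neg (map_ofNat C 2))

variable {P : LinkDiagram → HomflyRing}

theorem degenerate_skein (hP : IsHomfly P) {Lp Lm L0 : LinkDiagram} (h : SkeinTriple Lp Lm L0) :
    T 1 * degenerate P Lp + T (-1) * degenerate P Lm - 2 * degenerate P L0 = 0 := by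
  have := congrArg specialize (hP.skein _ _ _ h)
  simp only [map_add, map_mul, map_zero, specialize_lPow, specialize_mVar] at this
  unfold degenerate
  linear_combination this

/-- All intermediate words in a `TangleEq [] []` are closed, so each move is a step between link
diagrams. -/
theorem IsLinkInvariant.eq_of_tangleEq {α : Type*} {F : LinkDiagram → α} (hF : IsLinkInvariant F)
    {v w : List Slice} (h : TangleEq [] [] v w) (hv : IsTangle [] v []) (hw : IsTangle [] w []) :
    F ⟨v, hv⟩ = F ⟨w, hw⟩ := by
  induction h with
  | refl => rfl
  | move p q h _ _ => exact hF _ _ (.rel _ _ ⟨p, q, _, _, h, rfl, rfl⟩)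
  | symm _ ih => exact (ih hw hv).symm
  | trans h _ ih1 ih2 => exact (ih1 hv h.right).trans (ih2 h.right hw)

theorem twist_snoc_of_pos (l r : List Bool) (e : Bool) {k : ℤ} (hk : 0 ≤ k) :
    twist l r e k ++ [⟨l, .cross e e true, r⟩] = twist l r e (k + 1) := by
  obtain ⟨n, rfl⟩ := Int.eq_ofNat_of_zero_le hk
  have h1 : ((n : ℤ) + 1).natAbs = n + 1 := by omega
  have h2 : (0 : ℤ) < n + 1 := by omega
  rcases Nat.eq_zero_or_pos n with rfl | hn
  · simp [twist]
  · simp [twist, h1, h2, hn, List.replicate_succ']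

theorem twist_snoc_of_neg (l r : List Bool) (e : Bool) {k : ℤ} (hk : k ≤ 0) :
    twist l r e k ++ [⟨l, .cross e e false, r⟩] = twist l r e (k - 1) := by
  have h1 : (k - 1).natAbs = k.natAbs + 1 := by omega
  have h2 : ¬ (0 : ℤ) < k - 1 := by omega
  have h3 : ¬ (0 : ℤ) < k := by omega
  simp only [twist, h1, h2, h3, List.replicate_succ', decide_false]

/-- This covers a crossing appended to a twist of opposite sign, whose last crossing it cancels by
the second Reidemeister move. -/
theorem twist_cancel (l r : List Bool) (e o : Bool) {k k' : ℤ}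
    (h : twist l r e k ++ [⟨l, .cross e e o, r⟩] = twist l r e k') :
    TangleEq (l ++ [e, e] ++ r) (l ++ [e, e] ++ r)
      (twist l r e k' ++ [⟨l, .cross e e (!o), r⟩]) (twist l r e k) := by
  have h1 := isTangle_twist l r e k
  have hm : LocalMove [⟨l, .cross e e o, r⟩, ⟨l, .cross e e (!o), r⟩] [] :=
    .reidemeisterTwo l r e e o
  have h2 : IsTangle (l ++ [e, e] ++ r) [⟨l, .cross e e o, r⟩, ⟨l, .cross e e (!o), r⟩]
      (l ++ [e, e] ++ r) := ⟨rfl, rfl, rfl⟩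
  have := TangleEq.move (a := l ++ [e, e] ++ r) (b := l ++ [e, e] ++ r) (twist l r e k) [] hm
    (by simpa using h1.append h2) (by simpa using h1)
  simpa [← h] using this

theorem tangleEq_twist_succ (l r : List Bool) (e : Bool) (k : ℤ) :
    TangleEq (l ++ [e, e] ++ r) (l ++ [e, e] ++ r)
      (twist l r e k ++ [⟨l, .cross e e true, r⟩]) (twist l r e (k + 1)) := by
  rcases le_or_gt 0 k with hk | hk
  · rw [twist_snoc_of_pos l r e hk]
    exact .refl (isTangle_twist l r e _)
  · refine twist_cancel l r e false ?_
    rw [twist_snoc_of_neg l r e (by omega)]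
    simp

theorem tangleEq_twist_pred (l r : List Bool) (e : Bool) (k : ℤ) :
    TangleEq (l ++ [e, e] ++ r) (l ++ [e, e] ++ r)
      (twist l r e k ++ [⟨l, .cross e e false, r⟩]) (twist l r e (k - 1)) := by
  rcases le_or_gt k 0 with hk | hk
  · rw [twist_snoc_of_neg l r e hk]
    exact .refl (isTangle_twist l r e _)
  · refine twist_cancel l r e true ?_
    rw [twist_snoc_of_pos l r e (by omega)]
    simp

/-- Append one crossing to x^k: the positive one gives x^(k-1), the negative one x^(k+1), and the
smoothing leaves x^k. -/
theorem degenerate_twist (hP : IsHomfly P) {p p' : List Slice} {l r : List Bool} {e : Bool}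
    {L : ℤ → LinkDiagram} (hL : ∀ k, (L k).word = p ++ twist l r e k ++ p') (k : ℤ) :
    T 1 * degenerate P (L (k - 1)) + T (-1) * degenerate P (L (k + 1)) -
      2 * degenerate P (L k) = 0 := by
  have h1 := (L 1).closed
  rw [hL] at h1
  obtain ⟨d, h1, hp'⟩ := isTangle_append.1 h1
  obtain ⟨c, hp, h1⟩ := isTangle_append.1 h1
  obtain ⟨rfl, rfl⟩ : l ++ [e, e] ++ r = c ∧ l ++ [e, e] ++ r = d := h1
  have key : ∀ {v : List Slice} {k' : ℤ}, TangleEq (l ++ [e, e] ++ r) (l ++ [e, e] ++ r) v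
      (twist l r e k') → ∃ h, degenerate P ⟨p ++ v ++ p', h⟩ = degenerate P (L k') := by
    intro v k' h
    have hc := TangleEq.context hp hp' h
    refine ⟨hc.left, ?_⟩
    have := hP.invariant.eq_of_tangleEq hc hc.left hc.right
    have e : L k' = ⟨_, hc.right⟩ := by
      cases h : L k'
      have := hL k'
      rw [h] at this
      simpa using this
    rw [degenerate, degenerate, this, e]
  obtain ⟨hx, ex⟩ := key (tangleEq_twist_succ l r e k)
  obtain ⟨hy, ey⟩ := key (tangleEq_twist_pred l r e k)
  rw [← ex, ← ey]
  refine degenerate_skein hP ⟨p ++ twist l r e k, p', l, r, e, e, ?_, ?_, ?_⟩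
  · simp [positiveCrossing]
  · simp [negativeCrossing]
  · simp [smoothing, hL]

/-- The first differences are constant, so `g` is affine. -/
theorem eq_of_second_difference {M : Type*} [CommRing M] {g : ℤ → M}
    (h : ∀ k, g (k + 1) + g (k - 1) = 2 * g k) (k : ℤ) : g k = g 0 + k * (g 1 - g 0) := by
  have hd : ∀ k, g (k + 1) - g k = g 1 - g 0 := by
    intro k
    induction k using Int.induction_on with
    | zero => simp
    | succ n ih =>
      have := h (n + 1)
      rw [add_sub_cancel_right] at this
      linear_combination this + ih
    | pred n ih =>
      have := h (-n)
      rw [sub_add_cancel]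
      linear_combination ih - this
  induction k using Int.induction_on with
  | zero => simp
  | succ n ih =>
    push_cast at ih ⊢
    linear_combination hd n + ih
  | pred n ih =>
    have := hd (-n - 1)
    rw [sub_add_cancel] at this
    push_cast at ih ⊢
    linear_combination ih - this

theorem eq_sum_R_mul {f : ℤ → ℂ[T;T⁻¹]}
    (h : ∀ k, T 1 * f (k - 1) + T (-1) * f (k + 1) - 2 * f k = 0) (k : ℤ) :
    f k = ∑ j : Fin 2, R k j * f (j : ℕ) := by
  have hT : ∀ a b : ℤ, (T (a + b) : ℂ[T;T⁻¹]) = T a * T b := fun a b => T_add a b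
  -- Rescaling by s^(-k) turns the three-term relation, whose characteristic polynomial has the
  -- double root s, into a vanishing second difference.
  have hg := eq_of_second_difference (g := fun k => T (-k) * f k) (fun k => by
    have h1 : (T (-(k + 1)) : ℂ[T;T⁻¹]) = T (-k) * T (-1) := by rw [← hT]; congr 1; ring
    have h2 : (T (-(k - 1)) : ℂ[T;T⁻¹]) = T (-k) * T 1 := by rw [← hT]; congr 1; ring
    simp only [h1, h2]
    linear_combination T (-k) * h k) k
  have h0 : (T k : ℂ[T;T⁻¹]) * T (-k) = 1 := by rw [← hT, add_neg_cancel, T_zero]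
  have h1 : (T (k - 1) : ℂ[T;T⁻¹]) = T k * T (-1) := by rw [← hT]; rfl
  simp only [R, Fin.sum_univ_two, h1, neg_zero, T_zero] at hg ⊢
  simp only [Fin.val_zero, Fin.val_one, Nat.cast_zero, Nat.cast_one, if_true, one_ne_zero,
    if_false]
  linear_combination T k * hg - f k * h0

/-- The one-variable formula is applied to the coordinates in turn: `ih` expands the tail for the
fixed head `k 0`, and the head is expanded last. -/
theorem eq_sum_prod_R_mul {p : ℕ} {h : (Fin p → ℤ) → ℂ[T;T⁻¹]}
    (hh : ∀ k t, h k = ∑ j : Fin 2, R (k t) j * h (Function.update k t (j : ℕ)))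
    (k : Fin p → ℤ) :
    h k = ∑ j : Fin p → Fin 2, (∏ t, R (k t) (j t)) * h (fun t => ((j t : ℕ) : ℤ)) := by
  induction p with
  | zero =>
    simp only [Finset.univ_unique, Finset.univ_eq_empty, Finset.prod_empty, one_mul,
      Finset.sum_singleton]
    exact congrArg h (Subsingleton.elim _ _)
  | succ p ih =>
    have h1 := ih (h := fun k' => h (Fin.cons (k 0) k')) (fun k' t => by
      rw [hh _ t.succ]
      simp [Fin.cons_update]) (Fin.tail k)
    rw [Fin.cons_self_tail] at h1
    rw [h1, ← (Fin.consEquiv fun _ => Fin 2).sum_comp, Fintype.sum_prod_type, Finset.sum_comm]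
    refine Finset.sum_congr rfl fun j' _ => ?_
    rw [hh _ 0, Finset.mul_sum]
    refine Finset.sum_congr rfl fun j _ => ?_
    rw [Fin.prod_univ_succ, Fin.update_cons_zero]
    have e : (fun t => (((Fin.consEquiv fun _ => Fin 2) (j, j') t : ℕ) : ℤ)) =
        Fin.cons ((j : ℕ) : ℤ) fun t => ((j' t : ℕ) : ℤ) := by
      ext t
      cases t using Fin.cases <;> simp [Fin.consEquiv]
    rw [e]
    simp [Fin.consEquiv, Fin.tail]
    ring

/-- The point is that `u` and `v` do not depend on `x`: one region varies in a fixed surrounding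
diagram. -/
theorem exists_flatten_ofFn_update {p : ℕ} (A : Fin p → ℤ → List Slice) (k : Fin p → ℤ)
    (t : Fin p) : ∃ u v, ∀ x, (List.ofFn fun j => A j (Function.update k t x j)).flatten =
      u ++ A t x ++ v := by
  refine ⟨(((List.ofFn fun j => A j (k j)).take t)).flatten,
    ((List.ofFn fun j => A j (k j)).drop (t + 1)).flatten, fun x => ?_⟩
  have : (List.ofFn fun j => A j (Function.update k t x j)) =
      (List.ofFn fun j => A j (k j)).set t (A t x) := by
    refine List.ext_getElem (by simp) fun n h1 h2 => ?_
    rw [List.getElem_set]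
    split_ifs with h
    · subst h
      simp
    · simp only [List.getElem_ofFn]
      rw [Function.update_of_ne (fun h' => h (congrArg Fin.val h').symm)]
  rw [this, List.set_eq_take_append_cons_drop, if_pos (by simp)]
  simp

/-- Common form of both formulas: a closed braid has empty pieces `B` between its twist regions, a
twist family has an empty `u`. -/
theorem degenerate_expansion (hP : IsHomfly P) {p : ℕ} (u v : List Slice)
    (B : Fin p → List Slice) (l r : Fin p → List Bool) (e : Fin p → Bool)
    {L : (Fin p → ℤ) → LinkDiagram} (hL : ∀ k, (L k).word =
      u ++ (List.ofFn fun t => B t ++ twist (l t) (r t) (e t) (k t)).flatten ++ v)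
    (k : Fin p → ℤ) :
    degenerate P (L k) = ∑ j : Fin p → Fin 2, (∏ t, R (k t) (j t)) *
      degenerate P (L fun t => ((j t : ℕ) : ℤ)) := by
  refine eq_sum_prod_R_mul (h := fun k => degenerate P (L k)) (fun k t => ?_) k
  obtain ⟨u', v', h⟩ := exists_flatten_ofFn_update
    (fun t x => B t ++ twist (l t) (r t) (e t) x) k t
  have hw : ∀ x, (L (Function.update k t x)).word =
      (u ++ u' ++ B t) ++ twist (l t) (r t) (e t) x ++ (v' ++ v) := fun x => by
    rw [hL, h]
    simp
  have h1 := degenerate_twist hP hw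
  have := eq_sum_R_mul (f := fun x => degenerate P (L (Function.update k t x)))
    (fun x => h1 x) (k t)
  simpa only [Function.update_eq_self] using this

end OrientedLink

open OrientedLink LaurentPolynomial in
theorem theorem1p7 :
    (∃ P : LinkDiagram → HomflyRing, IsHomfly P) ∧
    ∀ P : LinkDiagram → HomflyRing, IsHomfly P →
      IsLinkInvariant (degenerate P) ∧
      degenerate P unknot = 1 ∧
      (∀ Lp Lm L0 : LinkDiagram, SkeinTriple Lp Lm L0 →
        T 1 * degenerate P Lp + T (-1) * degenerate P Lm - 2 * degenerate P L0 = 0) ∧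
      (∀ (n k : ℕ) (i : Fin k → Fin (n - 1)) (a : Fin k → ℤ),
        degenerate P (closedBraid n i a) =
          ∑ j : Fin k → Fin 2, (∏ t : Fin k, R (a t) (j t)) *
            degenerate P (closedBraid n i fun t => ((j t : ℕ) : ℤ))) ∧
      (∀ (p : ℕ) (L : TwistFamily p) (k : Fin p → ℤ),
        degenerate P (L.diagram k) =
          ∑ j : Fin p → Fin 2, (∏ t : Fin p, R (k t) (j t)) *
            degenerate P (L.diagram fun t => ((j t : ℕ) : ℤ))) := by
  refine ⟨⟨homfly, isHomfly_homfly⟩, fun P hP => ⟨fun L L' h => ?_, ?_,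
    fun _ _ _ => degenerate_skein hP, fun n k i a => ?_, fun p F k => ?_⟩⟩
  · exact congrArg specialize (hP.invariant L L' h)
  · exact (congrArg specialize hP.normalized).trans (map_one _)
  · exact degenerate_expansion hP (openArcs n) (closeArcs n) (fun _ => [])
      (fun t => List.replicate (i t) true)
      (fun t => List.replicate (n - 2 - i t) true ++ List.replicate n false) (fun _ => true)
      (L := closedBraid n i) (fun k => by simp [closedBraid, braidWord, braidPower]) a
  · exact degenerate_expansion hP [] F.below F.above F.left F.right F.orient
      (L := F.diagram) (fun k => by simp [TwistFamily.diagram]) k
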